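/- Let $K$ be either a finite field with the discrete topology or an $\ell$-adic field (a finite extension of $\mathbb{Q}_\ell$, for some prime $\ell$) with its $\ell$-adic topology, and let $L/K$ be a (possibly infinite) Galois extension with group $\Gamma=\mathrm{Gal}(L/K)$ (Krull topology), where $L$ carries the discrete, respectively the $\ell$-adic topology. Let $G$ be a finite or, more generally, a compact topological group. All representations and characters of $G$ are continuous. Let $\rho$ be a representation $G\to \mathrm{GL}_n(L)$ (the general linear case), or a representation $G\to\mathrm{GSp}_n(L)$ with $n$ even and multiplier character $m(\rho)$ (the symplectic case), and let $[\rho]$ be its equivalence class for conjugation by elements of $\mathrm{GL}_n(L)$, respectively of $\mathrm{GSp}_n(L)$. Let $\mathcal{E}$ be the group of characters $\epsilon:G\to L^\times$. The group $\mathcal{G}=\mathcal{E}\rtimes\Gamma$ of pairs $(\gamma,\epsilon)$, where $\Gamma$ acts on $\mathcal{E}$ by ${}^\gamma\epsilon=\gamma\circ\epsilon$, acts on equivalence classes by $(\gamma,\epsilon).[\rho]=[(\gamma\circ\rho)\otimes\epsilon^{-1}]$. Let $\mathcal{G}_{[\rho]}$ be the stabiliser of $[\rho]$ and put $$\Gamma_{[\rho]}=\{\gamma\in\Gamma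 : \exists\,\epsilon\in\mathcal{E},\ (\gamma,\epsilon)\in\mathcal{G}_{[\rho]}\},\quad \Delta_{[\rho]}=\{\gamma\in\Gamma : (\gamma,1)\in\mathcal{G}_{[\rho]}\},\quad K_{[\rho]}=L^{\Gamma_{[\rho]}},\quad E_{[\rho]}=L^{\Delta_{[\rho]}}.$$ One says that $[\rho]$ has no complex multiplication if $(1,\epsilon)\in\mathcal{G}_{[\rho]}$ only for $\epsilon=1$. Assume that $\rho$, as a linear representation, is absolutely irreducible if $K$ is finite, and residually absolutely irreducible if $K$ is $\ell$-adic. Let $\chi:G\to K^\times$ be a character and $\psi:G\to L^\times$ a character of finite order. In the symplectic case assume that $m(\rho)=\psi\chi$. In the general linear case assume that $\det\rho=\psi\chi$ and that $E_{[\rho]}$ contains the $n$-th roots of the values of $\psi$, i.e. every $x\in L$ such that $x^n=\psi(g)$ for some $g\in G$ lies in $E_{[\rho]}$. (a) $\Delta_{[\rho]}$ is an open normal subgroup of $\Gamma_{[\rho]}$, and $E_{[\rho]}/K_{[\rho]}$ is a finite Galois extension with Galois group $\Gamma_{[\rho]}/\Delta_{[\rho]}$ (the isomorphism being restriction of automorphisms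 to $E_{[\rho]}$). In particular $\gamma(E_{[\rho]})=E_{[\rho]}$ for all $\gamma\in\Gamma_{[\rho]}$. (b) In the symplectic case, assume moreover that $[\rho]$ has no complex multiplication. Then $[\rho]$ contains a representation that is defined over $E_{[\rho]}$ (i.e. with image in $\mathrm{GL}_n(E_{[\rho]})$, respectively $\mathrm{GSp}_n(E_{[\rho]})$), and $E_{[\rho]}$ is the smallest among the fields $K\subseteq F\subseteq L$ such that $[\rho]$ contains a representation defined over $F$. Moreover, $E_{[\rho]}$ is generated over $K$ by the traces $\mathrm{Tr}(\rho(g))$ for $g\in G$ in the general linear case, and by the traces $\mathrm{Tr}(\rho(g))$ and the multiplier values $m(\rho)(g)$ for $g\in G$ in the symplectic case. -/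

import Mathlib

open scoped Matrix MatrixGroups

namespace InnerTwist

universe u v w

/-! ### Coefficient fields -/

/-- The given topology of a field `F`, algebraic over `ℚ_[ℓ]`, is the `ℓ`-adic one, i.e. the one
defined by the unique extension to `F` of the absolute value of `ℚ_[ℓ]`. -/
def IsAdicTopology (ℓ : ℕ) [Fact ℓ.Prime] (F : Type u) [Field F] [TopologicalSpace F]
    [Algebra ℚ_[ℓ] F] : Prop :=
  ∀ x : F, (nhds x).HasBasis (fun r : ℝ => 0 < r)
    (fun r => {y : F | spectralNorm ℚ_[ℓ] F (y - x) < r})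

/-- The coefficient extensions `L/K`: either `K` is a finite field and everything is discrete, or
`K` is an `ℓ`-adic field, i.e. a finite extension of some `ℚ_[ℓ]`, and `K`, `L` carry the `ℓ`-adic
topology. (That `L` is algebraic over `ℚ_[ℓ]` is automatic when `L/K` is algebraic.) -/
class inductive CoefficientExtension (K : Type u) (L : Type v) [Field K] [Field L] [Algebra K L]
    [TopologicalSpace K] [TopologicalSpace L] : Type (max u v)
  | finite (finite_base : Finite K) (discrete_base : DiscreteTopology K)
      (discrete_top : DiscreteTopology L) : CoefficientExtension K L
  | adic (ℓ : ℕ) (prime : Fact ℓ.Prime) (algebra_base : Algebra ℚ_[ℓ] K)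
      (algebra_top : Algebra ℚ_[ℓ] L) (tower : IsScalarTower ℚ_[ℓ] K L)
      (finite_base : FiniteDimensional ℚ_[ℓ] K) (algebraic_top : Algebra.IsAlgebraic ℚ_[ℓ] L)
      (topology_base : IsAdicTopology ℓ K) (topology_top : IsAdicTopology ℓ L) :
      CoefficientExtension K L

theorem IsAdicTopology.eq {ℓ : ℕ} [Fact ℓ.Prime] {F : Type u} [Field F] [t : TopologicalSpace F]
    [Algebra ℚ_[ℓ] F] [Algebra.IsAlgebraic ℚ_[ℓ] F] (h : IsAdicTopology ℓ F) :
    t = (spectralNorm.uniformSpace ℚ_[ℓ] F).toTopologicalSpace := by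
  refine TopologicalSpace.ext_nhds fun x => ?_
  let _ := spectralNorm.normedField ℚ_[ℓ] F
  exact (h x).eq_of_same_basis Metric.nhds_basis_ball

theorem CoefficientExtension.isTopologicalRing (K : Type u) (L : Type v) [Field K] [Field L]
    [Algebra K L] [TopologicalSpace K] [t : TopologicalSpace L] [S : CoefficientExtension K L] :
    IsTopologicalRing L := by
  cases S with
  | finite _ _ _ => infer_instance
  | adic ℓ _ _ _ _ _ _ _ h =>
    let _ := spectralNorm.normedField ℚ_[ℓ] L
    have e := h.eq
    subst e
    exact (inferInstance : IsTopologicalRing L)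

theorem CoefficientExtension.continuous_galois {K : Type u} {L : Type v} [Field K] [Field L]
    [Algebra K L] [TopologicalSpace K] [t : TopologicalSpace L] [S : CoefficientExtension K L]
    (γ : Gal(L/K)) : Continuous γ := by
  cases S with
  | finite _ _ _ => exact continuous_of_discreteTopology
  | adic ℓ _ _ _ _ _ _ _ h =>
    refine continuous_iff_continuousAt.2 fun x => ?_
    refine ((h x).tendsto_iff (h (γ x))).2 fun r hr => ⟨r, hr, fun y hy => ?_⟩
    have := spectralNorm_eq_of_equiv (γ.restrictScalars ℚ_[ℓ]) (y - x)
    simp only [Set.mem_ofPred_eq] at hy ⊢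
    rw [← map_sub]
    rw [this] at hy
    exact hy

/-- The valuation ring of an algebraic extension of `ℚ_[ℓ]`. -/
noncomputable def adicIntegers (ℓ : ℕ) [Fact ℓ.Prime] (F : Type u) [Field F] [Algebra ℚ_[ℓ] F]
    [Algebra.IsAlgebraic ℚ_[ℓ] F] : ValuationSubring F where
  carrier := {x | spectralNorm ℚ_[ℓ] F x ≤ 1}
  mul_mem' {a b} ha hb := by
    have h := spectralAlgNorm_mul (K := ℚ_[ℓ]) a b
    simp only [spectralAlgNorm_def] at h
    simp only [Set.mem_ofPred_eq] at ha hb ⊢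
    rw [h]
    exact mul_le_one₀ ha (spectralNorm_nonneg b) hb
  one_mem' := (spectralNorm_one (K := ℚ_[ℓ])).le
  add_mem' {a b} ha hb :=
    (isNonarchimedean_spectralNorm (K := ℚ_[ℓ]) a b).trans (max_le ha hb)
  zero_mem' := by simp [spectralNorm_zero]
  neg_mem' {a} ha := by
    simp only [Set.mem_ofPred_eq] at ha ⊢
    rwa [spectralNorm_neg (Algebra.IsAlgebraic.isAlgebraic a)]
  mem_or_inv_mem' x := by
    by_cases hx : x = 0
    · left
      simp [hx, spectralNorm_zero]
    · have h := spectralAlgNorm_mul (K := ℚ_[ℓ]) x x⁻¹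
      simp only [spectralAlgNorm_def, mul_inv_cancel₀ hx, spectralNorm_one] at h
      by_cases h1 : spectralNorm ℚ_[ℓ] F x ≤ 1
      · exact Or.inl h1
      · right
        push Not at h1
        change spectralNorm ℚ_[ℓ] F x⁻¹ ≤ 1
        nlinarith [spectralNorm_nonneg (K := ℚ_[ℓ]) x⁻¹]

/-! ### Matrix representations and irreducibility -/

section Irreducible

variable {ι : Type w} [Fintype ι] [DecidableEq ι]

/-- The linear representation on column vectors given by a matrix representation. -/
def colRep {G F : Type*} [Group G] [Field F] (ρ : G →* GL ι F) : Representation F G (ι → F) :=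
  (Matrix.toLinAlgEquiv' : Matrix ι ι F ≃ₐ[F] Module.End F (ι → F)).toAlgHom.toMonoidHom'.comp
    ((Units.coeHom _).comp ρ)

/-- A matrix representation is absolutely irreducible if it is irreducible over an algebraic
closure. -/
def IsAbsIrreducible {G F : Type*} [Group G] [Field F] (ρ : G →* GL ι F) : Prop :=
  (colRep ((Matrix.GeneralLinearGroup.map (algebraMap F (AlgebraicClosure F))).comp
    ρ)).IsIrreducible

/-- Residual absolute irreducibility with respect to a valuation ring `O` of `F`: some conjugate
of `ρ` has entries in `O`, and its reduction modulo the maximal ideal is absolutely irreducible. -/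
def IsResiduallyAbsIrreducible {G F : Type*} [Group G] [Field F] (O : ValuationSubring F)
    (ρ : G →* GL ι F) : Prop :=
  ∃ (M : GL ι F) (ρ₀ : G →* GL ι O),
    (∀ g, Matrix.GeneralLinearGroup.map (algebraMap O F) (ρ₀ g) = M⁻¹ * ρ g * M) ∧
      IsAbsIrreducible ((Matrix.GeneralLinearGroup.map (IsLocalRing.residue O)).comp ρ₀)

/-- "(Residually) absolutely irreducible": absolutely irreducible if `K` is a finite field,
residually absolutely irreducible if `K` is an `ℓ`-adic field. -/
def IsResAbsIrreducible (K : Type u) {L : Type v} [Field K] [Field L] [Algebra K L]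
    [TopologicalSpace K] [TopologicalSpace L] [S : CoefficientExtension K L]
    {G : Type*} [Group G] (ρ : G →* GL ι L) : Prop :=
  match S with
  | .finite _ _ _ => IsAbsIrreducible ρ
  | .adic ℓ _ _ _ _ _ _ _ _ => IsResiduallyAbsIrreducible (adicIntegers ℓ L) ρ

end Irreducible

/-! ### General symplectic groups -/

/-- The general symplectic group of symplectic similitudes of size `2m`. -/
def GSp (m : ℕ) (F : Type u) [Field F] : Subgroup (GL (Fin m ⊕ Fin m) F) where
  carrier := {A | ∃ c : Fˣ, A.valᵀ * Matrix.J (Fin m) F * A.val = (c : F) • Matrix.J (Fin m) F}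
  one_mem' := ⟨1, by simp⟩
  mul_mem' := by
    rintro A B ⟨c, hc⟩ ⟨d, hd⟩
    refine ⟨c * d, ?_⟩
    calc (A * B).valᵀ * Matrix.J (Fin m) F * (A * B).val
        = B.valᵀ * (A.valᵀ * Matrix.J (Fin m) F * A.val) * B.val := by
          simp [Matrix.transpose_mul, Matrix.mul_assoc]
      _ = _ := by rw [hc]; simp [hd, smul_smul]
  inv_mem' := by
    rintro A ⟨c, hc⟩
    refine ⟨c⁻¹, ?_⟩
    have h1 : A.val * (A⁻¹).val = 1 := A.mul_inv
    have h2 : (A⁻¹).valᵀ * A.valᵀ = 1 := by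
      rw [← Matrix.transpose_mul, h1, Matrix.transpose_one]
    have h3 : Matrix.J (Fin m) F =
        (c : F) • ((A⁻¹).valᵀ * Matrix.J (Fin m) F * (A⁻¹).val) := by
      calc Matrix.J (Fin m) F
          = ((A⁻¹).valᵀ * A.valᵀ) * Matrix.J (Fin m) F * (A.val * (A⁻¹).val) := by
            rw [h1, h2]; simp
        _ = (A⁻¹).valᵀ * (A.valᵀ * Matrix.J (Fin m) F * A.val) * (A⁻¹).val := by
            simp only [Matrix.mul_assoc]
        _ = _ := by rw [hc]; simp only [Matrix.mul_smul, Matrix.smul_mul]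
    conv_rhs => rw [h3]
    rw [smul_smul]
    simp

/-- The multiplier of a symplectic similitude (uniquely determined as soon as `0 < m`). -/
noncomputable def multiplier {m : ℕ} {F : Type u} [Field F] (A : GSp m F) : Fˣ := A.2.choose

theorem multiplier_spec {m : ℕ} {F : Type u} [Field F] (A : GSp m F) :
    A.1.valᵀ * Matrix.J (Fin m) F * A.1.val = (multiplier A : F) • Matrix.J (Fin m) F :=
  A.2.choose_spec

theorem multiplier_eq {m : ℕ} (hm : 0 < m) {F : Type u} [Field F] (A : GSp m F) (c : Fˣ)
    (hc : A.1.valᵀ * Matrix.J (Fin m) F * A.1.val = (c : F) • Matrix.J (Fin m) F) :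
    multiplier A = c := by
  have h := congrFun (congrFun ((multiplier_spec A).symm.trans hc) (Sum.inr ⟨0, hm⟩))
    (Sum.inl ⟨0, hm⟩)
  simpa [Matrix.J, Units.val_inj] using h

/-! ### Continuous representations, equivalence classes -/

variable {ι : Type w} [Fintype ι] [DecidableEq ι]

/-- Continuous representations of `G` with values in a subgroup `H` of `GL ι F`. -/
structure Rep (G : Type*) [Group G] [TopologicalSpace G] {F : Type*} [Field F]
    [TopologicalSpace F] (H : Subgroup (GL ι F)) where
  hom : G →* GL ι F
  continuous_hom : Continuous hom
  mem : ∀ g, hom g ∈ H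

/-- Equivalence of representations `G → H`: conjugation by an element of `H`. -/
def Rep.setoid (G : Type*) [Group G] [TopologicalSpace G] {F : Type*} [Field F]
    [TopologicalSpace F] (H : Subgroup (GL ι F)) : Setoid (Rep G H) where
  r ρ₁ ρ₂ := ∃ M ∈ H, ∀ g, ρ₁.hom g = M * ρ₂.hom g * M⁻¹
  iseqv :=
    { refl := fun _ => ⟨1, H.one_mem, by simp⟩
      symm := by
        rintro ρ₁ ρ₂ ⟨M, hM, h⟩
        exact ⟨M⁻¹, H.inv_mem hM, fun g => by rw [h g]; group⟩
      trans := by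
        rintro ρ₁ ρ₂ ρ₃ ⟨M, hM, h⟩ ⟨N, hN, h'⟩
        exact ⟨M * N, H.mul_mem hM hN, fun g => by rw [h g, h' g]; group⟩ }

/-- The set of equivalence classes of continuous representations `G → H`. -/
def RepClass (G : Type*) [Group G] [TopologicalSpace G] {F : Type*} [Field F]
    [TopologicalSpace F] (H : Subgroup (GL ι F)) : Type _ := Quotient (Rep.setoid G H)

/-- The equivalence class `[ρ]`. -/
def Rep.toClass {G : Type*} [Group G] [TopologicalSpace G] {F : Type*} [Field F]
    [TopologicalSpace F] {H : Subgroup (GL ι F)} (ρ : Rep G H) : RepClass G H :=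
  Quotient.mk (Rep.setoid G H) ρ

theorem Rep.ext {G : Type*} [Group G] [TopologicalSpace G] {F : Type*} [Field F]
    [TopologicalSpace F] {H : Subgroup (GL ι F)} {ρ₁ ρ₂ : Rep G H}
    (h : ∀ g, ρ₁.hom g = ρ₂.hom g) : ρ₁ = ρ₂ := by
  cases ρ₁; cases ρ₂
  congr
  exact MonoidHom.ext h

/-! ### The group of pairs `(γ, ε)` and its action -/

variable (K : Type u) (L : Type v) [Field K] [Field L] [Algebra K L]
  [TopologicalSpace K] [TopologicalSpace L] [CoefficientExtension K L]
  (G : Type*) [Group G] [TopologicalSpace G]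

/-- The group of continuous characters `ε : G → Lˣ`. -/
def characters : Subgroup (G →* Lˣ) where
  carrier := {ε | Continuous ε}
  one_mem' := continuous_const
  mul_mem' {a b} ha hb := by
    have := CoefficientExtension.isTopologicalRing K L
    exact Continuous.mul ha hb
  inv_mem' {a} ha := by
    have := CoefficientExtension.isTopologicalRing K L
    exact Continuous.inv (G := Lˣ) ha

/-- The action `ε ↦ γ ∘ ε` of the Galois group on characters. -/
noncomputable def characterAction : Gal(L/K) →* MulAut (characters K L G) where
  toFun γ :=
    { toFun := fun ε => ⟨(Units.map (γ : L →* L)).comp ε.1,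
        (Continuous.units_map _ (CoefficientExtension.continuous_galois γ)).comp ε.2⟩
      invFun := fun ε => ⟨(Units.map ((γ⁻¹ : Gal(L/K)) : L →* L)).comp ε.1,
        (Continuous.units_map _ (CoefficientExtension.continuous_galois γ⁻¹)).comp ε.2⟩
      left_inv := fun ε => by
        ext g
        exact γ.symm_apply_apply _
      right_inv := fun ε => by
        ext g
        exact γ.apply_symm_apply _
      map_mul' := fun ε₁ ε₂ => by
        ext g
        simp }
  map_one' := by
    ext ε g
    rfl
  map_mul' γ₁ γ₂ := by
    ext ε g
    rfl

/-- The semidirect product of the group of characters and the Galois group; the pair `(γ, ε)` is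
the element with `left = ε` and `right = γ`. -/
abbrev TwistGroup : Type _ := characters K L G ⋊[characterAction K L G] Gal(L/K)

variable {L}

/-- Subgroups of `GL ι L` that are stable under `Gal(L/K)` and contain the scalar matrices. -/
class IsTwistStable (H : Subgroup (GL ι L)) : Prop where
  galois_mem : ∀ (γ : Gal(L/K)) (A : GL ι L), A ∈ H →
    Matrix.GeneralLinearGroup.map (γ : L →+* L) A ∈ H
  scalar_mem : ∀ c : Lˣ, Matrix.GeneralLinearGroup.scalar ι c ∈ H

instance isTwistStable_top : IsTwistStable K (⊤ : Subgroup (GL ι L)) where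
  galois_mem _ _ _ := Subgroup.mem_top _
  scalar_mem _ := Subgroup.mem_top _

instance isTwistStable_GSp (m : ℕ) : IsTwistStable K (GSp m L) where
  galois_mem := by
    rintro γ A ⟨c, hc⟩
    refine ⟨Units.map (γ : L →* L) c, ?_⟩
    have h := congrArg (fun B => B.map (γ : L →+* L)) hc
    simpa [Matrix.map_mul, Matrix.transpose_map, Matrix.map_smul'] using h
  scalar_mem := by
    intro c
    refine ⟨c * c, ?_⟩
    change (Matrix.scalar _ (c : L))ᵀ * Matrix.J (Fin m) L * Matrix.scalar _ (c : L) = _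
    simp [Matrix.scalar_apply, ← Matrix.smul_one_eq_diagonal, smul_smul]

variable {K G}

theorem scalar_mul_comm {L : Type v} [Field L] (c : Lˣ) (A : GL ι L) :
    Matrix.GeneralLinearGroup.scalar ι c * A = A * Matrix.GeneralLinearGroup.scalar ι c := by
  refine Units.ext ?_
  exact (Matrix.scalar_comm (c : L) (fun r => Commute.all _ r) A.val)

/-- The representation `(γ ∘ ρ) ⊗ ε⁻¹`. -/
noncomputable def twist {H : Subgroup (GL ι L)} [IsTwistStable K H] (x : TwistGroup K L G)
    (ρ : Rep G H) : Rep G H where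
  hom :=
    { toFun := fun g => Matrix.GeneralLinearGroup.map (x.right : L →+* L) (ρ.hom g) *
        Matrix.GeneralLinearGroup.scalar ι (x.left.1 g)⁻¹
      map_one' := by simp
      map_mul' := fun g h => by
        rw [map_mul, map_mul, map_mul, mul_inv, map_mul]
        simp only [mul_assoc]
        congr 1
        rw [scalar_mul_comm (x.left.1 g)⁻¹, scalar_mul_comm (x.left.1 g)⁻¹ (_ * _), mul_assoc] }
  continuous_hom := by
    have := CoefficientExtension.isTopologicalRing K L
    have hγ : Continuous (Matrix.GeneralLinearGroup.map (n := ι) (x.right : L →+* L)) :=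
      Continuous.units_map _
        (Continuous.matrix_map continuous_id (CoefficientExtension.continuous_galois x.right))
    have hs : Continuous (Matrix.GeneralLinearGroup.scalar (R := L) ι) :=
      Continuous.units_map _ (by
        change Continuous fun a : L => Matrix.diagonal fun _ => a
        fun_prop)
    exact (hγ.comp ρ.continuous_hom).mul (hs.comp (Continuous.inv (G := Lˣ) x.left.2))
  mem g := H.mul_mem (IsTwistStable.galois_mem _ _ (ρ.mem g)) (IsTwistStable.scalar_mem K _)

/-- The action `(γ, ε) • [ρ] = [(γ ∘ ρ) ⊗ ε⁻¹]` on equivalence classes. -/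
noncomputable instance twistAction (H : Subgroup (GL ι L)) [IsTwistStable K H] :
    MulAction (TwistGroup K L G) (RepClass G H) where
  smul x := Quotient.map (sa := Rep.setoid G H) (sb := Rep.setoid G H) (twist x) (by
    rintro ρ₁ ρ₂ ⟨M, hM, h⟩
    refine ⟨Matrix.GeneralLinearGroup.map (x.right : L →+* L) M,
      IsTwistStable.galois_mem _ _ hM, fun g => ?_⟩
    change Matrix.GeneralLinearGroup.map (x.right : L →+* L) (ρ₁.hom g) *
        Matrix.GeneralLinearGroup.scalar ι (x.left.1 g)⁻¹ = _ *
      (Matrix.GeneralLinearGroup.map (x.right : L →+* L) (ρ₂.hom g) *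
        Matrix.GeneralLinearGroup.scalar ι (x.left.1 g)⁻¹) * _
    rw [h g, map_mul, map_mul, map_inv]
    simp only [mul_assoc]
    rw [scalar_mul_comm])
  one_smul q := by
    refine Quotient.inductionOn q fun ρ => congrArg Rep.toClass (Rep.ext fun g => ?_)
    change Matrix.GeneralLinearGroup.map _ (ρ.hom g) *
      Matrix.GeneralLinearGroup.scalar ι (1 : Lˣ)⁻¹ = _
    rw [inv_one, map_one, mul_one]
    rfl
  mul_smul x y q := by
    refine Quotient.inductionOn q fun ρ => congrArg Rep.toClass (Rep.ext fun g => ?_)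
    change Matrix.GeneralLinearGroup.map _ (ρ.hom g) * Matrix.GeneralLinearGroup.scalar ι
        (x.left.1 g * Units.map (x.right : L →* L) (y.left.1 g))⁻¹ =
      Matrix.GeneralLinearGroup.map (x.right : L →+* L)
        (Matrix.GeneralLinearGroup.map (y.right : L →+* L) (ρ.hom g) *
          Matrix.GeneralLinearGroup.scalar ι (y.left.1 g)⁻¹) *
        Matrix.GeneralLinearGroup.scalar ι (x.left.1 g)⁻¹
    have e : ∀ u : Lˣ, Matrix.GeneralLinearGroup.map (x.right : L →+* L)
        (Matrix.GeneralLinearGroup.scalar ι u) =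
        Matrix.GeneralLinearGroup.scalar ι (Units.map (x.right : L →* L) u) :=
      fun u => Matrix.GeneralLinearGroup.map_scalar _ _
    rw [map_mul, mul_inv_rev, map_mul, mul_assoc, e,
      map_inv (Units.map (x.right : L →* L))]
    rfl

/-! ### The groups and fields attached to a class -/

variable (K) {H : Subgroup (GL ι L)} [IsTwistStable K H]

/-- The group of inner twists of a class: its stabiliser. -/
noncomputable def innerTwists (c : RepClass G H) : Subgroup (TwistGroup K L G) :=
  MulAction.stabilizer (TwistGroup K L G) c

/-- `Γ_[ρ]`: the image of the group of inner twists in `Gal(L/K)`. -/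
noncomputable def groupΓ (c : RepClass G H) : Subgroup Gal(L/K) :=
  (innerTwists K c).map SemidirectProduct.rightHom

/-- `Δ_[ρ]`: the group of all `γ` such that `(γ, 1)` is an inner twist. -/
noncomputable def groupΔ (c : RepClass G H) : Subgroup Gal(L/K) :=
  (innerTwists K c).comap SemidirectProduct.inr

/-- `𝓔_[ρ]`: the group of all `ε` such that `(1, ε)` is an inner twist. -/
noncomputable def groupE (c : RepClass G H) : Subgroup (characters K L G) :=
  (innerTwists K c).comap SemidirectProduct.inl

/-- The class has no complex multiplication. -/
def NoCM (c : RepClass G H) : Prop := groupE K c = ⊥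

/-- `K_[ρ]`: the fixed field of `Γ_[ρ]`. -/
noncomputable def fieldK (c : RepClass G H) : IntermediateField K L :=
  IntermediateField.fixedField (groupΓ K c)

/-- `E_[ρ]`: the fixed field of `Δ_[ρ]`. -/
noncomputable def fieldE (c : RepClass G H) : IntermediateField K L :=
  IntermediateField.fixedField (groupΔ K c)

variable {K}

/-- `ρ` is defined over the intermediate field `F`: it factors through a continuous representation
with values in `HF`, a subgroup of `GL ι F`. -/
def Rep.DefinedOver (ρ : Rep G H) (F : IntermediateField K L) (HF : Subgroup (GL ι F)) : Prop :=
  ∃ σ : Rep G HF, ∀ g, ρ.hom g = Matrix.GeneralLinearGroup.map (algebraMap F L) (σ.hom g)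

/-- The multiplier character of a symplectic representation. -/
noncomputable def Rep.mult {m : ℕ} (ρ : Rep G (GSp m L)) (g : G) : Lˣ :=
  multiplier ⟨ρ.hom g, ρ.mem g⟩

end InnerTwist

/-!
Everything rests on one consequence of (residual) absolute irreducibility: the image of `ρ` is
separating for the trace form (`TraceSeparating`), that is, it spans the full matrix algebra. In the
residual case a matrix orthogonal to the image could be scaled to be integral and nonzero modulo the
maximal ideal. Separation gives Schur's lemma, and with Skolem-Noether it shows that two such
representations with the same traces are conjugate (`TraceSeparating.exists_conj`). Hence `γ ∈ Δ` if
and only if `γ` fixes the traces and, in the symplectic case, the multipliers, as an invariant form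
is unique up to a scalar. So `Δ` is the Galois group of `L` over the field `F` generated by these
values, and `E = F` by infinite Galois theory.

For (a), let `(γ, ε)` be an inner twist. Comparing determinants (multipliers) gives
`ε ^ n = γ ψ / ψ` (respectively `ε ^ 2 = γ ψ / ψ`), whose values are values of `ψ`, because `γ` acts on roots of
unity by raising to powers. So the values of `ε` are roots of unity of bounded order. They are fixed
by `Δ`: in the linear case by the hypothesis on `n`-th roots, in the symplectic case because `Δ`
fixes `ψ` and the square root of `γ ψ / ψ` is up to sign a power of a value of `ψ`. Therefore `Δ` is
normal in `Γ` (`normal_groupΔ_subgroupOf`). Moreover the `ε` are all trivial on one neighbourhood of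
the identity. In the finite case this is the kernel of `ρ`. In the `ℓ`-adic case the trace is close
to `n ≠ 0` near the identity, and `γ (Tr ρ) = ε Tr ρ` with `γ` an isometry forces `ε` to be close to
`1`. As `G` is compact, only finitely many `ε` occur, so `Γ / Δ` is finite, and Artin's theorem
gives `galois_structure`.

For (b), a field of definition contains the traces and multipliers, so `E` has to be shown to be
one. It suffices to find an idempotent `v wᵀ` of rank one, `wᵀ v = 1`, in the `E`-span `A` of the
image: the vectors `ρ g v` then form an `E`-structure, since the pairings `wᵀ ρ g v` are traces of
elements of `A` (`exists_conj_eq_map`). If `K` is finite, only finitely many traces occur, so they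
generate a finite field, over which one takes an idempotent `e` of minimal rank: the corner `e A e`
is a finite division ring, hence commutative by Wedderburn's theorem, and so `e` has rank one
(`exists_rank_one_mem_imageAlgebra`). If `K` is `ℓ`-adic, apply this to the residual representation
over the finite field of its traces and lift the idempotent to an integral matrix of `A`. Its
characteristic polynomial has coefficients in `E` and reduces to `X ^ n - X ^ (n - 1)`, so Hensel's
lemma for algebraic extensions of `ℚ_[ℓ]` provides a simple eigenvalue in `E`, and the projection
onto its eigenline is a polynomial in the matrix (`exists_rank_one_of_isResiduallyAbsIrreducible`).
In the symplectic case the invariant form transported to the descended representation is, by Schur's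
lemma, a multiple of a form over `E`, and a symplectic basis for it over `E` turns the conjugating
matrix into a symplectic similitude (`exists_GSp_conj_eq_map`).
-/

namespace InnerTwist

open Matrix

/-! ### Representations separated by the trace form -/

/-- The image of `ρ` is separating for the trace form: only the zero matrix is orthogonal to it.
Equivalently, the matrices `ρ g` span the full matrix algebra. -/
def TraceSeparating {ι G F : Type*} [Fintype ι] [DecidableEq ι] [Group G] [Field F]
    (ρ : G →* GL ι F) : Prop :=
  ∀ B : Matrix ι ι F, (∀ g, trace (B * (ρ g).val) = 0) → B = 0

section TraceForm

variable {ι G F : Type*} [Fintype ι] [DecidableEq ι] [Group G] [Field F]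

/-- Irreducible representations are nonzero, so the size of the matrices is positive. -/
theorem nonempty_of_isAbsIrreducible {ρ : G →* GL ι F} (h : IsAbsIrreducible ρ) : Nonempty ι := by
  by_contra hι
  rw [not_nonempty_iff] at hι
  obtain ⟨a, b, hab⟩ := h.toNontrivial
  exact hab (Subrepresentation.toSubmodule_injective (Subsingleton.elim _ _))

/-- Burnside's theorem over an algebraically closed field, obtained from Jacobson density: the
endomorphisms of a finite-dimensional simple module are scalars, so everything commutes with
them. -/
theorem exists_asAlgebraHom_eq_of_isIrreducible {V : Type*} [IsAlgClosed F] [AddCommGroup V]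
    [Module F V] [FiniteDimensional F V] (σ : Representation F G V) (h : σ.IsIrreducible)
    (f : Module.End F V) : ∃ a, σ.asAlgebraHom a = f := by
  have hb := IsSimpleModule.algebraMap_end_bijective_of_isAlgClosed (A := MonoidAlgebra F G)
    (V := σ.asModule) F
  let f' : Module.End (Module.End (MonoidAlgebra F G) σ.asModule) σ.asModule :=
    { toFun := fun x => σ.asModuleEquiv.symm (f (σ.asModuleEquiv x))
      map_add' := fun x y => by simp
      map_smul' := fun c x => by
        obtain ⟨c, rfl⟩ := hb.2 c
        simp }
  obtain ⟨s, hs⟩ := Module.Finite.fg_top (R := F) (M := V)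
  obtain ⟨r, hr⟩ := jacobson_density f' (s.map σ.asModuleEquiv.symm.toEquiv.toEmbedding)
  refine ⟨r, LinearMap.ext_on hs fun x hx => ?_⟩
  have := hr (σ.asModuleEquiv.symm x) (Finset.mem_map_of_mem _ hx)
  have h2 := congrArg σ.asModuleEquiv this
  rw [Representation.asModuleEquiv_map_smul] at h2
  simpa [f'] using h2.symm

/-- A matrix orthogonal to the image is orthogonal to its span over an algebraic closure, which is
the full matrix algebra by Burnside's theorem. -/
theorem traceSeparating_of_isAbsIrreducible {ρ : G →* GL ι F} (h : IsAbsIrreducible ρ) :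
    TraceSeparating ρ := by
  intro B hB
  let F' := AlgebraicClosure F
  let B' : Matrix ι ι F' := B.map (algebraMap F F')
  suffices hB' : B' = 0 by
    ext i j
    have : algebraMap F F' (B i j) = 0 := congrFun (congrFun hB' i) j
    exact (map_eq_zero _).1 this
  rw [Matrix.ext_iff_trace_mul_right]
  intro X
  obtain ⟨a, ha⟩ := exists_asAlgebraHom_eq_of_isIrreducible _ h (Matrix.toLin' X)
  rw [← LinearMap.toMatrix'_toLin' X, ← ha, zero_mul, trace_zero]
  clear ha
  induction a using MonoidAlgebra.induction_linear with
  | zero => simp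
  | add x y hx hy => rw [map_add, map_add, mul_add, trace_add, hx, hy, add_zero]
  | single g c =>
    have e : LinearMap.toMatrix' (colRep ((Matrix.GeneralLinearGroup.map
        (algebraMap F (AlgebraicClosure F))).comp ρ) g) = (ρ g).val.map (algebraMap F F') := by
      change LinearMap.toMatrix' (Matrix.toLin' _) = _
      rw [LinearMap.toMatrix'_toLin']
      rfl
    rw [Representation.asAlgebraHom_single, map_smul, e, Matrix.mul_smul, trace_smul,
      ← Matrix.map_mul, ← AddMonoidHom.map_trace, hB]
    simp

theorem TraceSeparating.span_eq_top {ρ : G →* GL ι F} (h : TraceSeparating ρ) :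
    Submodule.span F (Set.range fun g => (ρ g).val) = ⊤ := by
  by_contra hne
  obtain ⟨f, hf, hle⟩ := Submodule.exists_le_ker_of_lt_top _ (lt_top_iff_ne_top.2 hne)
  -- The functional `f` is `X ↦ tr (B * X)` for the matrix `B` of its values on matrix units.
  let B : Matrix ι ι F := Matrix.of fun i j => f (Matrix.single j i 1)
  have hfB : ∀ X, f X = trace (B * X) := by
    intro X
    conv_lhs => rw [Matrix.matrix_eq_sum_single X]
    rw [map_sum]
    simp only [map_sum, trace, diag_apply, mul_apply, B, of_apply]
    rw [Finset.sum_comm]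
    refine Finset.sum_congr rfl fun i _ => Finset.sum_congr rfl fun j _ => ?_
    rw [mul_comm, ← smul_eq_mul, ← map_smul, Matrix.smul_single, smul_eq_mul, mul_one]
  have hB := h B fun g => by
    rw [← hfB]
    exact hle (Submodule.subset_span ⟨g, rfl⟩)
  exact hf (LinearMap.ext fun X => by rw [hfB, hB]; simp)

/-- Schur's lemma. -/
theorem TraceSeparating.exists_eq_smul_one {ρ : G →* GL ι F} (h : TraceSeparating ρ)
    {B : Matrix ι ι F} (hB : ∀ g, B * (ρ g).val = (ρ g).val * B) : ∃ c : F, B = c • 1 := by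
  have hall : ∀ X, Commute X B := by
    intro X
    have hX : X ∈ Submodule.span F (Set.range fun g => (ρ g).val) := by simp [h.span_eq_top]
    induction hX using Submodule.span_induction with
    | mem x hx => obtain ⟨g, rfl⟩ := hx; exact (hB g).symm
    | zero => simp
    | add x y _ _ hx hy => exact hx.add_left hy
    | smul c x _ hx => exact hx.smul_left c
  obtain ⟨c, hc⟩ := Matrix.mem_range_scalar_of_commute_single (M := B)
    fun i j _ => hall _
  exact ⟨c, by rw [← hc, Matrix.scalar_apply, Matrix.smul_one_eq_diagonal]⟩

/-- Representations with separating image and equal characters are conjugate: both define the same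
kernel in the group algebra, and automorphisms of the matrix algebra are inner. -/
theorem TraceSeparating.exists_conj {ρ ρ' : G →* GL ι F} (h : TraceSeparating ρ)
    (h' : TraceSeparating ρ') (ht : ∀ g, trace (ρ' g).val = trace (ρ g).val) :
    ∃ M : GL ι F, ∀ g, ρ' g = M * ρ g * M⁻¹ := by
  let lift (σ : G →* GL ι F) : MonoidAlgebra F G →ₐ[F] Matrix ι ι F :=
    MonoidAlgebra.lift F _ G ((Units.coeHom _).comp σ)
  have lift_single : ∀ σ g c, lift σ (MonoidAlgebra.single g c) = c • (σ g).val := fun σ g c => by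
    simp [lift]
  have hsurj : ∀ σ, TraceSeparating σ → Function.Surjective (lift σ) := by
    intro σ hσ
    rw [← AlgHom.range_eq_top, ← Algebra.toSubmodule_eq_top, eq_top_iff, ← hσ.span_eq_top,
      Submodule.span_le]
    rintro _ ⟨g, rfl⟩
    exact ⟨MonoidAlgebra.single g 1, by simpa using lift_single σ g 1⟩
  have htr : ∀ x, trace (lift ρ' x) = trace (lift ρ x) := by
    intro x
    induction x using MonoidAlgebra.induction_linear with
    | zero => simp
    | add x y hx hy => simp [hx, hy]
    | single g c => simp [lift_single, ht]
  -- The kernel on the group algebra is the radical of the trace form, so it depends only on the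
  -- character.
  have hker' : ∀ σ, TraceSeparating σ → ∀ x, lift σ x = 0 ↔ ∀ g, trace (lift σ
      (x * MonoidAlgebra.single g 1)) = 0 := by
    intro σ hσ x
    refine ⟨fun hx g => by rw [map_mul, hx]; simp, fun hx => hσ _ fun g => ?_⟩
    simpa [map_mul, lift_single] using hx g
  have hker : RingHom.ker (lift ρ) = RingHom.ker (lift ρ') := by
    ext x
    rw [RingHom.mem_ker, RingHom.mem_ker, hker' ρ h, hker' ρ' h']
    simp only [htr]
  let φ : Matrix ι ι F ≃ₐ[F] Matrix ι ι F :=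
    (Ideal.quotientKerAlgEquivOfSurjective (hsurj ρ h)).symm.trans
      ((Ideal.quotientEquivAlgOfEq F hker).trans
        (Ideal.quotientKerAlgEquivOfSurjective (hsurj ρ' h')))
  have hφ : ∀ g, φ (ρ g).val = (ρ' g).val := by
    intro g
    have h1 : (ρ g).val = Ideal.quotientKerAlgEquivOfSurjective (hsurj ρ h)
        (Ideal.Quotient.mk _ (MonoidAlgebra.single g 1)) := by
      change _ = lift ρ _
      rw [lift_single, one_smul]
    rw [h1]
    simp only [φ, AlgEquiv.trans_apply, AlgEquiv.symm_apply_apply]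
    change lift ρ' (MonoidAlgebra.single g 1) = _
    rw [lift_single, one_smul]
  -- Skolem-Noether for the automorphism `φ` of the matrix algebra.
  obtain ⟨T, hT⟩ := ((Matrix.toLinAlgEquiv'.symm.trans φ).trans
    Matrix.toLinAlgEquiv').eq_linearEquivConjAlgEquiv
  let M : GL ι F := Units.map (Matrix.toLinAlgEquiv' (R := F) (n := ι)).symm.toMonoidHom
    (LinearMap.GeneralLinearGroup.ofLinearEquiv T)
  refine ⟨M, fun g => ?_⟩
  rw [eq_mul_inv_iff_mul_eq]
  refine Units.ext ((Matrix.toLinAlgEquiv' (R := F) (n := ι)).injective ?_)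
  have h2 := congrArg (fun f => f (Matrix.toLinAlgEquiv' (ρ g).val)) hT
  simp only [AlgEquiv.trans_apply, AlgEquiv.symm_apply_apply, hφ] at h2
  have hM : Matrix.toLinAlgEquiv' M.val = (T : (ι → F) →ₗ[F] (ι → F)) :=
    AlgEquiv.apply_symm_apply _ _
  rw [Units.val_mul, Units.val_mul, map_mul, map_mul, h2, hM]
  refine LinearMap.ext fun x => ?_
  simp [LinearEquiv.conjAlgEquiv_apply, Module.End.mul_apply]

theorem TraceSeparating.map_equiv {ρ : G →* GL ι F} (h : TraceSeparating ρ) (γ : F ≃+* F) :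
    TraceSeparating ((Matrix.GeneralLinearGroup.map (γ : F →+* F)).comp ρ) := by
  intro B hB
  have h1 := h (B.map γ.symm) fun g => by
    refine γ.injective ?_
    rw [map_zero, ← hB g]
    have : B = (B.map γ.symm).map γ := by ext; simp
    conv_rhs => rw [this]
    exact (AddMonoidHom.map_trace (γ : F →+ F) _).trans (congrArg trace
      (Matrix.map_mul (f := (γ : F →+* F))))
  ext i j
  have := congrFun (congrFun h1 i) j
  simpa using this

/-- Separation of `ρ` passes to any representation `ρ'` conjugate to it. -/
theorem TraceSeparating.of_conj {ρ ρ' : G →* GL ι F} (h : TraceSeparating ρ) (M : GL ι F)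
    (hM : ∀ g, ρ g = M⁻¹ * ρ' g * M) : TraceSeparating ρ' := by
  intro B hB
  have h1 := h (M⁻¹.val * B * M.val) fun g => by
    rw [hM, ← hB g]
    simp only [Units.val_mul]
    have : M⁻¹.val * B * M.val * (M⁻¹.val * (ρ' g).val * M.val) =
        M⁻¹.val * (B * (M.val * M⁻¹.val) * (ρ' g).val * M.val) := by
      simp only [Matrix.mul_assoc]
    rw [this, ← Units.val_mul, mul_inv_cancel, Units.val_one, mul_one, trace_mul_comm,
      Matrix.mul_assoc, ← Units.val_mul, mul_inv_cancel, Units.val_one, mul_one]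
  have h2 : M.val * (M⁻¹.val * B * M.val) * M⁻¹.val = B := by
    have : M.val * (M⁻¹.val * B * M.val) * M⁻¹.val =
        (M.val * M⁻¹.val) * B * (M.val * M⁻¹.val) := by simp only [Matrix.mul_assoc]
    rw [this, ← Units.val_mul, mul_inv_cancel]; simp
  rw [← h2, h1]; simp

end TraceForm

/-! ### Galois theory of the inner twists -/

section Structure

variable {ι K L G : Type*} [Fintype ι] [DecidableEq ι] [Field K] [Field L] [Algebra K L]
  [TopologicalSpace K] [TopologicalSpace L] [CoefficientExtension K L]
  [Group G] [TopologicalSpace G] {H : Subgroup (GL ι L)} [IsTwistStable K H]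

theorem mem_groupΔ {c : RepClass G H} {γ : Gal(L/K)} :
    γ ∈ groupΔ K c ↔ (SemidirectProduct.inr γ : TwistGroup K L G) ∈ innerTwists K c := Iff.rfl

theorem mem_groupΓ {c : RepClass G H} {γ : Gal(L/K)} :
    γ ∈ groupΓ K c ↔ ∃ x ∈ innerTwists K c, x.right = γ := Iff.rfl

theorem groupΔ_le_groupΓ (c : RepClass G H) : groupΔ K c ≤ groupΓ K c :=
  fun γ hγ => ⟨SemidirectProduct.inr γ, hγ, rfl⟩

/-- `Δ` is normal in `Γ` as soon as it fixes the values of all characters occurring in inner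
twists: then conjugating `(δ, 1)` by an inner twist gives again a pair with trivial character. -/
theorem normal_groupΔ_subgroupOf (c : RepClass G H)
    (hfix : ∀ x ∈ innerTwists K c, ∀ δ ∈ groupΔ K c, ∀ g, δ (x.left.1 g : L) = x.left.1 g) :
    ((groupΔ K c).subgroupOf (groupΓ K c)).Normal := by
  refine ⟨fun δ hδ γ => ?_⟩
  obtain ⟨γ, x, hx, rfl⟩ := γ
  obtain ⟨δ, hδΓ⟩ := δ
  change δ ∈ groupΔ K c at hδ
  change x.right * δ * x.right⁻¹ ∈ groupΔ K c
  have hmem := mul_mem (mul_mem hx (mem_groupΔ.1 hδ)) (inv_mem hx)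
  rw [mem_groupΔ]
  convert hmem using 1
  have hact : characterAction K L G δ (x⁻¹).left = (x⁻¹).left := by
    refine Subtype.ext (MonoidHom.ext fun g => Units.ext ?_)
    exact hfix _ (inv_mem hx) _ hδ g
  refine SemidirectProduct.ext ?_ (by simp)
  rw [SemidirectProduct.left_inr, SemidirectProduct.mul_left, SemidirectProduct.mul_left,
    SemidirectProduct.left_inr, map_one, mul_one, SemidirectProduct.mul_right,
    SemidirectProduct.right_inr, map_mul, MulAut.mul_apply, hact, SemidirectProduct.inv_left,
    ← MulAut.mul_apply, ← map_mul, mul_inv_cancel, map_one, MulAut.one_apply, mul_inv_cancel]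

/-- An inner twist is determined modulo `Δ` by its character, so finitely many characters give a
finite quotient. -/
theorem finite_quotient_groupΔ (c : RepClass G H)
    (hfin : (SemidirectProduct.left '' (innerTwists K c : Set (TwistGroup K L G))).Finite) :
    Finite (groupΓ K c ⧸ (groupΔ K c).subgroupOf (groupΓ K c)) := by
  have hch : ∀ q : groupΓ K c ⧸ (groupΔ K c).subgroupOf (groupΓ K c),
      ∃ x ∈ innerTwists K c, x.right = (q.out : groupΓ K c) := fun q => mem_groupΓ.1 q.out.2
  choose x hx hxq using hch
  have := hfin.to_subtype
  refine Finite.of_injective (fun q => (⟨(x q).left, x q, hx q, rfl⟩ :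
    SemidirectProduct.left '' (innerTwists K c : Set (TwistGroup K L G)))) fun q q' hqq' => ?_
  have hl : (x q).left = (x q').left := congrArg Subtype.val hqq'
  rw [← QuotientGroup.out_eq' q, ← QuotientGroup.out_eq' q', QuotientGroup.eq]
  change ((q.out : groupΓ K c) : Gal(L/K))⁻¹ * (q'.out : groupΓ K c) ∈ groupΔ K c
  rw [← hxq, ← hxq, mem_groupΔ]
  convert mul_mem (inv_mem (hx q)) (hx q') using 1
  refine SemidirectProduct.ext ?_ (by simp)
  rw [SemidirectProduct.left_inr, SemidirectProduct.mul_left, SemidirectProduct.inv_left,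
    SemidirectProduct.inv_right, hl, ← map_mul, inv_mul_cancel, map_one]

/-- If `Δ` is the full Galois group of an intermediate field, fixes all characters occurring in
inner twists, and only finitely many such characters exist, then the fixed field of `Δ` is finite
Galois over that of `Γ`, with group `Γ/Δ`. -/
theorem galois_structure [IsGalois K L] (c : RepClass G H) (F : IntermediateField K L)
    (hF : groupΔ K c = F.fixingSubgroup)
    (hfix : ∀ x ∈ innerTwists K c, ∀ δ ∈ groupΔ K c, ∀ g, δ (x.left.1 g : L) = x.left.1 g)
    (hfin : (SemidirectProduct.left '' (innerTwists K c : Set (TwistGroup K L G))).Finite) :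
    groupΔ K c ≤ groupΓ K c ∧
      IsOpen (((groupΔ K c).subgroupOf (groupΓ K c) : Subgroup (groupΓ K c)) :
        Set (groupΓ K c)) ∧
      (∃ (_ : ((groupΔ K c).subgroupOf (groupΓ K c)).Normal) (h : fieldK K c ≤ fieldE K c),
        FiniteDimensional (fieldK K c) (IntermediateField.extendScalars h) ∧
        IsGalois (fieldK K c) (IntermediateField.extendScalars h) ∧
        ∃ e : (groupΓ K c ⧸ (groupΔ K c).subgroupOf (groupΓ K c)) ≃*
            Gal((IntermediateField.extendScalars h)/(fieldK K c)),
          ∀ (γ : groupΓ K c) (x : IntermediateField.extendScalars h),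
            ((e γ x : IntermediateField.extendScalars h) : L) = γ.1 (x : L)) ∧
      ∀ γ ∈ groupΓ K c, (fieldE K c).map (γ : L →ₐ[K] L) = fieldE K c := by
  have hnormal := normal_groupΔ_subgroupOf c hfix
  have hquot := finite_quotient_groupΔ c hfin
  -- A closed subgroup of finite index is open.
  have hclosed : IsClosed (((groupΔ K c).subgroupOf (groupΓ K c) : Subgroup (groupΓ K c)) :
      Set (groupΓ K c)) := by
    have h1 : IsClosed (groupΔ K c : Set Gal(L/K)) := by
      rw [hF]
      exact InfiniteGalois.fixingSubgroup_isClosed F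
    exact h1.preimage continuous_subtype_val
  have hfi : ((groupΔ K c).subgroupOf (groupΓ K c)).FiniteIndex :=
    Subgroup.finiteIndex_of_finite_quotient
  have hle : fieldK K c ≤ fieldE K c :=
    IntermediateField.fixedField_antitone (groupΔ_le_groupΓ c)
  have hE : fieldE K c = F := by
    rw [fieldE, hF, InfiniteGalois.fixedField_fixingSubgroup]
  have hΔE : ∀ γ : Gal(L/K), γ ∈ groupΔ K c ↔ ∀ x ∈ fieldE K c, γ x = x := by
    intro γ
    rw [hF, hE, IntermediateField.mem_fixingSubgroup_iff]
  have hstab : ∀ γ ∈ groupΓ K c, ∀ x ∈ fieldE K c, γ x ∈ fieldE K c := by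
    rintro γ hγ x hx ⟨δ, hδ⟩
    have h1 := hnormal.conj_mem ⟨δ, groupΔ_le_groupΓ c hδ⟩ hδ ⟨γ, hγ⟩⁻¹
    have h2 := (hΔE _).1 h1 x hx
    change γ⁻¹ (δ ((γ⁻¹)⁻¹ x)) = x at h2
    rw [inv_inv] at h2
    change δ (γ x) = γ x
    rw [← AlgEquiv.symm_apply_eq]
    exact h2
  refine ⟨groupΔ_le_groupΓ c, Subgroup.isOpen_of_isClosed_of_finiteIndex _ hclosed,
    ⟨hnormal, hle, ?_⟩, ?_⟩
  · let E' := IntermediateField.extendScalars hle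
    have hK : ∀ γ : groupΓ K c, ∀ x : fieldK K c, γ.1 (x : L) = x := fun γ x => x.2 γ
    let res (γ : groupΓ K c) : E' →ₐ[fieldK K c] E' :=
      { toFun := fun x => ⟨γ.1 x, hstab γ.1 γ.2 x x.2⟩
        map_one' := Subtype.ext (map_one γ.1)
        map_mul' := fun x y => Subtype.ext (map_mul γ.1 _ _)
        map_zero' := Subtype.ext (map_zero γ.1)
        map_add' := fun x y => Subtype.ext (map_add γ.1 _ _)
        commutes' := fun x => Subtype.ext (hK γ x) }
    let r : groupΓ K c →* Gal(E'/fieldK K c) :=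
      { toFun := fun γ => AlgEquiv.ofAlgHom (res γ) (res γ⁻¹)
          (AlgHom.ext fun x => Subtype.ext (γ.1.apply_symm_apply _))
          (AlgHom.ext fun x => Subtype.ext (γ.1.symm_apply_apply _))
        map_one' := rfl
        map_mul' := fun _ _ => rfl }
    have hr : ∀ γ (x : E'), (r γ x : L) = γ.1 x := fun _ _ => rfl
    have hker : r.ker = (groupΔ K c).subgroupOf (groupΓ K c) := by
      ext γ
      rw [MonoidHom.mem_ker, Subgroup.mem_subgroupOf, hΔE]
      refine ⟨fun h x hx => ?_, fun h => AlgEquiv.ext fun x => Subtype.ext (h x x.2)⟩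
      exact congrArg (fun f : Gal(E'/fieldK K c) => ((f ⟨x, hx⟩ : E') : L)) h
    have hfinker : Finite (groupΓ K c ⧸ r.ker) := by rw [hker]; exact hquot
    have hfinr : Finite r.range :=
      Finite.of_equiv _ (QuotientGroup.quotientKerEquivRange r).toEquiv
    -- The elements of `E'` fixed by all of `Γ` are those of the fixed field of `Γ`, so Artin's
    -- theorem applies to the finite group `Γ/Δ`.
    have hgal : IsGaloisGroup r.range (fieldK K c) E' :=
      { faithful := inferInstance
        commutes := inferInstance
        isInvariant := ⟨fun x hx => by
          refine ⟨⟨(x : L), fun γ => ?_⟩, rfl⟩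
          exact congrArg (fun y : E' => (y : L)) (hx ⟨r γ, γ, rfl⟩)⟩ }
    refine ⟨IsGaloisGroup.finiteDimensional r.range _ _, IsGaloisGroup.isGalois r.range _ _,
      (QuotientGroup.quotientMulEquivOfEq hker.symm).trans
        ((QuotientGroup.quotientKerEquivRange r).trans
          (IsGaloisGroup.mulEquivAlgEquiv r.range (fieldK K c) E')), fun γ x => rfl⟩
  · intro γ hγ
    refine le_antisymm ?_ fun x hx => ?_
    · rintro _ ⟨x, hx, rfl⟩
      exact hstab γ hγ x hx
    · exact ⟨γ⁻¹ x, hstab γ⁻¹ (inv_mem hγ) x hx, γ.apply_symm_apply x⟩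

end Structure

/-! ### Inner twists of a representation -/

section Twists

variable {ι K L G : Type*} [Fintype ι] [DecidableEq ι] [Field K] [Field L] [Algebra K L]
  [TopologicalSpace K] [TopologicalSpace L] [CoefficientExtension K L]
  [Group G] [TopologicalSpace G] {H : Subgroup (GL ι L)}

theorem Rep.toClass_eq_iff {ρ₁ ρ₂ : Rep G H} :
    ρ₁.toClass = ρ₂.toClass ↔ ∃ M ∈ H, ∀ g, ρ₁.hom g = M * ρ₂.hom g * M⁻¹ :=
  Quotient.eq (r := Rep.setoid G H)

variable [IsTwistStable K H]

theorem mem_innerTwists {ρ : Rep G H} {x : TwistGroup K L G} :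
    x ∈ innerTwists K ρ.toClass ↔ ∃ M ∈ H, ∀ g,
      GeneralLinearGroup.map (x.right : L →+* L) (ρ.hom g) *
        GeneralLinearGroup.scalar ι (x.left.1 g)⁻¹ = M * ρ.hom g * M⁻¹ :=
  (MulAction.mem_stabilizer_iff (G := TwistGroup K L G) (a := ρ.toClass)).trans
    (Rep.toClass_eq_iff (ρ₁ := twist x ρ) (ρ₂ := ρ))

theorem mem_groupΔ_toClass {ρ : Rep G H} {γ : Gal(L/K)} :
    γ ∈ groupΔ K ρ.toClass ↔ ∃ M ∈ H, ∀ g,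
      GeneralLinearGroup.map (γ : L →+* L) (ρ.hom g) = M * ρ.hom g * M⁻¹ := by
  rw [mem_groupΔ, mem_innerTwists]
  simp

theorem exists_conj_of_mem_innerTwists {ρ : Rep G H} {x : TwistGroup K L G}
    (hx : x ∈ innerTwists K ρ.toClass) : ∃ M ∈ H, ∀ g,
      (ρ.hom g).val.map x.right = (x.left.1 g : L) • (M * ρ.hom g * M⁻¹).val := by
  obtain ⟨M, hM, h⟩ := mem_innerTwists.1 hx
  refine ⟨M, hM, fun g => ?_⟩
  have h1 : GeneralLinearGroup.map (x.right : L →+* L) (ρ.hom g) =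
      GeneralLinearGroup.scalar ι (x.left.1 g) * (M * ρ.hom g * M⁻¹) := by
    rw [scalar_mul_comm, ← h g, mul_assoc, ← map_mul, inv_mul_cancel, map_one, mul_one]
  have h2 := congrArg Units.val h1
  rw [Units.val_mul] at h2
  refine Eq.trans h2 ?_
  change Matrix.scalar ι (x.left.1 g : L) * _ = _
  rw [Matrix.scalar_apply, ← Matrix.smul_one_eq_diagonal, Matrix.smul_mul, one_mul]

theorem map_trace_of_mem_innerTwists {ρ : Rep G H} {x : TwistGroup K L G}
    (hx : x ∈ innerTwists K ρ.toClass) (g : G) :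
    x.right (trace (ρ.hom g).val) = x.left.1 g * trace (ρ.hom g).val := by
  obtain ⟨M, -, h⟩ := exists_conj_of_mem_innerTwists hx
  have h1 := congrArg trace (h g)
  rw [trace_smul, Units.val_mul, trace_mul_comm, ← Units.val_mul, inv_mul_cancel_left,
    smul_eq_mul] at h1
  rw [← h1]
  exact AddMonoidHom.map_trace (x.right : L →+ L) _

theorem map_det_of_mem_innerTwists {ρ : Rep G H} {x : TwistGroup K L G}
    (hx : x ∈ innerTwists K ρ.toClass) (g : G) :
    x.right (det (ρ.hom g).val) = (x.left.1 g : L) ^ Fintype.card ι * det (ρ.hom g).val := by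
  obtain ⟨M, -, h⟩ := exists_conj_of_mem_innerTwists hx
  have h1 := congrArg det (h g)
  rw [det_smul, Units.val_mul, det_mul_comm, ← Units.val_mul, inv_mul_cancel_left] at h1
  rw [← h1]
  exact RingHom.map_det (x.right : L →+* L) _

/-- If every inner twist has a character of order dividing `N` which is trivial on a fixed
neighbourhood of the identity, only finitely many characters occur, since `G` is compact. -/
theorem finite_left_innerTwists [IsTopologicalGroup G] [CompactSpace G] {c : RepClass G H} {N : ℕ}
    (hN : 0 < N) (hpow : ∀ x ∈ innerTwists K c, ∀ g, x.left.1 g ^ N = 1) {U : Set G}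
    (hU : U ∈ nhds 1) (htriv : ∀ x ∈ innerTwists K c, ∀ g ∈ U, x.left.1 g = 1) :
    (SemidirectProduct.left '' (innerTwists K c : Set (TwistGroup K L G))).Finite := by
  set S := SemidirectProduct.left '' (innerTwists K c : Set (TwistGroup K L G))
  -- All characters in question factor through the finite quotient by the open subgroup `W`, and
  -- each is determined by its values, `N`-th roots of unity, on coset representatives.
  let W : Subgroup G := ⨅ ε : S, ε.1.1.ker
  have hW : IsOpen (W : Set G) := by
    refine W.isOpen_of_mem_nhds (g := 1) (Filter.mem_of_superset hU fun g hg => ?_)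
    rw [SetLike.mem_coe, Subgroup.mem_iInf]
    rintro ⟨_, x, hx, rfl⟩
    exact htriv x hx g hg
  have hfin : Finite (G ⧸ W) := W.quotient_finite_of_isOpen hW
  have : NeZero N := ⟨hN.ne'⟩
  let f : S → (G ⧸ W) → rootsOfUnity N L := fun ε q =>
    ⟨ε.1.1 q.out, by
      obtain ⟨_, x, hx, rfl⟩ := ε
      exact hpow x hx _⟩
  refine Set.finite_coe_iff.1 (Finite.of_injective f fun ε ε' h => ?_)
  refine Subtype.ext (Subtype.ext (MonoidHom.ext fun g => ?_))
  have hval : ∀ (ε : S) (g : G), ε.1.1 g = ε.1.1 (g : G ⧸ W).out := by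
    intro ε g
    have h1 : (g : G ⧸ W).out⁻¹ * g ∈ W :=
      QuotientGroup.eq.1 (QuotientGroup.out_eq' (g : G ⧸ W))
    have h2 := MonoidHom.mem_ker.1 (Subgroup.mem_iInf.1 h1 ε)
    rw [map_mul, map_inv, inv_mul_eq_one] at h2
    exact h2.symm
  rw [hval ε, hval ε']
  exact congrArg Subtype.val (congrFun h (g : G ⧸ W))

theorem continuous_trace_hom [IsTopologicalRing L] (ρ : Rep G H) :
    Continuous fun g => trace (ρ.hom g).val :=
  Continuous.matrix_trace (Units.continuous_val.comp ρ.continuous_hom)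

/-- In the discrete case `ε` is trivial where `ρ` is: there the relation defining an inner twist
reads `1 = ε g • 1`. -/
theorem exists_nhds_left_eq_one_of_discrete [DiscreteTopology L] [Nonempty ι] (ρ : Rep G H) :
    ∃ U ∈ nhds (1 : G), ∀ x ∈ innerTwists K ρ.toClass, ∀ g ∈ U, x.left.1 g = 1 := by
  refine ⟨{g | (ρ.hom g).val = 1}, ?_, fun x hx g hg => ?_⟩
  · have h1 : Continuous fun g => (ρ.hom g).val := Units.continuous_val.comp ρ.continuous_hom
    have : DiscreteTopology (Matrix ι ι L) := inferInstanceAs (DiscreteTopology (ι → ι → L))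
    exact (isOpen_discrete {1}).preimage h1 |>.mem_nhds (by simp)
  · obtain ⟨M, -, h⟩ := exists_conj_of_mem_innerTwists hx
    have h1 := h g
    have hg' : ρ.hom g = 1 := Units.ext hg
    rw [hg', mul_one, mul_inv_cancel, Units.val_one] at h1
    obtain ⟨i⟩ := ‹Nonempty ι›
    have h2 := congrFun (congrFun h1 i) i
    simp only [map_apply, one_apply_eq, map_one, Matrix.smul_apply, smul_eq_mul, mul_one] at h2
    exact Units.ext h2.symm

end Twists

/-- The fixed field of the subgroup generated by `γ` contains the adjoined elements as soon as `γ`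
fixes them. -/
theorem mem_fixingSubgroup_adjoin {K L : Type*} [Field K] [Field L] [Algebra K L]
    {A : Set L} {γ : Gal(L/K)} :
    γ ∈ (IntermediateField.adjoin K A).fixingSubgroup ↔ ∀ x ∈ A, γ x = x := by
  rw [← SetLike.mem_coe, ← Set.singleton_subset_iff, ← Subgroup.closure_le,
    ← IntermediateField.le_iff_le, IntermediateField.adjoin_le_iff]
  refine ⟨fun h x hx => h hx ⟨γ, Subgroup.subset_closure rfl⟩, fun h x hx => ?_⟩
  rintro ⟨δ, hδ⟩
  change δ x = x
  induction hδ using Subgroup.closure_induction with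
  | mem y hy => rw [Set.mem_singleton_iff.1 hy, h x hx]
  | one => rfl
  | mul a b _ _ ha hb => rw [AlgEquiv.mul_apply, hb, ha]
  | inv a _ ha => exact (AlgEquiv.symm_apply_eq a).2 ha.symm

/-! ### The spectral norm -/

section SpectralNorm

variable {ℓ : ℕ} [Fact ℓ.Prime] {F : Type*} [Field F] [Algebra ℚ_[ℓ] F]
  [Algebra.IsAlgebraic ℚ_[ℓ] F]

theorem spectralNorm_mul_eq (a b : F) :
    spectralNorm ℚ_[ℓ] F (a * b) = spectralNorm ℚ_[ℓ] F a * spectralNorm ℚ_[ℓ] F b :=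
  spectralAlgNorm_mul (K := ℚ_[ℓ]) a b

theorem spectralNorm_add_le_max (a b : F) :
    spectralNorm ℚ_[ℓ] F (a + b) ≤ max (spectralNorm ℚ_[ℓ] F a) (spectralNorm ℚ_[ℓ] F b) :=
  isNonarchimedean_spectralNorm (K := ℚ_[ℓ]) a b

theorem spectralNorm_neg_eq (a : F) : spectralNorm ℚ_[ℓ] F (-a) = spectralNorm ℚ_[ℓ] F a :=
  spectralNorm_neg (Algebra.IsAlgebraic.isAlgebraic a)

theorem spectralNorm_sub_le_max (a b : F) :
    spectralNorm ℚ_[ℓ] F (a - b) ≤ max (spectralNorm ℚ_[ℓ] F a) (spectralNorm ℚ_[ℓ] F b) := by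
  rw [sub_eq_add_neg, ← spectralNorm_neg_eq b]
  exact spectralNorm_add_le_max a (-b)

theorem spectralNorm_pos {a : F} (ha : a ≠ 0) : 0 < spectralNorm ℚ_[ℓ] F a :=
  spectralNorm_zero_lt ha (Algebra.IsAlgebraic.isAlgebraic a)

/-- Nontrivial `N`-th roots of unity stay away from `1`. -/
theorem exists_le_spectralNorm_sub_one {N : ℕ} (hN : 0 < N) :
    ∃ r : ℝ, 0 < r ∧ ∀ ζ : F, ζ ^ N = 1 → spectralNorm ℚ_[ℓ] F (ζ - 1) < r → ζ = 1 := by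
  have hfin : {ζ : F | ζ ^ N = 1 ∧ ζ ≠ 1}.Finite := by
    classical
    refine (Polynomial.nthRoots N (1 : F)).toFinset.finite_toSet.subset fun ζ hζ => ?_
    rw [Finset.mem_coe, Multiset.mem_toFinset, Polynomial.mem_nthRoots hN]
    exact hζ.1
  obtain hemp | hne := {ζ : F | ζ ^ N = 1 ∧ ζ ≠ 1}.eq_empty_or_nonempty
  · refine ⟨1, one_pos, fun ζ hζ _ => ?_⟩
    by_contra h
    exact (hemp ▸ (⟨hζ, h⟩ : ζ ∈ {ζ : F | ζ ^ N = 1 ∧ ζ ≠ 1}) : ζ ∈ (∅ : Set F))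
  · obtain ⟨ξ, hξ, hmin⟩ := Set.exists_min_image _
      (fun ζ : F => spectralNorm ℚ_[ℓ] F (ζ - 1)) hfin hne
    refine ⟨_, spectralNorm_pos (ℓ := ℓ) (sub_ne_zero.2 hξ.2), fun ζ hζ hlt => ?_⟩
    by_contra h
    exact (hmin ζ ⟨hζ, h⟩).not_gt hlt

end SpectralNorm

/-! ### Finiteness of the characters of inner twists -/

/-- The two cases for the coefficient fields, with the data of the `CoefficientExtension` used
below. -/
theorem IsResAbsIrreducible.finite_or_adic {ι K L G : Type*} [Fintype ι] [DecidableEq ι]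
    [Field K] [Field L] [Algebra K L] [TopologicalSpace K] [TopologicalSpace L]
    [S : CoefficientExtension K L] [Group G] {ρ : G →* GL ι L}
    (h : IsResAbsIrreducible K ρ) :
    (Finite K ∧ DiscreteTopology L ∧ IsAbsIrreducible ρ) ∨
      ∃ (ℓ : ℕ) (_ : Fact ℓ.Prime) (_ : Algebra ℚ_[ℓ] K) (_ : Algebra ℚ_[ℓ] L)
        (_ : IsScalarTower ℚ_[ℓ] K L) (_ : Algebra.IsAlgebraic ℚ_[ℓ] L),
        IsAdicTopology ℓ L ∧ IsResiduallyAbsIrreducible (adicIntegers ℓ L) ρ := by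
  cases S with
  | finite h1 _ h2 => exact Or.inl ⟨h1, h2, h⟩
  | adic ℓ i1 i2 i3 i4 _ i5 _ hL => exact Or.inr ⟨ℓ, i1, i2, i3, i4, i5, hL, h⟩

section Twists

variable {ι K L G : Type*} [Fintype ι] [DecidableEq ι] [Field K] [Field L] [Algebra K L]
  [TopologicalSpace K] [TopologicalSpace L] [S : CoefficientExtension K L]
  [Group G] [TopologicalSpace G] {H : Subgroup (GL ι L)} [IsTwistStable K H]

/-- Where the trace of `ρ g` is close to the nonzero number `Tr 1`, the relation
`γ (Tr ρ g) = ε g * Tr ρ g` forces the root of unity `ε g` to be close to `1`, hence equal to it,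
because Galois automorphisms are isometries. -/
theorem exists_nhds_left_eq_one_of_adic {ℓ : ℕ} [Fact ℓ.Prime] [Algebra ℚ_[ℓ] K]
    [Algebra ℚ_[ℓ] L] [IsScalarTower ℚ_[ℓ] K L] [Algebra.IsAlgebraic ℚ_[ℓ] L]
    (hL : IsAdicTopology ℓ L) [Nonempty ι] (ρ : Rep G H) {N : ℕ} (hN : 0 < N)
    (hpow : ∀ x ∈ innerTwists K ρ.toClass, ∀ g, x.left.1 g ^ N = 1) :
    ∃ U ∈ nhds (1 : G), ∀ x ∈ innerTwists K ρ.toClass, ∀ g ∈ U, x.left.1 g = 1 := by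
  have := CoefficientExtension.isTopologicalRing K L
  have : CharZero L := charZero_of_injective_algebraMap (algebraMap ℚ_[ℓ] L).injective
  obtain ⟨r, hr, hroot⟩ := exists_le_spectralNorm_sub_one (ℓ := ℓ) (F := L) hN
  set n : L := (Fintype.card ι : L)
  have hn : 0 < spectralNorm ℚ_[ℓ] L n := spectralNorm_pos (Nat.cast_ne_zero.2 Fintype.card_ne_zero)
  have h1 : trace (ρ.hom 1).val = n := by simp [n]
  refine ⟨{g | spectralNorm ℚ_[ℓ] L (trace (ρ.hom g).val - n) < min r 1 * spectralNorm ℚ_[ℓ] L n},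
    ?_, fun x hx g hg => ?_⟩
  · refine (continuous_trace_hom ρ).continuousAt.preimage_mem_nhds
      (t := {y | spectralNorm ℚ_[ℓ] L (y - n) < min r 1 * spectralNorm ℚ_[ℓ] L n}) ?_
    rw [h1]
    exact (hL n).mem_of_mem (mul_pos (lt_min hr one_pos) hn)
  set t := trace (ρ.hom g).val
  change spectralNorm ℚ_[ℓ] L (t - n) < _ at hg
  have hlt1 : spectralNorm ℚ_[ℓ] L (t - n) < spectralNorm ℚ_[ℓ] L n :=
    hg.trans_le (mul_le_of_le_one_left hn.le (min_le_right _ _))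
  have hnt : spectralNorm ℚ_[ℓ] L n ≤ spectralNorm ℚ_[ℓ] L t := by
    have h2 := spectralNorm_sub_le_max (ℓ := ℓ) t (t - n)
    rw [sub_sub_cancel] at h2
    exact (le_max_iff.1 h2).resolve_right hlt1.not_ge
  have hrel := map_trace_of_mem_innerTwists hx g
  have hγ : spectralNorm ℚ_[ℓ] L (x.right (t - n)) = spectralNorm ℚ_[ℓ] L (t - n) :=
    (spectralNorm_eq_of_equiv (x.right.restrictScalars ℚ_[ℓ]) (t - n)).symm
  have hprod : ((x.left.1 g : L) - 1) * t = x.right (t - n) - (t - n) := by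
    rw [map_sub, hrel, map_natCast]
    ring
  have hle : spectralNorm ℚ_[ℓ] L ((x.left.1 g : L) - 1) * spectralNorm ℚ_[ℓ] L t ≤
      spectralNorm ℚ_[ℓ] L (t - n) := by
    rw [← spectralNorm_mul_eq, hprod]
    refine (spectralNorm_sub_le_max _ _).trans ?_
    rw [hγ, max_self]
  refine Units.ext (hroot _ ?_ ?_)
  · rw [← Units.val_pow_eq_pow_val, hpow x hx g, Units.val_one]
  · refine lt_of_mul_lt_mul_right ?_ hn.le
    calc _ ≤ spectralNorm ℚ_[ℓ] L ((x.left.1 g : L) - 1) * spectralNorm ℚ_[ℓ] L t :=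
          mul_le_mul_of_nonneg_left hnt (spectralNorm_nonneg _)
      _ ≤ _ := hle
      _ < _ := hg
      _ ≤ _ := mul_le_mul_of_nonneg_right (min_le_left _ _) hn.le

/-- The inner twists of `ρ` involve finitely many characters as soon as these have bounded order. -/
theorem finite_left_innerTwists_toClass [IsTopologicalGroup G] [CompactSpace G] [Nonempty ι]
    {ρ : Rep G H} (hρ : IsResAbsIrreducible K ρ.hom) {N : ℕ} (hN : 0 < N)
    (hpow : ∀ x ∈ innerTwists K ρ.toClass, ∀ g, x.left.1 g ^ N = 1) :
    (SemidirectProduct.left '' (innerTwists K ρ.toClass : Set (TwistGroup K L G))).Finite := by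
  have hU : ∃ U ∈ nhds (1 : G), ∀ x ∈ innerTwists K ρ.toClass, ∀ g ∈ U, x.left.1 g = 1 := by
    obtain ⟨-, _, -⟩ | ⟨ℓ, _, _, _, _, _, hL, -⟩ := hρ.finite_or_adic
    · exact exists_nhds_left_eq_one_of_discrete ρ
    · exact exists_nhds_left_eq_one_of_adic hL ρ hN hpow
  obtain ⟨U, hU, h⟩ := hU
  exact finite_left_innerTwists hN hpow hU h

/-- `Gal(L/K)` acts on the values of a character of finite order by raising to powers. -/
theorem exists_map_eq_pow {ψ : characters K L G} (hψ : IsOfFinOrder ψ) (γ : Gal(L/K)) (g : G) :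
    ∃ a : ℕ, γ (ψ.1 g : L) = (ψ.1 g : L) ^ a := by
  have : NeZero (orderOf ψ) := ⟨hψ.orderOf_pos.ne'⟩
  have h1 : ψ.1 g ^ orderOf ψ = 1 := by
    have := pow_orderOf_eq_one ψ
    exact congrArg (fun ε : characters K L G => ε.1 g) this
  exact map_rootsOfUnity_eq_pow_self γ (⟨ψ.1 g, h1⟩ : rootsOfUnity (orderOf ψ) L)

end Twists

/-! ### Rank one idempotents over finite fields -/

section ImageAlgebra

variable {ι G E F : Type*} [Fintype ι] [DecidableEq ι] [Group G] [Field E] [Field F] [Algebra E F]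

/-- The `E`-subalgebra of the matrix algebra over `F` spanned by the image of `ρ`. -/
noncomputable def imageAlgebra (E : Type*) {F : Type*} [Field E] [Field F] [Algebra E F]
    (ρ : G →* GL ι F) : Subalgebra E (Matrix ι ι F) :=
  (MonoidAlgebra.lift E (Matrix ι ι F) G ((Units.coeHom _).comp ρ)).range

theorem coe_mem_imageAlgebra (ρ : G →* GL ι F) (g : G) : (ρ g).val ∈ imageAlgebra E ρ :=
  ⟨MonoidAlgebra.single g 1, by simp⟩

/-- The algebra is spanned by the image, as the image is multiplicatively closed: induction needs no
products. -/
theorem imageAlgebra_induction {ρ : G →* GL ι F} {p : Matrix ι ι F → Prop}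
    (h0 : p 0) (hadd : ∀ a b, p a → p b → p (a + b))
    (hsmul : ∀ (c : E) (g : G), p (c • (ρ g).val)) {a : Matrix ι ι F}
    (ha : a ∈ imageAlgebra E ρ) : p a := by
  obtain ⟨a, rfl⟩ := ha
  change p (MonoidAlgebra.lift E (Matrix ι ι F) G ((Units.coeHom _).comp ρ) a)
  induction a using MonoidAlgebra.induction_linear with
  | zero => simpa using h0
  | add x y hx hy => rw [map_add]; exact hadd _ _ hx hy
  | single g c => simpa using hsmul c g

theorem trace_mem_range_of_mem_imageAlgebra {ρ : G →* GL ι F}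
    (ht : ∀ g, trace (ρ g).val ∈ (algebraMap E F).range) {a : Matrix ι ι F}
    (ha : a ∈ imageAlgebra E ρ) : trace a ∈ (algebraMap E F).range := by
  refine imageAlgebra_induction (p := fun a => trace a ∈ (algebraMap E F).range) ?_
    (fun a b h1 h2 => ?_) (fun c g => ?_) ha
  · simp
  · rw [trace_add]; exact add_mem h1 h2
  · rw [trace_smul, Algebra.smul_def]
    exact mul_mem ⟨c, rfl⟩ (ht g)

/-- An algebra spanned over a finite field by a separating image with traces in that field is
finite: its elements are determined by finitely many traces. -/
theorem finite_imageAlgebra [Finite E] {ρ : G →* GL ι F} (hρ : TraceSeparating ρ)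
    (ht : ∀ g, trace (ρ g).val ∈ (algebraMap E F).range) : Finite (imageAlgebra E ρ) := by
  obtain ⟨b, hb, hspan, hlin⟩ := exists_linearIndependent F (Set.range fun g => (ρ g).val)
  have hbfin : Finite b := hlin.setFinite
  have hEfin : Finite (algebraMap E F).range := Set.finite_range _
  refine Finite.of_injective (fun (a : imageAlgebra E ρ) (x : b) =>
    (⟨trace (a.1 * x.1), trace_mem_range_of_mem_imageAlgebra ht (mul_mem a.2 ?_)⟩ :
      (algebraMap E F).range)) fun a a' h => Subtype.ext ?_
  · obtain ⟨g, hg⟩ := hb x.2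
    rw [← hg]
    exact coe_mem_imageAlgebra ρ g
  · rw [Matrix.ext_iff_trace_mul_right]
    intro X
    have hX : X ∈ Submodule.span F b := by simp [hspan, hρ.span_eq_top]
    induction hX using Submodule.span_induction with
    | mem x hx => exact congrArg Subtype.val (congrFun h ⟨x, hx⟩)
    | zero => simp
    | add x y _ _ hx hy => rw [mul_add, mul_add, trace_add, trace_add, hx, hy]
    | smul c x _ hx => rw [Matrix.mul_smul, Matrix.mul_smul, trace_smul, trace_smul, hx]

end ImageAlgebra

/-- Powers of an element of a finite monoid are eventually periodic, hence one of them is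
idempotent. -/
theorem exists_isIdempotentElem_pow {M : Type*} [Monoid M] [Finite M] (x : M) :
    ∃ m : ℕ, 0 < m ∧ IsIdempotentElem (x ^ m) := by
  obtain ⟨i, j, hij, h⟩ := Finite.exists_ne_map_eq_of_infinite fun m : ℕ => x ^ m
  wlog hlt : i < j generalizing i j
  · exact this j i hij.symm h.symm (lt_of_le_of_ne (not_lt.1 hlt) hij.symm)
  obtain ⟨d, rfl⟩ := Nat.exists_eq_add_of_lt hlt
  have hper : ∀ m, i ≤ m → x ^ (m + (d + 1)) = x ^ m := by
    intro m hm
    obtain ⟨k, rfl⟩ := Nat.exists_eq_add_of_le hm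
    calc x ^ (i + k + (d + 1)) = x ^ (i + d + 1) * x ^ k := by rw [← pow_add]; congr 1; ring
      _ = x ^ (i + k) := by rw [pow_add x i k]; exact congrArg (· * x ^ k) h.symm
  have hper' : ∀ t m, i ≤ m → x ^ (m + t * (d + 1)) = x ^ m := by
    intro t
    induction t with
    | zero => simp
    | succ t ih =>
      intro m hm
      rw [← ih m hm, ← hper (m + t * (d + 1)) (hm.trans (Nat.le_add_right _ _))]
      congr 1
      ring
  refine ⟨(i + 1) * (d + 1), by positivity, ?_⟩
  rw [IsIdempotentElem, ← pow_add]
  exact hper' _ _ (by nlinarith)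

section RankOne

variable {ι G E F : Type*} [Fintype ι] [DecidableEq ι] [Group G] [Field E] [Field F] [Algebra E F]

/-- If the corner ring `e M e` of the full matrix algebra is commutative, then `e` has rank one. -/
theorem exists_vecMulVec_of_commute_corner {e : Matrix ι ι F} (he : e * e = e) (hne : e ≠ 0)
    (hcomm : ∀ X Y : Matrix ι ι F, (e * X * e) * (e * Y * e) = (e * Y * e) * (e * X * e)) :
    ∃ v w : ι → F, w ⬝ᵥ v = 1 ∧ e = vecMulVec v w := by
  obtain ⟨b, a, hba⟩ : ∃ b a, e b a ≠ 0 := by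
    by_contra h
    push Not at h
    exact hne (Matrix.ext h)
  -- Compare entries in the commutation relation for the matrix units `E_kb` and `E_ak`.
  have key : ∀ i j k, e b a * (e i k * e k j) = e k k * (e i a * e b j) := by
    intro i j k
    have h := congrFun (congrFun (hcomm (single k b 1) (single a k 1)) i) j
    have hs : ∀ (p q r s : ι), (e * single p q 1 * e) * (e * single r s 1 * e) =
        e q r • (e * single p s 1 * e) := by
      intro p q r s
      calc _ = e * (single p q 1 * (e * e) * single r s 1) * e := by simp only [Matrix.mul_assoc]
        _ = e * (e q r • single p s 1) * e := by
          rw [he]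
          simp
        _ = _ := by rw [Matrix.mul_smul, Matrix.smul_mul]
    have hent : ∀ p q, (e * single p q (1 : F) * e) i j = e i p * e q j := by
      intro p q
      simp [Matrix.mul_apply, single_apply, ite_and]
    rw [hs, hs] at h
    simp only [Matrix.smul_apply, hent, smul_eq_mul] at h
    exact h
  have hform : ∀ i j, e i j = (trace e / e b a * e i a) * e b j := by
    intro i j
    have h1 : e i j = ∑ k, e i k * e k j := by
      conv_lhs => rw [← he]
      rfl
    have h2 : e b a * e i j = trace e * (e i a * e b j) := by
      rw [h1, Finset.mul_sum, trace, Finset.sum_mul]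
      exact Finset.sum_congr rfl fun k _ => key i j k
    field_simp
    linear_combination h2
  refine ⟨fun i => trace e / e b a * e i a, fun j => e b j, ?_, Matrix.ext hform⟩
  set v := fun i => trace e / e b a * e i a
  set w := fun j => e b j
  have hvw : e = vecMulVec v w := Matrix.ext hform
  have h1 : (w ⬝ᵥ v) • e = e := by
    conv_rhs => rw [← he, hvw, Matrix.vecMulVec_mul_vecMulVec]
    rw [hvw]
    ext i j
    simp only [vecMulVec_apply, Matrix.smul_apply, Pi.smul_apply, smul_eq_mul]
    ring
  have h2 := congrFun (congrFun h1 b) a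
  rw [Matrix.smul_apply, smul_eq_mul] at h2
  exact mul_right_cancel₀ hba (h2.trans (one_mul _).symm)

/-- A separating image whose traces lie in a finite field `E` contains in its `E`-span an
idempotent of rank one. For a nonzero idempotent `e` of minimal rank, powers of elements of the
corner ring `e A e` are nilpotent or equal to `e`; since the trace form is nondegenerate the corner
is a finite division ring, hence commutative, and by density `e` has rank one. -/
theorem exists_rank_one_mem_imageAlgebra [Finite E] [Nonempty ι] {ρ : G →* GL ι F}
    (hρ : TraceSeparating ρ) (ht : ∀ g, trace (ρ g).val ∈ (algebraMap E F).range) :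
    ∃ v w : ι → F, w ⬝ᵥ v = 1 ∧ vecMulVec v w ∈ imageAlgebra E ρ := by
  classical
  set A := imageAlgebra E ρ
  have hAfin : Finite A := finite_imageAlgebra hρ ht
  have hex : ∃ r : ℕ, ∃ e : A, IsIdempotentElem e ∧ e ≠ 0 ∧ e.1.rank = r :=
    ⟨_, 1, IsIdempotentElem.one, one_ne_zero, rfl⟩
  obtain ⟨e, he, hne, hrank⟩ := Nat.find_spec hex
  -- By minimality of the rank `e` is the only nonzero idempotent of the corner ring.
  have hmin : ∀ f : A, IsIdempotentElem f → e * f = f → f * e = f → f ≠ 0 → f = e := by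
    intro f hf hef hfe hf0
    have hle : LinearMap.range f.1.mulVecLin ≤ LinearMap.range e.1.mulVecLin := by
      rintro _ ⟨x, rfl⟩
      refine ⟨f.1 *ᵥ x, ?_⟩
      simp only [mulVecLin_apply, mulVec_mulVec]
      rw [← Subalgebra.coe_mul, hef]
    have hr : e.1.rank ≤ f.1.rank := by
      rw [hrank]
      exact Nat.find_min' hex ⟨f, hf, hf0, rfl⟩
    have heq := Submodule.eq_of_le_of_finrank_le hle hr
    have hfe' : f * e = e := by
      refine Subtype.ext (Matrix.mulVec_injective (funext fun x => ?_))
      obtain ⟨y, hy⟩ : e.1 *ᵥ x ∈ LinearMap.range f.1.mulVecLin := heq ▸ ⟨x, rfl⟩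
      have hy' : f.1 *ᵥ y = e.1 *ᵥ x := hy
      rw [Subalgebra.coe_mul, ← mulVec_mulVec, ← hy', mulVec_mulVec, ← Subalgebra.coe_mul, hf.eq]
    rw [← hfe, hfe']
  -- A nonzero `x` in the corner has a multiple `x * (e * a * e)` of nonzero trace, which is not
  -- nilpotent, so that some power of it is `e`.
  have hinv : ∀ x : A, e * x = x → x * e = x → x ≠ 0 →
      ∃ y : A, e * y = y ∧ y * e = y ∧ x * y = e := by
    intro x hex hxe hx0
    obtain ⟨g, hg⟩ : ∃ g, trace (x.1 * (ρ g).val) ≠ 0 := by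
      by_contra h
      push Not at h
      exact hx0 (Subtype.ext (hρ _ h))
    let a : A := ⟨(ρ g).val, coe_mem_imageAlgebra ρ g⟩
    have htr : trace (x * (e * a * e)).1 ≠ 0 := by
      have : x * (e * a * e) = (x * a) * e := by rw [← mul_assoc, ← mul_assoc, hxe]
      rw [this, Subalgebra.coe_mul, trace_mul_comm, ← Subalgebra.coe_mul, ← mul_assoc, hex]
      exact hg
    obtain ⟨m, hm, hidem⟩ := exists_isIdempotentElem_pow (x * (e * a * e))
    obtain ⟨m, rfl⟩ := Nat.exists_eq_succ_of_ne_zero hm.ne'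
    set z := x * (e * a * e)
    have hez : e * z = z := by rw [← mul_assoc, hex]
    have hze : z * e = z := by simp only [z, mul_assoc, he.eq]
    have hz : z ^ (m + 1) = e := by
      refine hmin _ hidem (by rw [pow_succ', ← mul_assoc, hez])
        (by rw [pow_succ, mul_assoc, hze]) fun h0 => htr ?_
      have hnil : IsNilpotent z.1 := ⟨m + 1, congrArg Subtype.val h0⟩
      exact (Matrix.isNilpotent_trace_of_isNilpotent hnil).eq_zero
    refine ⟨e * a * e * z ^ m * e, ?_, ?_, ?_⟩
    · simp only [← mul_assoc, he.eq]
    · simp only [mul_assoc, he.eq]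
    · have : x * (e * a * e * z ^ m * e) = z ^ (m + 1) * e := by
        rw [pow_succ']; simp only [z, mul_assoc]
      rw [this, hz, he.eq]
  -- Wedderburn's little theorem for the corner ring.
  have hcomm : ∀ x y : he.Corner, x * y = y * x := by
    have hfin : Finite he.Corner := inferInstanceAs (Finite (Subtype _))
    have hnt : Nontrivial he.Corner :=
      ⟨0, 1, fun h => hne (congrArg Subtype.val h).symm⟩
    have hnz : NoZeroDivisors he.Corner := by
      refine ⟨fun {x z} hxz => ?_⟩
      by_contra! h
      have hz := (Subsemigroup.mem_corner_iff he).1 z.2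
      obtain ⟨y, -, -, hy⟩ := hinv z.1 hz.1 hz.2 fun h0 => h.2 (Subtype.ext h0)
      have hx := (Subsemigroup.mem_corner_iff he).1 x.2
      refine h.1 (Subtype.ext ?_)
      have hxz' : (x.1 : A) * z.1 = 0 := congrArg Subtype.val hxz
      calc (x.1 : A) = x.1 * (z.1 * y) := by rw [hy]; exact hx.2.symm
        _ = 0 := by rw [← mul_assoc, hxz', zero_mul]
    have := NoZeroDivisors.to_isDomain he.Corner
    exact (Finite.isDomain_to_isField he.Corner).mul_comm
  have hA : ∀ a b : A, (e * a * e) * (e * b * e) = (e * b * e) * (e * a * e) := fun a b =>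
    congrArg Subtype.val (hcomm ⟨e * a * e, ⟨a, rfl⟩⟩ ⟨e * b * e, ⟨b, rfl⟩⟩)
  have hidem : e.1 * e.1 = e.1 := congrArg Subtype.val he.eq
  -- Commutativity of the corner of `A` extends by linearity to the full matrix algebra.
  obtain ⟨v, w, hvw, heq⟩ := exists_vecMulVec_of_commute_corner hidem
    (fun h => hne (Subtype.ext h)) fun X Y => by
      have hmem : ∀ X : Matrix ι ι F, X ∈ Submodule.span F (Set.range fun g => (ρ g).val) :=
        fun X => by simp [hρ.span_eq_top]
      induction hmem X using Submodule.span_induction with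
      | mem x hx =>
        obtain ⟨g, rfl⟩ := hx
        induction hmem Y using Submodule.span_induction with
        | mem y hy =>
          obtain ⟨h, rfl⟩ := hy
          exact congrArg Subtype.val
            (hA ⟨_, coe_mem_imageAlgebra ρ g⟩ ⟨_, coe_mem_imageAlgebra ρ h⟩)
        | zero => simp
        | add x y _ _ hx hy => simp only [mul_add, add_mul, hx, hy]
        | smul c x _ hx => simp only [Matrix.mul_smul, Matrix.smul_mul, hx]
      | zero => simp
      | add x y _ _ hx hy => simp only [mul_add, add_mul, hx, hy]
      | smul c x _ hx => simp only [Matrix.mul_smul, Matrix.smul_mul, hx]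
  exact ⟨v, w, hvw, heq ▸ e.2⟩

end RankOne

/-! ### Reduction modulo the maximal ideal -/

/-- Residually absolutely irreducible representations have separating image: a nonzero matrix
orthogonal to the image can be scaled to be integral with a unit entry, and its reduction would be
orthogonal to the residual image. -/
theorem traceSeparating_of_isResiduallyAbsIrreducible {ι G F : Type*} [Fintype ι] [DecidableEq ι]
    [Group G] [Field F] {O : ValuationSubring F} {ρ : G →* GL ι F}
    (h : IsResiduallyAbsIrreducible O ρ) : TraceSeparating ρ := by
  obtain ⟨M, ρ₀, hM, habs⟩ := h
  have hres := traceSeparating_of_isAbsIrreducible habs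
  refine TraceSeparating.of_conj
    (ρ := (GeneralLinearGroup.map (algebraMap O F)).comp ρ₀) ?_ M hM
  intro B hB
  by_contra hB0
  obtain ⟨i₀, j₀, -⟩ : ∃ i j, B i j ≠ 0 := by
    by_contra h
    push Not at h
    exact hB0 (Matrix.ext h)
  have : Nonempty (ι × ι) := ⟨(i₀, j₀)⟩
  obtain ⟨⟨i, j⟩, hmax⟩ := Finite.exists_max fun x : ι × ι => O.valuation (B x.1 x.2)
  have hij : B i j ≠ 0 := by
    intro h0
    refine hB0 (Matrix.ext fun i' j' => ?_)
    have h1 := hmax (i', j')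
    simp only [h0, map_zero] at h1
    exact (map_eq_zero O.valuation).1 (le_zero_iff.1 h1)
  have hint : ∀ i' j', (B i j)⁻¹ * B i' j' ∈ O := by
    intro i' j'
    rw [← O.valuation_le_one_iff, map_mul, map_inv₀]
    exact (inv_mul_le_one₀ ((zero_lt_iff).2 ((map_ne_zero O.valuation).2 hij))).2 (hmax (i', j'))
  let B₀ : Matrix ι ι O := Matrix.of fun i' j' => ⟨_, hint i' j'⟩
  have hB₀ : B₀.map (algebraMap O F) = (B i j)⁻¹ • B := by ext; rfl
  have h0 := hres (B₀.map (IsLocalRing.residue O)) fun g => by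
    have h1 : trace (B₀ * (ρ₀ g).val) = 0 := by
      refine (FaithfulSMul.algebraMap_injective O F) ?_
      rw [map_zero]
      refine (AddMonoidHom.map_trace (algebraMap O F : O →+ F) _).trans ?_
      change trace ((B₀ * (ρ₀ g).val).map (algebraMap O F)) = 0
      rw [Matrix.map_mul, hB₀, Matrix.smul_mul, trace_smul]
      have h2 : trace (B * (ρ₀ g).val.map (algebraMap O F)) = 0 := hB g
      rw [h2, smul_zero]
    have h3 := congrArg (IsLocalRing.residue O) h1
    rw [map_zero] at h3
    rw [← h3]
    change trace (B₀.map (IsLocalRing.residue O) * (ρ₀ g).val.map (IsLocalRing.residue O)) = _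
    rw [← Matrix.map_mul]
    exact (AddMonoidHom.map_trace (IsLocalRing.residue O).toAddMonoidHom _).symm
  have h1 : IsLocalRing.residue O (B₀ i j) = 0 := congrFun (congrFun h0 i) j
  have h2 : B₀ i j = 1 := Subtype.ext (inv_mul_cancel₀ hij)
  rw [h2, map_one] at h1
  exact one_ne_zero h1

theorem IsResAbsIrreducible.traceSeparating {ι K L G : Type*} [Fintype ι] [DecidableEq ι]
    [Field K] [Field L] [Algebra K L] [TopologicalSpace K] [TopologicalSpace L]
    [S : CoefficientExtension K L] [Group G] {ρ : G →* GL ι L}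
    (h : IsResAbsIrreducible K ρ) : TraceSeparating ρ := by
  obtain ⟨-, -, h⟩ | ⟨ℓ, _, _, _, _, _, -, h⟩ := h.finite_or_adic
  · exact traceSeparating_of_isAbsIrreducible h
  · exact traceSeparating_of_isResiduallyAbsIrreducible h

theorem IsResAbsIrreducible.nonempty {ι K L G : Type*} [Fintype ι] [DecidableEq ι]
    [Field K] [Field L] [Algebra K L] [TopologicalSpace K] [TopologicalSpace L]
    [S : CoefficientExtension K L] [Group G] {ρ : G →* GL ι L}
    (h : IsResAbsIrreducible K ρ) : Nonempty ι := by
  obtain ⟨-, -, h⟩ | ⟨ℓ, _, _, _, _, _, -, M, ρ₀, -, h⟩ := h.finite_or_adic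
  · exact nonempty_of_isAbsIrreducible h
  · exact nonempty_of_isAbsIrreducible h

/-- The trace of a matrix of finite order is a sum of roots of unity. -/
theorem isIntegral_trace_of_pow_eq_one {ι k R : Type*} [Fintype ι] [DecidableEq ι] [Field k]
    [CommRing R] [Algebra R k] {X : Matrix ι ι k} {N : ℕ} (hN : 0 < N) (hX : X ^ N = 1) :
    IsIntegral R (trace X) := by
  let Ω := AlgebraicClosure k
  rw [← isIntegral_algebraMap_iff (B := Ω) (algebraMap k Ω).injective]
  have h1 : algebraMap k Ω (trace X) = trace (X.map (algebraMap k Ω)) :=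
    AddMonoidHom.map_trace (algebraMap k Ω : k →+ Ω) X
  have hX' : (X.map (algebraMap k Ω)) ^ N = 1 := by
    rw [← Matrix.map_pow, hX, Matrix.map_one _ (map_zero _) (map_one _)]
  rw [h1, Matrix.trace_eq_sum_roots_charpoly]
  refine IsIntegral.multiset_sum fun μ hμ => ?_
  refine IsIntegral.of_pow hN ?_
  have hroot := Polynomial.isRoot_of_mem_roots hμ
  rw [← Matrix.mem_spectrum_iff_isRoot_charpoly] at hroot
  have h2 : μ ^ N ∈ spectrum Ω ((X.map (algebraMap k Ω)) ^ N) := spectrum.pow_mem_pow _ _ hroot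
  rw [hX'] at h2
  obtain hι | hι := isEmpty_or_nonempty ι
  · simp [spectrum.of_subsingleton] at h2
  · rw [spectrum.one_eq, Set.mem_singleton_iff] at h2
    rw [h2]
    exact isIntegral_one

/-! ### Simple eigenvalues -/

/-- Removing a simple root from the characteristic polynomial of `a` gives a polynomial whose value
at `a` is a multiple of the projection onto the corresponding eigenline. -/
theorem exists_rank_one_of_simple_root {ι E F : Type*} [Fintype ι] [DecidableEq ι] [Field E]
    [Field F] [Algebra E F] (A : Subalgebra E (Matrix ι ι F)) {a : Matrix ι ι F} (ha : a ∈ A)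
    {f : Polynomial E} (hf : f.map (algebraMap E F) = a.charpoly) {x : E} (hx : f.eval x = 0)
    (hx' : f.derivative.eval x ≠ 0) :
    ∃ v w : ι → F, w ⬝ᵥ v = 1 ∧ vecMulVec v w ∈ A := by
  set y := algebraMap E F x
  obtain ⟨q, rfl⟩ := Polynomial.dvd_iff_isRoot.2 hx
  have hq : q.eval x ≠ 0 := by simpa using hx'
  have hy : a.charpoly.IsRoot y := by
    rw [← hf, Polynomial.IsRoot, Polynomial.eval_map_algebraMap, Polynomial.aeval_algebraMap_apply,
      Polynomial.coe_aeval_eq_eval, hx, map_zero]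
  have hy' : ¬ a.charpoly.derivative.IsRoot y := by
    rw [← hf, Polynomial.derivative_map, Polynomial.IsRoot, Polynomial.eval_map_algebraMap,
      Polynomial.aeval_algebraMap_apply, Polynomial.coe_aeval_eq_eval]
    exact fun h => hx' ((map_eq_zero _).1 h)
  have hmult : a.charpoly.rootMultiplicity y ≤ 1 := by
    by_contra! h
    exact hy' ((Polynomial.one_lt_rootMultiplicity_iff_isRoot a.charpoly_monic.ne_zero).1 h).2
  let φ : Module.End F (ι → F) := Matrix.toLinAlgEquiv' a
  have hφ : φ.charpoly = a.charpoly := Matrix.charpoly_toLin' a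
  have hdim : Module.finrank F (φ.eigenspace y) ≤ 1 := by
    refine (LinearMap.finrank_eigenspace_le _ _).trans ?_
    rwa [hφ]
  obtain ⟨v, hv⟩ : ∃ v, φ.HasEigenvector y v := by
    refine Module.End.HasEigenvalue.exists_hasEigenvector ?_
    rwa [Module.End.hasEigenvalue_iff_isRoot_charpoly, hφ]
  have hav : a *ᵥ v = y • v := hv.apply_eq_smul
  have hline : ∀ u, a *ᵥ u = y • u → ∃ c : F, c • v = u := by
    intro u hu
    have hmem : u ∈ φ.eigenspace y := Module.End.mem_eigenspace_iff.2 hu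
    have hpos : 1 ≤ Module.finrank F (φ.eigenspace y) :=
      Submodule.one_le_finrank_iff.2 fun h => hv.2 (by
        have : v ∈ φ.eigenspace y := hv.1
        rw [h] at this
        exact this)
    obtain ⟨c, hc⟩ := exists_smul_eq_of_finrank_eq_one (le_antisymm hdim hpos)
      (x := (⟨v, hv.1⟩ : φ.eigenspace y))
      (fun h => hv.2 (congrArg Subtype.val h)) ⟨u, hmem⟩
    exact ⟨c, congrArg Subtype.val hc⟩
  -- Every column of `e = q(a)` lies in the eigenline of `v`.
  set e := Polynomial.aeval a q
  have heA : e ∈ A := by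
    have h1 : e = A.val (Polynomial.aeval (⟨a, ha⟩ : A) q) := by
      rw [← Polynomial.aeval_algHom_apply]
      rfl
    rw [h1]
    exact Subtype.property _
  have hae : a * e = y • e := by
    have h1 : Polynomial.aeval a ((Polynomial.X - Polynomial.C x) * q) = 0 := by
      rw [← Polynomial.aeval_map_algebraMap F, hf, Matrix.aeval_self_charpoly]
    rw [map_mul, map_sub, Polynomial.aeval_X, Polynomial.aeval_C, sub_mul, sub_eq_zero,
      ← Algebra.smul_def, ← algebraMap_smul F] at h1
    exact h1
  have hcol : ∀ j, ∃ c : F, c • v = fun i => e i j := fun j => hline _ (by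
    ext i
    exact congrFun (congrFun hae i) j)
  choose w hw using hcol
  have hform : e = vecMulVec v w := by
    ext i j
    rw [vecMulVec_apply, mul_comm]
    exact (congrFun (hw j) i).symm
  have hev : e *ᵥ v = (algebraMap E F (q.eval x)) • v := by
    have h1 := Module.End.aeval_apply_of_mem_apply_eq_smul (p := q.map (algebraMap E F))
      hv.apply_eq_smul
    rw [Polynomial.aeval_map_algebraMap, Polynomial.eval_map_algebraMap,
      Polynomial.aeval_algebraMap_apply, Polynomial.coe_aeval_eq_eval] at h1
    rw [← h1]
    have h2 := Polynomial.aeval_algHom_apply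
      ((Matrix.toLinAlgEquiv' (R := F) (n := ι)).toAlgHom.restrictScalars E) a q
    exact (LinearMap.congr_fun h2 v).symm
  have hwv : w ⬝ᵥ v = algebraMap E F (q.eval x) := by
    rw [hform, vecMulVec_mulVec] at hev
    obtain ⟨i, hi⟩ := Function.ne_iff.1 hv.2
    have h1 := congrFun hev i
    simp only [Pi.smul_apply, smul_eq_mul, MulOpposite.smul_eq_mul_unop, MulOpposite.unop_op] at h1
    rw [mul_comm] at h1
    exact mul_right_cancel₀ hi h1
  refine ⟨v, algebraMap E F (q.eval x)⁻¹ • w, ?_, ?_⟩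
  · rw [smul_dotProduct, hwv, smul_eq_mul, ← map_mul, inv_mul_cancel₀ hq, map_one]
  · rw [vecMulVec_smul, ← hform, algebraMap_smul]
    exact A.smul_mem heA _

section Lifting

open Polynomial

/-! ### Hensel's lemma for algebraic extensions of `ℚ_[ℓ]` -/

section Hensel

variable {ℓ : ℕ} [Fact ℓ.Prime] {F : Type*} [Field F] [Algebra ℚ_[ℓ] F]
  [Algebra.IsAlgebraic ℚ_[ℓ] F]

theorem mem_adicIntegers {x : F} : x ∈ adicIntegers ℓ F ↔ spectralNorm ℚ_[ℓ] F x ≤ 1 := Iff.rfl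

theorem mem_maximalIdeal_adicIntegers {x : adicIntegers ℓ F} :
    x ∈ IsLocalRing.maximalIdeal (adicIntegers ℓ F) ↔ spectralNorm ℚ_[ℓ] F x < 1 := by
  rw [IsLocalRing.mem_maximalIdeal, mem_nonunits_iff, ← not_le, not_iff_not]
  constructor
  · intro h
    obtain ⟨y, hy⟩ := h.exists_right_inv
    have hxy : (x : F) * (y : F) = 1 := congrArg Subtype.val hy
    have h1 : spectralNorm ℚ_[ℓ] F (x : F) * spectralNorm ℚ_[ℓ] F (y : F) = 1 := by
      rw [← spectralNorm_mul_eq, hxy, spectralNorm_one]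
    have h2 : spectralNorm ℚ_[ℓ] F (y : F) ≤ 1 := mem_adicIntegers.1 y.2
    nlinarith [spectralNorm_nonneg (K := ℚ_[ℓ]) (x : F)]
  · intro h
    have hx : (x : F) ≠ 0 := by
      intro h0
      rw [h0, spectralNorm_zero] at h
      exact absurd h (by norm_num)
    have h1 : spectralNorm ℚ_[ℓ] F (x : F) * spectralNorm ℚ_[ℓ] F (x : F)⁻¹ = 1 := by
      rw [← spectralNorm_mul_eq, mul_inv_cancel₀ hx, spectralNorm_one]
    have h2 : (x : F)⁻¹ ∈ adicIntegers ℓ F := by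
      rw [mem_adicIntegers]
      nlinarith [spectralNorm_nonneg (K := ℚ_[ℓ]) (x : F)⁻¹]
    exact IsUnit.of_mul_eq_one ⟨_, h2⟩ (Subtype.ext (mul_inv_cancel₀ hx))

/-- The inclusion of valuation rings in a tower of algebraic extensions of `ℚ_[ℓ]`. -/
noncomputable def adicIntegersMap (ℓ : ℕ) [Fact ℓ.Prime] (F F' : Type*) [Field F] [Field F']
    [Algebra ℚ_[ℓ] F] [Algebra ℚ_[ℓ] F'] [Algebra F F'] [IsScalarTower ℚ_[ℓ] F F']
    [Algebra.IsAlgebraic ℚ_[ℓ] F] [Algebra.IsAlgebraic ℚ_[ℓ] F'] :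
    adicIntegers ℓ F →+* adicIntegers ℓ F' :=
  ((algebraMap F F').comp (adicIntegers ℓ F).subtype).codRestrict (adicIntegers ℓ F') fun x => by
    change spectralNorm ℚ_[ℓ] F' (algebraMap F F' x) ≤ 1
    rw [← spectralNorm.eq_of_tower]
    exact x.2

variable {F' : Type*} [Field F'] [Algebra ℚ_[ℓ] F'] [Algebra F F'] [IsScalarTower ℚ_[ℓ] F F']
  [Algebra.IsAlgebraic ℚ_[ℓ] F']

theorem coe_adicIntegersMap (x : adicIntegers ℓ F) :
    (adicIntegersMap ℓ F F' x : F') = algebraMap F F' x := rfl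

theorem adicIntegersMap_mem_maximalIdeal {x : adicIntegers ℓ F} :
    adicIntegersMap ℓ F F' x ∈ IsLocalRing.maximalIdeal (adicIntegers ℓ F') ↔
      x ∈ IsLocalRing.maximalIdeal (adicIntegers ℓ F) := by
  rw [mem_maximalIdeal_adicIntegers, mem_maximalIdeal_adicIntegers, coe_adicIntegersMap,
    ← spectralNorm.eq_of_tower]

/-- Two roots of a polynomial that reduce to the same simple root modulo the maximal ideal agree. -/
theorem eq_of_isRoot_of_sub_mem {R : Type*} [CommRing R] [IsDomain R] [IsLocalRing R] {f : R[X]}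
    {a r s : R} (ha : IsUnit (f.derivative.eval a)) (hr : f.IsRoot r) (hs : f.IsRoot s)
    (hra : r - a ∈ IsLocalRing.maximalIdeal R) (hsa : s - a ∈ IsLocalRing.maximalIdeal R) :
    r = s := by
  obtain ⟨k, hk⟩ := binomExpansion f r (s - r)
  rw [add_sub_cancel, hr.eq_zero, hs.eq_zero, zero_add] at hk
  have hsr : s - r ∈ IsLocalRing.maximalIdeal R := by
    have := sub_mem hsa hra
    rwa [sub_sub_sub_cancel_right] at this
  have hunit : IsUnit (f.derivative.eval r + k * (s - r)) := by
    by_contra h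
    have h1 : f.derivative.eval r + k * (s - r) ∈ IsLocalRing.maximalIdeal R := h
    have h2 : f.derivative.eval r ∈ IsLocalRing.maximalIdeal R :=
      (Ideal.add_mem_iff_left _ (Ideal.mul_mem_left _ k hsr)).1 h1
    have h3 : f.derivative.eval r - f.derivative.eval a ∈ IsLocalRing.maximalIdeal R :=
      Ideal.mem_of_dvd _ (sub_dvd_eval_sub r a f.derivative) hra
    have h4 := sub_mem h2 h3
    rw [sub_sub_cancel] at h4
    exact h4 ha
  have h5 : (f.derivative.eval r + k * (s - r)) * (s - r) = 0 := by
    rw [hk]; ring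
  exact (sub_eq_zero.1 ((hunit.mul_right_eq_zero).1 h5)).symm

/-- Hensel's lemma for a simple root. Over an algebraic closure some root is congruent to `a`. By
uniqueness it is fixed by all automorphisms, so it lies in the base field. -/
theorem exists_isRoot_adicIntegers {f : (adicIntegers ℓ F)[X]} (hf : f.Monic)
    {a : adicIntegers ℓ F} (h0 : f.eval a ∈ IsLocalRing.maximalIdeal (adicIntegers ℓ F))
    (h1 : IsUnit (f.derivative.eval a)) :
    ∃ r : adicIntegers ℓ F, f.IsRoot r ∧ r - a ∈ IsLocalRing.maximalIdeal (adicIntegers ℓ F) := by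
  let Ω := AlgebraicClosure F
  have : Algebra.IsAlgebraic ℚ_[ℓ] Ω := Algebra.IsAlgebraic.trans ℚ_[ℓ] F Ω
  have : CharZero F := charZero_of_injective_algebraMap (algebraMap ℚ_[ℓ] F).injective
  let j := adicIntegersMap ℓ F Ω
  let p : Polynomial Ω := f.map ((algebraMap F Ω).comp (adicIntegers ℓ F).subtype)
  have hpeval : ∀ x : adicIntegers ℓ F,
      p.eval (algebraMap F Ω x) = algebraMap F Ω (f.eval x : adicIntegers ℓ F) :=
    fun x => by
      change p.eval (((algebraMap F Ω).comp (adicIntegers ℓ F).subtype) x) = _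
      rw [eval_map, eval₂_hom]
      rfl
  obtain ⟨r, hr, hra⟩ : ∃ r ∈ p.roots, spectralNorm ℚ_[ℓ] Ω (algebraMap F Ω a - r) < 1 := by
    by_contra! h
    have h2 := (IsAlgClosed.splits p).eval_eq_prod_roots_of_monic (hf.map _) (algebraMap F Ω a)
    rw [hpeval] at h2
    have h3 : ∀ s : Multiset Ω, (∀ r ∈ s, 1 ≤ spectralNorm ℚ_[ℓ] Ω (algebraMap F Ω a - r)) →
        1 ≤ spectralNorm ℚ_[ℓ] Ω (s.map fun r => algebraMap F Ω a - r).prod := by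
      intro s
      induction s using Multiset.induction with
      | empty => intro _; simp [spectralNorm_one]
      | cons x s ih =>
        intro hs
        rw [Multiset.map_cons, Multiset.prod_cons, spectralNorm_mul_eq]
        exact one_le_mul_of_one_le_of_one_le (hs x (Multiset.mem_cons_self x s))
          (ih fun y hy => hs y (Multiset.mem_cons_of_mem hy))
    have h4 := h3 _ h
    rw [← h2, ← spectralNorm.eq_of_tower] at h4
    exact (mem_maximalIdeal_adicIntegers.1 h0).not_ge h4
  have hroot := isRoot_of_mem_roots hr
  have hint : ∀ s : Ω, spectralNorm ℚ_[ℓ] Ω (algebraMap F Ω a - s) < 1 → s ∈ adicIntegers ℓ Ω := by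
    intro s hs
    have := sub_mem (j a).2 (show algebraMap F Ω a - s ∈ adicIntegers ℓ Ω from hs.le)
    rwa [coe_adicIntegersMap, sub_sub_cancel] at this
  -- Integral roots of `p` congruent to `a`, viewed in the valuation ring of `Ω`.
  have hlift : ∀ s (hs : spectralNorm ℚ_[ℓ] Ω (algebraMap F Ω a - s) < 1), p.IsRoot s →
      (f.map j).IsRoot ⟨s, hint s hs⟩ ∧
        (⟨s, hint s hs⟩ : adicIntegers ℓ Ω) - j a ∈
          IsLocalRing.maximalIdeal (adicIntegers ℓ Ω) := by
    intro s hs hps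
    refine ⟨Subtype.ext ?_, ?_⟩
    · have h2 : p = (f.map j).map (adicIntegers ℓ Ω).subtype := by rw [Polynomial.map_map]; rfl
      have h3 := hps.eq_zero
      rw [h2, show s = (adicIntegers ℓ Ω).subtype ⟨s, hint s hs⟩ from rfl, eval_map,
        eval₂_hom] at h3
      exact h3
    · rw [mem_maximalIdeal_adicIntegers]
      change spectralNorm ℚ_[ℓ] Ω (s - algebraMap F Ω a) < 1
      rwa [← neg_sub, spectralNorm_neg_eq]
  have hfix : ∀ σ : Gal(Ω/F), σ r = r := by
    intro σ
    have hσ : spectralNorm ℚ_[ℓ] Ω (algebraMap F Ω a - σ r) < 1 := by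
      rw [← σ.commutes, ← map_sub]
      have := spectralNorm_eq_of_equiv (σ.restrictScalars ℚ_[ℓ]) (algebraMap F Ω a - r)
      exact this ▸ hra
    have hσr : p.IsRoot (σ r) := by
      have h2 : p = (f.map (adicIntegers ℓ F).subtype).map (algebraMap F Ω) := by
        rw [Polynomial.map_map]
      have h3 := hroot.eq_zero
      rw [h2, eval_map_algebraMap] at h3
      rw [IsRoot, h2, eval_map_algebraMap, aeval_algHom_apply σ, h3, map_zero]
    have hu : IsUnit ((f.map j).derivative.eval (j a)) := by
      rw [derivative_map, eval_map, eval₂_hom]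
      exact h1.map j
    obtain ⟨h2, h3⟩ := hlift r hra hroot
    obtain ⟨h4, h5⟩ := hlift (σ r) hσ hσr
    exact congrArg Subtype.val (eq_of_isRoot_of_sub_mem hu h4 h2 h5 h3)
  obtain ⟨r, rfl⟩ := (InfiniteGalois.mem_range_algebraMap_iff_fixed r).2 hfix
  have hr1 : r ∈ adicIntegers ℓ F := by
    have := hint _ hra
    rwa [mem_adicIntegers, ← spectralNorm.eq_of_tower] at this
  refine ⟨⟨r, hr1⟩, ?_, ?_⟩
  · have h2 := hroot.eq_zero
    rw [show algebraMap F Ω r = algebraMap F Ω (⟨r, hr1⟩ : adicIntegers ℓ F) from rfl, hpeval] at h2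
    exact Subtype.ext ((map_eq_zero _).1 h2)
  · rw [mem_maximalIdeal_adicIntegers]
    rw [← map_sub, ← spectralNorm.eq_of_tower] at hra
    change spectralNorm ℚ_[ℓ] F (r - a) < 1
    rwa [← neg_sub, spectralNorm_neg_eq]

end Hensel

/-! ### Lifting rank one idempotents -/

/-- The traces of a representation with finite image in characteristic `p` generate a finite field:
they are finitely many and integral over the prime field. -/
theorem finite_subfield_closure_traces {ι G k : Type*} [Fintype ι] [DecidableEq ι] [Group G]
    [Field k] {p : ℕ} [Fact p.Prime] [CharP k p] (σ : G →* GL ι k) [σ.ker.FiniteIndex] :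
    Finite (Subfield.closure (Set.range fun g => trace (σ g).val)) := by
  set T := Set.range fun g => trace (σ g).val
  have hT : T.Finite := by
    have : Finite (G ⧸ σ.ker) := inferInstance
    have hr : Finite σ.range := Finite.of_equiv _ (QuotientGroup.quotientKerEquivRange σ).toEquiv
    refine (Set.finite_range fun x : σ.range => trace x.1.val).subset ?_
    rintro _ ⟨g, rfl⟩
    exact ⟨⟨σ g, g, rfl⟩, rfl⟩
  let : Algebra (ZMod p) k := ZMod.algebra k p
  have hint : ∀ x ∈ T, IsIntegral (ZMod p) x := by
    rintro _ ⟨g, rfl⟩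
    have h1 : σ (g ^ σ.ker.index) = 1 := σ.ker.pow_index_mem g
    refine isIntegral_trace_of_pow_eq_one (N := σ.ker.index)
      (Nat.pos_of_ne_zero Subgroup.FiniteIndex.index_ne_zero) ?_
    rw [← Units.val_pow_eq_pow_val, ← map_pow, h1, Units.val_one]
  have hTfin := hT.to_subtype
  have hfd : FiniteDimensional (ZMod p) (IntermediateField.adjoin (ZMod p) T) :=
    IntermediateField.finiteDimensional_adjoin hint
  have hfin : Finite (IntermediateField.adjoin (ZMod p) T) := Module.finite_of_finite (ZMod p)
  have hle : Subfield.closure T ≤ (IntermediateField.adjoin (ZMod p) T).toSubfield :=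
    Subfield.closure_le.2 (IntermediateField.subset_adjoin _ _)
  exact Finite.of_injective (fun x => (⟨x.1, hle x.2⟩ : IntermediateField.adjoin (ZMod p) T))
    fun x y h => Subtype.ext (Subtype.mk.inj h)

theorem conj_mem_imageAlgebra {ι G E F : Type*} [Fintype ι] [DecidableEq ι] [Group G] [Field E]
    [Field F] [Algebra E F] {ρ ρ' : G →* GL ι F} (M : GL ι F) (hM : ∀ g, ρ' g = M⁻¹ * ρ g * M)
    {a : Matrix ι ι F} (ha : a ∈ imageAlgebra E ρ') :
    M.val * a * M⁻¹.val ∈ imageAlgebra E ρ := by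
  refine imageAlgebra_induction (p := fun a => M.val * a * M⁻¹.val ∈ imageAlgebra E ρ) ?_
    (fun a b h1 h2 => ?_) (fun c g => ?_) ha
  · simp
  · rw [mul_add, add_mul]; exact add_mem h1 h2
  · rw [Matrix.mul_smul, Matrix.smul_mul, ← Units.val_mul, ← Units.val_mul]
    refine Subalgebra.smul_mem _ ?_ c
    have : M * ρ' g * M⁻¹ = ρ g := by rw [hM]; group
    rw [this]
    exact coe_mem_imageAlgebra ρ g

theorem charpoly_conj {ι R : Type*} [Fintype ι] [DecidableEq ι] [CommRing R] (M : GL ι R)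
    (a : Matrix ι ι R) : (M.val * a * M⁻¹.val).charpoly = a.charpoly := by
  rw [Matrix.coe_units_inv, Matrix.charpoly_units_conj]

section Charpoly

variable {ι G K L : Type*} [Fintype ι] [DecidableEq ι] [Group G] [Field K] [Field L] [Algebra K L]
  [IsGalois K L]

/-- If all conjugates of `ρ` by `Gal(L/E)` are equivalent to `ρ`, the elements of the `E`-algebra
spanned by `ρ` have their characteristic polynomials defined over `E`. -/
theorem exists_map_eq_charpoly {ρ : G →* GL ι L} {E : IntermediateField K L}
    (hconj : ∀ δ ∈ E.fixingSubgroup, ∃ M : GL ι L, ∀ g,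
      GeneralLinearGroup.map (δ : L →+* L) (ρ g) = M * ρ g * M⁻¹)
    {a : Matrix ι ι L} (ha : a ∈ imageAlgebra E ρ) :
    ∃ f : Polynomial E, f.map (algebraMap E L) = a.charpoly := by
  suffices h : a.charpoly ∈ lifts (algebraMap E L) by
    obtain ⟨f, hf⟩ := h
    exact ⟨f, hf⟩
  rw [lifts_iff_coeff_lifts]
  intro n
  suffices h : a.charpoly.coeff n ∈ IntermediateField.fixedField E.fixingSubgroup by
    rw [InfiniteGalois.fixedField_fixingSubgroup] at h
    exact ⟨⟨_, h⟩, rfl⟩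
  rintro ⟨δ, hδ⟩
  change δ (a.charpoly.coeff n) = _
  obtain ⟨M, hM⟩ := hconj δ hδ
  have h1 : a.map (δ : L →+* L) = M.val * a * M⁻¹.val := by
    refine imageAlgebra_induction (p := fun a => a.map (δ : L →+* L) = M.val * a * M⁻¹.val) ?_
      (fun a b h1 h2 => ?_) (fun c g => ?_) ha
    · simp
    · rw [mul_add, add_mul, ← h1, ← h2, Matrix.map_add _ (map_add _)]
    · rw [Matrix.mul_smul, Matrix.smul_mul, ← Units.val_mul, ← Units.val_mul, ← hM]
      ext i j
      have hc : δ (c : L) = c := (IntermediateField.mem_fixingSubgroup_iff _ _).1 hδ c c.2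
      change δ ((c : L) * (ρ g).val i j) = (c : L) * δ ((ρ g).val i j)
      rw [map_mul, hc]
  have h2 : a.charpoly.map (δ : L →+* L) = a.charpoly := by
    rw [← Matrix.charpoly_map, h1, charpoly_conj]
  have h3 := congrArg (fun q => coeff q n) h2
  simp only [coeff_map] at h3
  exact h3

end Charpoly

section Adic

variable {ℓ : ℕ} [Fact ℓ.Prime]

theorem charP_residueField_adicIntegers {F : Type*} [Field F] [Algebra ℚ_[ℓ] F]
    [Algebra.IsAlgebraic ℚ_[ℓ] F] : CharP (IsLocalRing.ResidueField (adicIntegers ℓ F)) ℓ := by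
  rw [CharP.charP_iff_prime_eq_zero Fact.out]
  rw [← map_natCast (IsLocalRing.residue (adicIntegers ℓ F)), IsLocalRing.residue_eq_zero_iff,
    mem_maximalIdeal_adicIntegers]
  have h1 : ((ℓ : adicIntegers ℓ F) : F) = algebraMap ℚ_[ℓ] F ℓ := by simp
  rw [h1, spectralNorm_extends]
  exact Padic.norm_p_lt_one

/-- The residual representation of a compact group has finite image, since the matrices congruent
to the identity form an open subgroup. -/
theorem finiteIndex_ker_residual {ι G L : Type*} [Fintype ι] [DecidableEq ι] [Group G]
    [TopologicalSpace G] [IsTopologicalGroup G] [CompactSpace G] [Field L] [TopologicalSpace L]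
    [IsTopologicalRing L] [Algebra ℚ_[ℓ] L] [Algebra.IsAlgebraic ℚ_[ℓ] L] (hL : IsAdicTopology ℓ L)
    {ρ : G →* GL ι L} (hρ : Continuous ρ) {M : GL ι L} {ρ₀ : G →* GL ι (adicIntegers ℓ L)}
    (hM : ∀ g, GeneralLinearGroup.map (algebraMap (adicIntegers ℓ L) L) (ρ₀ g) =
      M⁻¹ * ρ g * M) :
    ((GeneralLinearGroup.map (IsLocalRing.residue (adicIntegers ℓ L))).comp
      ρ₀).ker.FiniteIndex := by
  set σ := (GeneralLinearGroup.map (n := ι) (IsLocalRing.residue (adicIntegers ℓ L))).comp ρ₀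
  have hcont : Continuous fun g => (M⁻¹ * ρ g * M).val :=
    Units.continuous_val.comp ((continuous_const.mul hρ).mul continuous_const)
  have hent : ∀ i j, {g | spectralNorm ℚ_[ℓ] L ((M⁻¹ * ρ g * M).val i j - (1 : Matrix ι ι L) i j)
      < 1} ∈ nhds (1 : G) := by
    intro i j
    have h1 : Continuous fun g => (M⁻¹ * ρ g * M).val i j := hcont.matrix_elem i j
    refine h1.continuousAt.preimage_mem_nhds
      (t := {y | spectralNorm ℚ_[ℓ] L (y - (1 : Matrix ι ι L) i j) < 1}) ?_
    have h2 : (M⁻¹ * ρ 1 * M).val i j = (1 : Matrix ι ι L) i j := by simp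
    rw [h2]
    exact (hL _).mem_of_mem one_pos
  have hopen : IsOpen (σ.ker : Set G) := by
    refine σ.ker.isOpen_of_mem_nhds (g := 1) (Filter.mem_of_superset (Filter.iInter_mem.2
      fun i => Filter.iInter_mem.2 fun j => hent i j) fun g hg => ?_)
    refine MonoidHom.mem_ker.2 (Units.ext (Matrix.ext fun i j => ?_))
    have h1 := Set.mem_iInter.1 (Set.mem_iInter.1 hg i) j
    rw [Set.mem_ofPred_eq, ← hM] at h1
    have h2 : (((ρ₀ g).val - 1) i j) ∈ IsLocalRing.maximalIdeal (adicIntegers ℓ L) := by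
      rw [mem_maximalIdeal_adicIntegers]
      convert h1 using 2
      have h3 : (1 : Matrix ι ι L) =
          (1 : Matrix ι ι (adicIntegers ℓ L)).map (algebraMap (adicIntegers ℓ L) L) :=
        (Matrix.map_one _ (map_zero _) (map_one _)).symm
      rw [h3]
      rfl
    rw [← IsLocalRing.residue_eq_zero_iff, Matrix.sub_apply, map_sub, sub_eq_zero] at h2
    refine h2.trans ?_
    change ((1 : Matrix ι ι (adicIntegers ℓ L)).map (IsLocalRing.residue _)) i j = _
    rw [Matrix.map_one _ (map_zero _) (map_one _)]
    rfl
  have := σ.ker.quotient_finite_of_isOpen hopen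
  exact Subgroup.finiteIndex_of_finite_quotient

/-- The residues of the integers of `L` lying in an intermediate field `E`. -/
def residuesOf {K L : Type*} [Field K] [Field L] [Algebra K L] (O : ValuationSubring L)
    (E : IntermediateField K L) : Subfield (IsLocalRing.ResidueField O) where
  carrier := {x | ∃ o : O, (o : L) ∈ E ∧ IsLocalRing.residue O o = x}
  mul_mem' := by
    rintro _ _ ⟨a, ha, rfl⟩ ⟨b, hb, rfl⟩
    exact ⟨a * b, mul_mem ha hb, map_mul _ _ _⟩
  one_mem' := ⟨1, one_mem E, map_one _⟩
  add_mem' := by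
    rintro _ _ ⟨a, ha, rfl⟩ ⟨b, hb, rfl⟩
    exact ⟨a + b, add_mem ha hb, map_add _ _ _⟩
  zero_mem' := ⟨0, zero_mem E, map_zero _⟩
  neg_mem' := by
    rintro _ ⟨a, ha, rfl⟩
    exact ⟨-a, neg_mem ha, map_neg _ _⟩
  inv_mem' := by
    rintro _ ⟨a, ha, rfl⟩
    by_cases hu : IsUnit a
    · obtain ⟨u, rfl⟩ := hu
      have h1 : ((u.val : O) : L) * ((u⁻¹.val : O) : L) = 1 := by
        have := u.mul_inv
        exact congrArg (fun o : O => (o : L)) this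
      refine ⟨u⁻¹.val, ?_, ?_⟩
      · rw [eq_inv_of_mul_eq_one_right h1]
        exact inv_mem ha
      · refine eq_inv_of_mul_eq_one_right ?_
        rw [← map_mul, u.mul_inv, map_one]
    · have h0 : IsLocalRing.residue O a = 0 := by
        rwa [IsLocalRing.residue_eq_zero_iff, IsLocalRing.mem_maximalIdeal]
      exact ⟨0, zero_mem E, by rw [map_zero, h0, _root_.inv_zero]⟩

/-- Elements of the span of the residual image over residues of `E` lift to integral matrices in
the `E`-span of the image. -/
theorem exists_lift_mem_imageAlgebra {ι G K L : Type*} [Fintype ι] [DecidableEq ι] [Group G]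
    [Field K] [Field L] [Algebra K L] {O : ValuationSubring L} {E : IntermediateField K L}
    {k : Subfield (IsLocalRing.ResidueField O)} (hk : k ≤ residuesOf O E) {ρ₀ : G →* GL ι O}
    {x : Matrix ι ι (IsLocalRing.ResidueField O)}
    (hx : x ∈ imageAlgebra k ((GeneralLinearGroup.map (IsLocalRing.residue O)).comp ρ₀)) :
    ∃ a : Matrix ι ι O, a.map (IsLocalRing.residue O) = x ∧
      a.map (algebraMap O L) ∈
        imageAlgebra E ((GeneralLinearGroup.map (algebraMap O L)).comp ρ₀) := by
  refine imageAlgebra_induction (p := fun x => ∃ a : Matrix ι ι O,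
    a.map (IsLocalRing.residue O) = x ∧ a.map (algebraMap O L) ∈
      imageAlgebra E ((GeneralLinearGroup.map (algebraMap O L)).comp ρ₀)) ?_ ?_ ?_ hx
  · refine ⟨0, by simp, ?_⟩
    rw [Matrix.map_zero _ (map_zero _)]
    exact zero_mem _
  · rintro _ _ ⟨a, rfl, ha⟩ ⟨b, rfl, hb⟩
    refine ⟨a + b, Matrix.map_add _ (map_add _) _ _, ?_⟩
    rw [Matrix.map_add _ (map_add _)]
    exact add_mem ha hb
  · rintro ⟨c, hc⟩ g
    obtain ⟨o, ho, rfl⟩ := hk hc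
    refine ⟨o • (ρ₀ g).val, ?_, ?_⟩
    · ext i j
      exact map_mul (IsLocalRing.residue O) o ((ρ₀ g).val i j)
    · have h1 := Subalgebra.smul_mem _ (coe_mem_imageAlgebra (E := E)
        ((GeneralLinearGroup.map (algebraMap O L)).comp ρ₀) g) ⟨(o : L), ho⟩
      convert h1 using 1
      ext i j
      exact map_mul (algebraMap O L) o ((ρ₀ g).val i j)

/-- A matrix congruent to a rank one idempotent, whose characteristic polynomial is defined over
`E`, has a simple eigenvalue in `E`, by Hensel's lemma applied to the simple root `1` of the reduced
characteristic polynomial. -/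
theorem exists_simple_root_charpoly {ι E L : Type*} [Fintype ι] [DecidableEq ι] [Nonempty ι]
    [Field E] [Field L] [Algebra ℚ_[ℓ] E] [Algebra ℚ_[ℓ] L] [Algebra E L]
    [IsScalarTower ℚ_[ℓ] E L] [Algebra.IsAlgebraic ℚ_[ℓ] E] [Algebra.IsAlgebraic ℚ_[ℓ] L]
    {a : Matrix ι ι (adicIntegers ℓ L)}
    {v w : ι → IsLocalRing.ResidueField (adicIntegers ℓ L)} (hvw : w ⬝ᵥ v = 1)
    (ha : a.map (IsLocalRing.residue (adicIntegers ℓ L)) = vecMulVec v w) {f : Polynomial E}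
    (hf : f.map (algebraMap E L) = (a.map (algebraMap (adicIntegers ℓ L) L)).charpoly) :
    ∃ x : E, f.eval x = 0 ∧ f.derivative.eval x ≠ 0 := by
  set j := adicIntegersMap ℓ E L
  have hcoeff : ∀ n, algebraMap E L (f.coeff n) = (a.charpoly.coeff n : adicIntegers ℓ L) := by
    intro n
    rw [← coeff_map, hf, Matrix.charpoly_map, coeff_map]
    rfl
  obtain ⟨q, hq⟩ : f ∈ lifts (adicIntegers ℓ E).subtype := by
    rw [lifts_iff_coeff_lifts]
    intro n
    refine ⟨⟨f.coeff n, ?_⟩, rfl⟩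
    rw [mem_adicIntegers, spectralNorm.eq_of_tower (L := L), hcoeff]
    exact (a.charpoly.coeff n).2
  have hqmap : q.map j = a.charpoly := by
    ext n
    rw [coeff_map, ← hcoeff, coe_adicIntegersMap, ← hq]
    simp
  have hj : Function.Injective j := fun x y h =>
    Subtype.ext ((algebraMap E L).injective (congrArg Subtype.val h))
  have hmonic : q.Monic := monic_of_injective hj (hqmap ▸ a.charpoly_monic)
  -- The characteristic polynomial of a rank one idempotent.
  have hres : a.charpoly.map (IsLocalRing.residue (adicIntegers ℓ L)) =
      X ^ Fintype.card ι - X ^ (Fintype.card ι - 1) := by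
    rw [← Matrix.charpoly_map, ha, Matrix.charpoly_vecMulVec, dotProduct_comm, hvw, one_smul]
  have heval : ∀ p : Polynomial (adicIntegers ℓ E), IsLocalRing.residue _ (j (p.eval 1)) =
      ((p.map j).map (IsLocalRing.residue (adicIntegers ℓ L))).eval 1 := by
    intro p
    rw [Polynomial.map_map, eval_map, ← map_one ((IsLocalRing.residue _).comp j), eval₂_hom]
    rfl
  have h0 : q.eval 1 ∈ IsLocalRing.maximalIdeal (adicIntegers ℓ E) := by
    rw [← adicIntegersMap_mem_maximalIdeal (F' := L), ← IsLocalRing.residue_eq_zero_iff, heval,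
      hqmap, hres]
    simp
  have h1 : IsUnit (q.derivative.eval 1) := by
    by_contra h
    have h2 : q.derivative.eval 1 ∈ IsLocalRing.maximalIdeal (adicIntegers ℓ E) := h
    rw [← adicIntegersMap_mem_maximalIdeal (F' := L), ← IsLocalRing.residue_eq_zero_iff, heval,
      ← derivative_map, hqmap, ← derivative_map, hres] at h2
    obtain ⟨n, hn⟩ := Nat.exists_eq_succ_of_ne_zero (Fintype.card_ne_zero (α := ι))
    simp [hn, derivative_X_pow] at h2
  obtain ⟨r, hr, hr1⟩ := exists_isRoot_adicIntegers hmonic h0 h1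
  have hfe : ∀ p : Polynomial (adicIntegers ℓ E), (p.map (adicIntegers ℓ E).subtype).eval (r : E) =
      (p.eval r : adicIntegers ℓ E) := by
    intro p
    rw [eval_map]
    exact eval₂_hom (adicIntegers ℓ E).subtype r
  have hqf : q.map (adicIntegers ℓ E).subtype = f := hq
  refine ⟨r, ?_, fun h => ?_⟩
  · rw [← hqf, hfe, hr.eq_zero]
    rfl
  · rw [← hqf, derivative_map, hfe] at h
    have h2 : q.derivative.eval r = 0 := Subtype.ext h
    have h3 := Ideal.mem_of_dvd _ (sub_dvd_eval_sub r 1 q.derivative) hr1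
    rw [h2, zero_sub, neg_mem_iff] at h3
    exact h3 h1

/-- For a residually absolutely irreducible representation whose traces lie in `E` and which is
equivalent to its conjugates over `E`, the `E`-span of the image contains a rank one idempotent:
such an idempotent exists over the finite field of residual traces, and it lifts. -/
theorem exists_rank_one_of_isResiduallyAbsIrreducible {ι G K L : Type*} [Fintype ι] [DecidableEq ι]
    [Group G] [TopologicalSpace G] [IsTopologicalGroup G] [CompactSpace G] [Field K] [Field L]
    [Algebra K L] [IsGalois K L] [TopologicalSpace L] [IsTopologicalRing L] [Algebra ℚ_[ℓ] K]
    [Algebra ℚ_[ℓ] L] [IsScalarTower ℚ_[ℓ] K L] [Algebra.IsAlgebraic ℚ_[ℓ] L]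
    (hL : IsAdicTopology ℓ L) {ρ : G →* GL ι L} (hρ : Continuous ρ)
    (hirr : IsResiduallyAbsIrreducible (adicIntegers ℓ L) ρ) {E : IntermediateField K L}
    (ht : ∀ g, trace (ρ g).val ∈ E)
    (hconj : ∀ δ ∈ E.fixingSubgroup, ∃ M : GL ι L, ∀ g,
      GeneralLinearGroup.map (δ : L →+* L) (ρ g) = M * ρ g * M⁻¹) :
    ∃ v w : ι → L, w ⬝ᵥ v = 1 ∧ vecMulVec v w ∈ imageAlgebra E ρ := by
  obtain ⟨M, ρ₀, hM, habs⟩ := hirr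
  have := nonempty_of_isAbsIrreducible habs
  have hsep := traceSeparating_of_isAbsIrreducible habs
  have hker := finiteIndex_ker_residual hL hρ hM
  have := charP_residueField_adicIntegers (ℓ := ℓ) (F := L)
  set σ := (GeneralLinearGroup.map (n := ι) (IsLocalRing.residue (adicIntegers ℓ L))).comp ρ₀
  set k := Subfield.closure (Set.range fun g => trace (σ g).val)
  have hkfin : Finite k := finite_subfield_closure_traces (p := ℓ) σ
  have hk : k ≤ residuesOf (adicIntegers ℓ L) E := by
    refine Subfield.closure_le.2 ?_
    rintro _ ⟨g, rfl⟩
    refine ⟨trace (ρ₀ g).val, ?_,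
      AddMonoidHom.map_trace (IsLocalRing.residue (adicIntegers ℓ L)).toAddMonoidHom _⟩
    have h1 : ((trace (ρ₀ g).val : adicIntegers ℓ L) : L) = trace (M⁻¹ * ρ g * M).val := by
      rw [← hM]
      exact AddMonoidHom.map_trace (algebraMap (adicIntegers ℓ L) L).toAddMonoidHom _
    rw [h1, Units.val_mul, trace_mul_comm, ← Units.val_mul, mul_inv_cancel_left]
    exact ht g
  obtain ⟨v, w, hvw, hmem⟩ := exists_rank_one_mem_imageAlgebra (E := k) hsep fun g =>
    ⟨⟨_, Subfield.subset_closure ⟨g, rfl⟩⟩, rfl⟩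
  obtain ⟨a, ha, haE⟩ := exists_lift_mem_imageAlgebra hk hmem
  have haE' := conj_mem_imageAlgebra M hM haE
  obtain ⟨f, hf⟩ := exists_map_eq_charpoly hconj haE'
  have hf' : f.map (algebraMap E L) = (a.map (algebraMap (adicIntegers ℓ L) L)).charpoly := by
    rw [hf, charpoly_conj]
  have : IsScalarTower ℚ_[ℓ] E L := IsScalarTower.of_algebraMap_eq fun _ => rfl
  have : Algebra.IsAlgebraic ℚ_[ℓ] E :=
    Algebra.IsAlgebraic.of_injective (IsScalarTower.toAlgHom ℚ_[ℓ] E L)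
      (algebraMap E L).injective
  obtain ⟨x, hx, hx'⟩ := exists_simple_root_charpoly hvw ha hf'
  exact exists_rank_one_of_simple_root _ haE' hf hx hx'

end Adic

end Lifting

/-! ### Descent of the field of definition -/

section Descent

variable {ι G E F : Type*} [Fintype ι] [DecidableEq ι] [Group G] [Field E] [Field F] [Algebra E F]

/-- A spanning set contains the rows of an invertible matrix. -/
theorem exists_isUnit_of_mem_of_span_eq_top {S : Set (ι → F)} (hS : Submodule.span F S = ⊤) :
    ∃ u : ι → ι → F, (∀ i, u i ∈ S) ∧ IsUnit (Matrix.of u) := by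
  obtain ⟨f, hf, -, hlin⟩ := Submodule.exists_fun_fin_finrank_span_eq F S
  have hcard : Fintype.card ι = Module.finrank F (Submodule.span F S) := by
    rw [hS, finrank_top, Module.finrank_fintype_fun_eq_card]
  let e := Fintype.equivFinOfCardEq hcard
  refine ⟨fun i => f (e i), fun i => hf _, ?_⟩
  rw [← Matrix.linearIndependent_rows_iff_isUnit]
  exact hlin.comp e e.injective

/-- A homomorphism into `GL ι F` with all entries in a subfield comes from that subfield. -/
theorem exists_eq_map_of_entries {τ : G →* GL ι F}
    (h : ∀ g i j, (τ g).val i j ∈ (algebraMap E F).range) :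
    ∃ σ : G →* GL ι E, ∀ g, τ g = GeneralLinearGroup.map (algebraMap E F) (σ g) := by
  choose Y hY using h
  have hmap : ∀ g, (Matrix.of (Y g)).map (algebraMap E F) = (τ g).val := fun g => by
    ext i j
    exact hY g i j
  have hinj : Function.Injective fun A : Matrix ι ι E => A.map (algebraMap E F) :=
    Matrix.map_injective (algebraMap E F).injective
  let σ : G →* Matrix ι ι E :=
    { toFun := fun g => Matrix.of (Y g)
      map_one' := hinj (by
        change (Matrix.of (Y 1)).map _ = (1 : Matrix ι ι E).map _
        rw [hmap, map_one, Matrix.map_one _ (map_zero _) (map_one _), Units.val_one])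
      map_mul' := fun g h => hinj (by
        change (Matrix.of (Y (g * h))).map _ = (Matrix.of (Y g) * Matrix.of (Y h)).map _
        rw [hmap, map_mul, Matrix.map_mul, hmap, hmap, Units.val_mul]) }
  exact ⟨σ.toHomUnits, fun g => Units.ext (hmap g).symm⟩

/-- A rank one idempotent `v wᵀ` in the `E`-span of the image gives a descent to `E`: the vectors
`ρ g v` form an `E`-structure, because all pairings `wᵀ ρ g v` are traces of elements of the
`E`-span. -/
theorem exists_conj_eq_map {ρ : G →* GL ι F} (hρ : TraceSeparating ρ)
    (ht : ∀ g, trace (ρ g).val ∈ (algebraMap E F).range) {v w : ι → F} (hvw : w ⬝ᵥ v = 1)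
    (he : vecMulVec v w ∈ imageAlgebra E ρ) :
    ∃ (Q : GL ι F) (σ : G →* GL ι E),
      ∀ g, Q⁻¹ * ρ g * Q = GeneralLinearGroup.map (algebraMap E F) (σ g) := by
  have hX : ∀ X : Matrix ι ι F, X ∈ Submodule.span F (Set.range fun g => (ρ g).val) :=
    fun X => by simp [hρ.span_eq_top]
  have hv : Submodule.span F (Set.range fun g => (ρ g).val *ᵥ v) = ⊤ := by
    refine Submodule.eq_top_iff'.2 fun u => ?_
    have hu : vecMulVec u w *ᵥ v = u := by
      rw [vecMulVec_mulVec, hvw]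
      ext i
      simp
    rw [← hu]
    clear hu
    generalize vecMulVec u w = X
    induction hX X using Submodule.span_induction with
    | mem x hx => obtain ⟨g, rfl⟩ := hx; exact Submodule.subset_span ⟨g, rfl⟩
    | zero => simp
    | add x y _ _ hx hy => rw [add_mulVec]; exact add_mem hx hy
    | smul c x _ hx => rw [smul_mulVec]; exact Submodule.smul_mem _ c hx
  have hw : Submodule.span F (Set.range fun g => w ᵥ* (ρ g).val) = ⊤ := by
    refine Submodule.eq_top_iff'.2 fun u => ?_
    have hu : w ᵥ* vecMulVec v u = u := by
      rw [vecMul_vecMulVec, hvw, one_smul]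
    rw [← hu]
    clear hu
    generalize vecMulVec v u = X
    induction hX X using Submodule.span_induction with
    | mem x hx => obtain ⟨g, rfl⟩ := hx; exact Submodule.subset_span ⟨g, rfl⟩
    | zero => simp
    | add x y _ _ hx hy => rw [vecMul_add]; exact add_mem hx hy
    | smul c x _ hx => rw [vecMul_smul]; exact Submodule.smul_mem _ c hx
  -- The columns of `Q` are vectors `ρ g v` and the rows of `P` are covectors `wᵀ ρ g`, so that the
  -- entries of `P * ρ g * Q` are traces of elements of the `E`-span.
  obtain ⟨q, hq, hqu⟩ := exists_isUnit_of_mem_of_span_eq_top hv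
  obtain ⟨p, hp, hpu⟩ := exists_isUnit_of_mem_of_span_eq_top hw
  choose gq hgq using hq
  choose gp hgp using hp
  obtain ⟨Q, hQ⟩ := (Matrix.isUnit_transpose (A := Matrix.of q)).2 hqu
  obtain ⟨P, hP⟩ := hpu
  have hentry : ∀ g i j, (P * ρ g * Q).val i j ∈ (algebraMap E F).range := by
    intro g i j
    have h1 : (P * ρ g * Q).val i j = trace ((ρ (gp i * g * gq j)).val * vecMulVec v w) := by
      have hPi : P.val i = w ᵥ* (ρ (gp i)).val := by
        rw [hP]
        exact (hgp i).symm
      have hQj : (fun k => Q.val k j) = (ρ (gq j)).val *ᵥ v := by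
        rw [hQ]
        exact (hgq j).symm
      calc (P * ρ g * Q).val i j = P.val i ⬝ᵥ ((ρ g).val *ᵥ fun k => Q.val k j) := by
            rw [mul_assoc]; rfl
        _ = _ := by
            rw [hPi, hQj, ← dotProduct_mulVec, mulVec_mulVec, mulVec_mulVec, mul_vecMulVec,
              trace_vecMulVec, dotProduct_comm, ← Units.val_mul, ← Units.val_mul, ← map_mul,
              ← map_mul, mul_assoc]
    rw [h1]
    exact trace_mem_range_of_mem_imageAlgebra ht (mul_mem (coe_mem_imageAlgebra ρ _) he)
  obtain ⟨Y, hY⟩ : ∃ Y : GL ι E, GeneralLinearGroup.map (algebraMap E F) Y = P * Q := by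
    choose Y hY using hentry 1
    have hmap : (Matrix.of Y).map (algebraMap E F) = (P * Q).val := by
      ext i j
      rw [← mul_one P, ← map_one ρ]
      exact hY i j
    have hdet : (Matrix.of Y).det ≠ 0 := by
      intro h0
      have h1 : ((Matrix.of Y).map (algebraMap E F)).det = 0 := by
        rw [← RingHom.mapMatrix_apply, ← RingHom.map_det, h0, map_zero]
      rw [hmap] at h1
      exact (GeneralLinearGroup.det (P * Q)).ne_zero h1
    exact ⟨GeneralLinearGroup.mkOfDetNeZero _ hdet, Units.ext hmap⟩
  let τ : G →* GL ι F := ((MulAut.conj Q⁻¹).toMonoidHom).comp ρ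
  have hτ : ∀ g, τ g = Q⁻¹ * ρ g * Q := fun g => by simp [τ]
  obtain ⟨σ, hσ⟩ := exists_eq_map_of_entries (E := E) (τ := τ) fun g i j => by
    have h1 : τ g = GeneralLinearGroup.map (algebraMap E F) Y⁻¹ * (P * ρ g * Q) := by
      rw [map_inv, hY, hτ]
      group
    rw [h1, Units.val_mul, Matrix.mul_apply]
    exact sum_mem fun k _ => mul_mem ⟨Y⁻¹.val i k, rfl⟩ (hentry g k j)
  exact ⟨Q, σ, fun g => by rw [← hσ, hτ]⟩

end Descent

/-! ### Symplectic bases and invariant forms -/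

section Symplectic

variable {F : Type*} [Field F]

/-- An alternating nondegenerate form on a space of dimension `2m` admits `k ≤ m` pairs of vectors
spanning mutually orthogonal hyperbolic planes. -/
theorem exists_hyperbolic_family {m : ℕ} {B : Matrix (Fin m ⊕ Fin m) (Fin m ⊕ Fin m) F}
    (halt : ∀ x, x ⬝ᵥ B *ᵥ x = 0) (hB : IsUnit B) {k : ℕ} (hk : k ≤ m) :
    ∃ b : Fin k ⊕ Fin k → (Fin m ⊕ Fin m → F), ∀ p q, b p ⬝ᵥ B *ᵥ b q = Matrix.J (Fin k) F p q := by
  have hskew : ∀ x y, x ⬝ᵥ B *ᵥ y = -(y ⬝ᵥ B *ᵥ x) := by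
    intro x y
    have h := halt (x + y)
    rw [mulVec_add, add_dotProduct, dotProduct_add, dotProduct_add, halt, halt] at h
    linear_combination h
  induction k with
  | zero => exact ⟨fun p => 0, fun p => by rcases p with p | p <;> exact p.elim0⟩
  | succ k ih =>
    obtain ⟨b, hb⟩ := ih (by omega)
    let P : Matrix (Fin m ⊕ Fin m) (Fin k ⊕ Fin k) F := (Matrix.of b)ᵀ
    have hPB : Pᵀ * B * P = Matrix.J (Fin k) F := by
      ext p q
      rw [← hb, Matrix.mul_assoc]
      rfl
    -- The component of `x` orthogonal to the family constructed so far.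
    let π : (Fin m ⊕ Fin m → F) → (Fin m ⊕ Fin m → F) := fun x =>
      x + P *ᵥ (Matrix.J (Fin k) F *ᵥ (Pᵀ *ᵥ (B *ᵥ x)))
    have horth : ∀ x p, b p ⬝ᵥ B *ᵥ π x = 0 := by
      intro x
      have h1 : Pᵀ *ᵥ (B *ᵥ π x) = 0 := by
        have h2 : Pᵀ *ᵥ (B *ᵥ (P *ᵥ (Matrix.J (Fin k) F *ᵥ (Pᵀ *ᵥ (B *ᵥ x))))) =
            (Pᵀ * B * P * Matrix.J (Fin k) F) *ᵥ (Pᵀ *ᵥ (B *ᵥ x)) := by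
          simp only [mulVec_mulVec, Matrix.mul_assoc]
        rw [mulVec_add, mulVec_add, h2, hPB, Matrix.J_squared, neg_mulVec, one_mulVec,
          add_neg_cancel]
      exact fun p => congrFun h1 p
    have horth' : ∀ x p, π x ⬝ᵥ B *ᵥ b p = 0 := fun x p => by rw [hskew, horth, neg_zero]
    obtain ⟨x, hx⟩ : ∃ x, x ∉ LinearMap.range P.mulVecLin := by
      by_contra! h
      have h1 : LinearMap.range P.mulVecLin = ⊤ := Submodule.eq_top_iff'.2 h
      have h2 := LinearMap.finrank_range_le P.mulVecLin
      rw [h1, finrank_top, Module.finrank_fintype_fun_eq_card,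
        Module.finrank_fintype_fun_eq_card] at h2
      simp only [Fintype.card_sum, Fintype.card_fin] at h2
      omega
    have hx0 : π x ≠ 0 := by
      intro h0
      refine hx ⟨-(Matrix.J (Fin k) F *ᵥ (Pᵀ *ᵥ (B *ᵥ x))), ?_⟩
      rw [mulVecLin_apply, mulVec_neg]
      exact (eq_neg_of_add_eq_zero_left h0).symm
    obtain ⟨y, hy⟩ : ∃ y, π x ⬝ᵥ B *ᵥ y ≠ 0 := by
      by_contra! h
      refine hx0 (dotProduct_eq_zero _ fun z => ?_)
      obtain ⟨y, rfl⟩ := (Matrix.mulVec_surjective_iff_isUnit.2 hB) z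
      exact h y
    have hxy : π x ⬝ᵥ B *ᵥ π y = π x ⬝ᵥ B *ᵥ y := by
      have h1 : ∀ z, π x ⬝ᵥ B *ᵥ (P *ᵥ z) = 0 := by
        intro z
        have h2 : Pᵀ *ᵥ (B *ᵥ π x) = 0 := funext fun p => horth x p
        rw [hskew, dotProduct_comm, dotProduct_mulVec, ← mulVec_transpose, h2, zero_dotProduct,
          neg_zero]
      change _ ⬝ᵥ B *ᵥ (y + _) = _
      rw [mulVec_add, dotProduct_add, h1, add_zero]
    set c := π x ⬝ᵥ B *ᵥ y
    have hyx : π y ⬝ᵥ B *ᵥ π x = -c := by rw [hskew, hxy]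
    refine ⟨Sum.elim (Fin.cons (π x) fun i => b (Sum.inl i))
      (Fin.cons (-c⁻¹ • π y) fun i => b (Sum.inr i)), ?_⟩
    rintro (p | p) (q | q) <;> refine Fin.cases ?_ (fun p => ?_) p <;>
      refine Fin.cases ?_ (fun q => ?_) q
    all_goals
      simp only [Sum.elim_inl, Sum.elim_inr, Fin.cons_zero, Fin.cons_succ, mulVec_smul,
        dotProduct_smul, smul_dotProduct, halt, horth, horth', hb, hxy, hyx, smul_eq_mul, mul_zero,
        neg_mul, mul_neg, inv_mul_cancel₀ hy]
      simp [Matrix.J, Matrix.one_apply, Fin.succ_ne_zero, (Fin.succ_ne_zero _).symm]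

/-- Existence of a symplectic basis. -/
theorem exists_transpose_mul_mul_eq_J {m : ℕ} {B : Matrix (Fin m ⊕ Fin m) (Fin m ⊕ Fin m) F}
    (halt : ∀ x, x ⬝ᵥ B *ᵥ x = 0) (hB : IsUnit B) :
    ∃ P : GL (Fin m ⊕ Fin m) F, P.valᵀ * B * P.val = Matrix.J (Fin m) F := by
  obtain ⟨b, hb⟩ := exists_hyperbolic_family halt hB le_rfl
  have hPB : (Matrix.of b)ᵀᵀ * B * (Matrix.of b)ᵀ = Matrix.J (Fin m) F := by
    ext p q
    rw [← hb, Matrix.mul_assoc]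
    rfl
  have hdet : ((Matrix.of b)ᵀ).det ≠ 0 := by
    intro h0
    have h1 := congrArg det hPB
    rw [det_mul, h0, mul_zero] at h1
    exact (Matrix.isUnit_det_J (Fin m) F).ne_zero h1.symm
  exact ⟨GeneralLinearGroup.mkOfDetNeZero _ hdet, hPB⟩

/-- By Schur's lemma, the forms on which a separating representation acts through a given
multiplier are proportional. -/
theorem TraceSeparating.exists_eq_smul_form {ι G : Type*} [Fintype ι] [DecidableEq ι] [Group G]
    {ρ : G →* GL ι F} (hρ : TraceSeparating ρ) {B C : Matrix ι ι F} {m : G → F}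
    (hB : IsUnit B) (hBρ : ∀ g, (ρ g).valᵀ * B * (ρ g).val = m g • B)
    (hCρ : ∀ g, (ρ g).valᵀ * C * (ρ g).val = m g • C) : ∃ c : F, C = c • B := by
  obtain ⟨B, rfl⟩ := hB
  obtain ⟨c, hc⟩ := hρ.exists_eq_smul_one (B := B⁻¹.val * C) fun g => by
    have h1 : (ρ g).valᵀ * B.val * ((ρ g).val * (B⁻¹.val * C)) =
        (ρ g).valᵀ * B.val * (B⁻¹.val * C * (ρ g).val) := by
      calc _ = (ρ g).valᵀ * B.val * (ρ g).val * (B⁻¹.val * C) := by simp only [Matrix.mul_assoc]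
        _ = m g • C := by
          rw [hBρ, Matrix.smul_mul, ← Matrix.mul_assoc, ← Units.val_mul, mul_inv_cancel,
            Units.val_one, one_mul]
        _ = (ρ g).valᵀ * (B.val * B⁻¹.val) * C * (ρ g).val := by
          rw [← Units.val_mul, mul_inv_cancel, Units.val_one, mul_one, hCρ]
        _ = _ := by simp only [Matrix.mul_assoc]
    have hu : IsUnit ((ρ g).valᵀ * B.val) :=
      ((Matrix.isUnit_transpose (A := (ρ g).val)).2 (ρ g).isUnit).mul B.isUnit
    exact (hu.mul_left_cancel h1).symm
  refine ⟨c, ?_⟩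
  have h2 := congrArg (fun X => B.val * X) hc
  simp only [← Matrix.mul_assoc] at h2
  rw [← Units.val_mul, mul_inv_cancel, Units.val_one, one_mul] at h2
  rw [h2]
  simp

end Symplectic

/-! ### The field generated by the traces -/

section CoefficientField

variable {ι K L G : Type*} [Fintype ι] [DecidableEq ι] [Field K] [Field L] [Algebra K L]
  [Group G]

theorem map_trace_eq_of_conj {ρ : G →* GL ι L} {M : GL ι L} {γ : Gal(L/K)}
    (h : ∀ g, GeneralLinearGroup.map (γ : L →+* L) (ρ g) = M * ρ g * M⁻¹) (g : G) :
    γ (trace (ρ g).val) = trace (ρ g).val := by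
  have h1 := congrArg (fun X : GL ι L => trace X.val) (h g)
  simp only [Units.val_mul] at h1
  rw [trace_mul_comm, ← Units.val_mul, ← Units.val_mul, inv_mul_cancel_left] at h1
  exact (AddMonoidHom.map_trace (γ : L →+ L) (ρ g).val).trans h1

/-- An automorphism fixing the traces of `ρ` carries `ρ` to a conjugate representation. -/
theorem TraceSeparating.exists_conj_map {ρ : G →* GL ι L} (hρ : TraceSeparating ρ) {γ : Gal(L/K)}
    (h : ∀ g, γ (trace (ρ g).val) = trace (ρ g).val) :
    ∃ M : GL ι L, ∀ g, GeneralLinearGroup.map (γ : L →+* L) (ρ g) = M * ρ g * M⁻¹ :=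
  hρ.exists_conj (hρ.map_equiv γ.toRingEquiv) fun g =>
    (AddMonoidHom.map_trace (γ : L →+ L) _).symm.trans (h g)

/-- Continuity over a subfield with the subspace topology can be tested over the large field. -/
theorem continuous_of_continuous_map [TopologicalSpace L] {X : Type*} [TopologicalSpace X]
    {E : IntermediateField K L} {σ : X → GL ι E}
    (h : Continuous fun g => GeneralLinearGroup.map (algebraMap E L) (σ g)) : Continuous σ := by
  have key : ∀ f : X → Matrix ι ι E,
      (Continuous fun g => (f g).map (algebraMap E L)) → Continuous f := fun f hf =>
    continuous_matrix fun i j => continuous_induced_rng.2 (hf.matrix_elem i j)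
  rw [Units.continuous_iff] at h ⊢
  refine ⟨key _ h.1, key _ ?_⟩
  refine h.2.congr fun g => ?_
  simp only [← map_inv]
  rfl

/-- Equivalent representations have the same traces, and those of a representation defined over
`F` lie in `F`. -/
theorem trace_mem_of_definedOver [TopologicalSpace L] [TopologicalSpace G]
    {H : Subgroup (GL ι L)} {ρ ρ' : Rep G H} (h : ρ'.toClass = ρ.toClass)
    {F : IntermediateField K L} {HF : Subgroup (GL ι F)} (hF : ρ'.DefinedOver F HF) (g : G) :
    trace (ρ.hom g).val ∈ F := by
  obtain ⟨M, -, hM⟩ := Rep.toClass_eq_iff.1 h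
  obtain ⟨σ, hσ⟩ := hF
  have h1 : trace (ρ.hom g).val = trace (ρ'.hom g).val := by
    rw [hM, Units.val_mul, trace_mul_comm, ← Units.val_mul, inv_mul_cancel_left]
  rw [h1, hσ]
  exact (AddMonoidHom.map_trace (algebraMap F L : F →+ L) (σ.hom g).val) ▸ (trace (σ.hom g).val).2

variable [TopologicalSpace K] [TopologicalSpace L] [CoefficientExtension K L] [TopologicalSpace G]
  {H : Subgroup (GL ι L)}

/-- An absolutely irreducible (residually so, if `K` is `ℓ`-adic) representation admits a rank one
idempotent in the span of its image over any subfield containing the traces. -/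
theorem IsResAbsIrreducible.exists_rank_one [IsGalois K L] [IsTopologicalGroup G] [CompactSpace G]
    {ρ : Rep G H} (hρ : IsResAbsIrreducible K ρ.hom) {E : IntermediateField K L}
    (ht : ∀ g, trace (ρ.hom g).val ∈ E) :
    ∃ v w : ι → L, w ⬝ᵥ v = 1 ∧ vecMulVec v w ∈ imageAlgebra E ρ.hom := by
  have hsep := hρ.traceSeparating
  have := hρ.nonempty
  have := CoefficientExtension.isTopologicalRing K L
  obtain ⟨_, _, -⟩ | ⟨ℓ, _, _, _, _, _, hL, hirr⟩ := hρ.finite_or_adic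
  · -- The finitely many traces generate a finite subfield.
    set T := Set.range fun g => trace (ρ.hom g).val
    have hT : T.Finite := (isCompact_range (continuous_trace_hom ρ)).finite_of_discrete
    have : Finite T := hT
    have : FiniteDimensional K (IntermediateField.adjoin K T) :=
      IntermediateField.finiteDimensional_adjoin fun x _ => Algebra.IsIntegral.isIntegral x
    have : Finite (IntermediateField.adjoin K T) := Module.finite_of_finite K
    obtain ⟨v, w, hvw, hmem⟩ := exists_rank_one_mem_imageAlgebra
      (E := IntermediateField.adjoin K T) hsep fun g =>
        ⟨⟨_, IntermediateField.subset_adjoin K T ⟨g, rfl⟩⟩, rfl⟩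
    refine ⟨v, w, hvw, imageAlgebra_induction (p := (· ∈ imageAlgebra E ρ.hom)) (zero_mem _)
      (fun a b => add_mem) (fun c g => ?_) hmem⟩
    have hle : IntermediateField.adjoin K T ≤ E :=
      IntermediateField.adjoin_le_iff.2 (Set.range_subset_iff.2 ht)
    exact Subalgebra.smul_mem _ (coe_mem_imageAlgebra ρ.hom g) (⟨c.1, hle c.2⟩ : E)
  · exact exists_rank_one_of_isResiduallyAbsIrreducible hL ρ.continuous_hom hirr ht fun δ hδ =>
      hsep.exists_conj_map fun g => hδ ⟨_, ht g⟩

theorem IsResAbsIrreducible.exists_conj_eq_map [IsGalois K L] [IsTopologicalGroup G]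
    [CompactSpace G] {ρ : Rep G H} (hρ : IsResAbsIrreducible K ρ.hom) {E : IntermediateField K L}
    (ht : ∀ g, trace (ρ.hom g).val ∈ E) :
    ∃ (Q : GL ι L) (σ : G →* GL ι E),
      ∀ g, Q⁻¹ * ρ.hom g * Q = GeneralLinearGroup.map (algebraMap E L) (σ g) := by
  obtain ⟨v, w, hvw, he⟩ := hρ.exists_rank_one ht
  exact InnerTwist.exists_conj_eq_map hρ.traceSeparating (fun g => ⟨⟨_, ht g⟩, rfl⟩) hvw he

theorem continuous_conj_hom [IsTopologicalRing L] (ρ : Rep G H) (M : GL ι L) :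
    Continuous fun g => M⁻¹ * ρ.hom g * M :=
  (continuous_const.mul ρ.continuous_hom).mul continuous_const

end CoefficientField

/-! ### Values of the characters of inner twists -/

/-- If `γ` acts on a root of unity `z` by `z ↦ z ^ a` and `e ^ 2 * z = z ^ a`, then `e` is, up to
sign, a power of `z`: the exponent `a` may be taken odd. -/
theorem map_eq_self_of_sq_mul_eq_pow {K L : Type*} [Field K] [Field L] [Algebra K L]
    {γ δ : Gal(L/K)} {z e : L} {N a : ℕ} (hN : 0 < N)
    (hz : z ^ N = 1) (ha : γ z = z ^ a) (he : e ^ 2 * z = z ^ a) (hδ : δ z = z) : δ e = e := by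
  have hz0 : z ≠ 0 := by
    rintro rfl
    rw [zero_pow hN.ne'] at hz
    exact zero_ne_one hz
  have hfin : IsOfFinOrder z := isOfFinOrder_iff_pow_eq_one.2 ⟨N, hN, hz⟩
  obtain ⟨b, hb⟩ : ∃ b, z ^ a = z ^ (2 * b + 1) := by
    obtain ⟨b, rfl⟩ | ⟨b, rfl⟩ := Nat.even_or_odd a
    · obtain ⟨s, hs⟩ | ⟨s, hs⟩ := Nat.even_or_odd (orderOf z)
      · -- An even power cannot generate a cyclic group of even order.
        exfalso
        have h1 : γ (z ^ s) = 1 := by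
          rw [map_pow, ha, ← pow_mul, show (b + b) * s = (s + s) * b by ring, ← hs, pow_mul,
            pow_orderOf_eq_one, one_pow]
        have h2 : z ^ s = 1 := γ.injective (h1.trans (map_one γ).symm)
        have h3 := orderOf_dvd_of_pow_eq_one h2
        have h4 := hfin.orderOf_pos
        have h5 := Nat.le_of_dvd (by omega) h3
        omega
      · refine ⟨b + s, ?_⟩
        rw [show 2 * (b + s) + 1 = (b + b) + (2 * s + 1) by ring, ← hs, pow_add z (b + b),
          pow_orderOf_eq_one, mul_one]
    · exact ⟨b, rfl⟩
  have hsq : e ^ 2 = (z ^ b) ^ 2 := by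
    refine mul_right_cancel₀ hz0 ?_
    rw [he, hb]
    ring
  obtain rfl | rfl := sq_eq_sq_iff_eq_or_eq_neg.1 hsq
  · rw [map_pow, hδ]
  · rw [map_neg, map_pow, hδ]

section Values

variable {ι K L G : Type*} [Fintype ι] [DecidableEq ι] [Field K] [Field L] [Algebra K L]
  [TopologicalSpace K] [TopologicalSpace L] [CoefficientExtension K L]
  [Group G] [TopologicalSpace G] {H : Subgroup (GL ι L)} [IsTwistStable K H]

theorem fieldE_eq_of_groupΔ_eq [IsGalois K L] {c : RepClass G H} {F : IntermediateField K L}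
    (h : groupΔ K c = F.fixingSubgroup) : fieldE K c = F := by
  rw [fieldE, h]
  exact InfiniteGalois.fixedField_fixingSubgroup F

/-- If `γ` multiplies a value of `ψ χ`, with `χ` valued in `K`, by `e`, then it multiplies the
value of `ψ` by `e`; as `ψ` has finite order, `e` is a power of that value. -/
theorem exists_mul_eq_pow {ψ : characters K L G} (hψ : IsOfFinOrder ψ) {χ : G →* Kˣ}
    {γ : Gal(L/K)} {g : G} {e d : L} (hd : d = ψ.1 g * algebraMap K L (χ g)) (h : γ d = e * d) :
    ∃ a : ℕ, γ (ψ.1 g : L) = (ψ.1 g : L) ^ a ∧ e * ψ.1 g = (ψ.1 g : L) ^ a := by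
  obtain ⟨a, ha⟩ := exists_map_eq_pow hψ γ g
  refine ⟨a, ha, ?_⟩
  have hχ : algebraMap K L (χ g) ≠ 0 := (map_ne_zero _).2 (χ g).ne_zero
  rw [hd, map_mul, AlgEquiv.commutes, ha, ← mul_assoc] at h
  exact (mul_right_cancel₀ hχ h).symm

theorem eq_of_mul_eq_pow {ψ : characters K L G} {g : G} {e : L} {a : ℕ}
    (h : e * ψ.1 g = (ψ.1 g : L) ^ a) : e = (ψ.1 (g ^ a * g⁻¹) : L) := by
  rw [map_mul, map_pow, map_inv, Units.val_mul, Units.val_pow_eq_pow_val, ← h, mul_assoc,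
    Units.mul_inv, mul_one]

theorem character_pow_orderOf (ψ : characters K L G) (g : G) : ψ.1 g ^ orderOf ψ = 1 :=
  congrArg (fun ε : characters K L G => ε.1 g) (pow_orderOf_eq_one ψ)

end Values

/-! ### General linear representations -/

section GeneralLinear

variable {ι K L G : Type*} [Fintype ι] [DecidableEq ι] [Field K] [Field L] [Algebra K L]
  [TopologicalSpace K] [TopologicalSpace L] [CoefficientExtension K L]
  [Group G] [TopologicalSpace G]

/-- `Δ` is the Galois group of `L` over the field generated by the traces. -/
theorem groupΔ_eq_fixingSubgroup_of_top {ρ : Rep G (⊤ : Subgroup (GL ι L))}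
    (hρ : TraceSeparating ρ.hom) :
    groupΔ K ρ.toClass = (IntermediateField.adjoin K
      (Set.range fun g => trace (ρ.hom g).val)).fixingSubgroup := by
  ext γ
  rw [mem_groupΔ_toClass, mem_fixingSubgroup_adjoin, Set.forall_mem_range]
  constructor
  · rintro ⟨M, -, hM⟩ g
    exact map_trace_eq_of_conj hM g
  · intro h
    obtain ⟨M, hM⟩ := hρ.exists_conj_map h
    exact ⟨M, Subgroup.mem_top M, hM⟩

/-- The field generated by the traces is the smallest field of definition. -/
theorem isLeast_adjoin_of_top [IsGalois K L] [IsTopologicalGroup G] [CompactSpace G]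
    {ρ : Rep G (⊤ : Subgroup (GL ι L))} (hρ : IsResAbsIrreducible K ρ.hom) :
    IsLeast {F : IntermediateField K L | ∃ ρ' : Rep G (⊤ : Subgroup (GL ι L)),
        ρ'.toClass = ρ.toClass ∧ ρ'.DefinedOver F ⊤}
      (IntermediateField.adjoin K (Set.range fun g => trace (ρ.hom g).val)) := by
  have := CoefficientExtension.isTopologicalRing K L
  constructor
  · obtain ⟨Q, σ, hσ⟩ := hρ.exists_conj_eq_map fun g => IntermediateField.subset_adjoin K
      (Set.range fun g => trace (ρ.hom g).val) ⟨g, rfl⟩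
    refine ⟨⟨(MulAut.conj Q⁻¹).toMonoidHom.comp ρ.hom, ?_, fun _ => Subgroup.mem_top _⟩,
      Rep.toClass_eq_iff.2 ⟨Q⁻¹, Subgroup.mem_top _, fun g => rfl⟩,
      ⟨σ, continuous_of_continuous_map ?_, fun _ => Subgroup.mem_top _⟩, fun g => ?_⟩
    · exact (continuous_conj_hom ρ Q).congr fun g => by simp
    · simp only [← hσ]
      exact continuous_conj_hom ρ Q
    · rw [← hσ]
      simp
  · rintro F ⟨ρ', h, hF⟩
    exact IntermediateField.adjoin_le_iff.2
      (Set.range_subset_iff.2 (trace_mem_of_definedOver h hF))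

end GeneralLinear

/-! ### Symplectic representations -/

section Similitudes

variable {F : Type*} [Field F] {m : ℕ}

theorem map_J {E : Type*} [Field E] (f : E →+* F) :
    (Matrix.J (Fin m) E).map f = Matrix.J (Fin m) F := by
  simp [Matrix.J, Matrix.fromBlocks_map, Matrix.map_neg]

theorem J_ne_zero (hm : 0 < m) : Matrix.J (Fin m) F ≠ 0 := by
  intro h
  have h1 := congrFun (congrFun h (Sum.inr ⟨0, hm⟩)) (Sum.inl ⟨0, hm⟩)
  simp [Matrix.J] at h1

theorem dotProduct_J_mulVec_self (x : Fin m ⊕ Fin m → F) : x ⬝ᵥ Matrix.J (Fin m) F *ᵥ x = 0 := by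
  rw [Matrix.J, Matrix.fromBlocks_mulVec, neg_mulVec]
  simp [dotProduct, mul_comm]

/-- For `0 < m` the multiplier is automatically nonzero. -/
theorem mem_GSp_of_eq_smul (hm : 0 < m) {A : GL (Fin m ⊕ Fin m) F} {c : F}
    (h : A.valᵀ * Matrix.J (Fin m) F * A.val = c • Matrix.J (Fin m) F) : A ∈ GSp m F := by
  have hc : c ≠ 0 := by
    rintro rfl
    rw [zero_smul] at h
    have h1 := (Units.mul_left_eq_zero A).1 h
    exact J_ne_zero hm (((Matrix.isUnit_transpose (A := A.val)).2 A.isUnit).mul_right_eq_zero.1 h1)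
  exact ⟨Units.mk0 c hc, h⟩

/-- Conjugation by a similitude preserves multipliers. -/
theorem transpose_conj_mul_J_mul_conj {M A : GL (Fin m ⊕ Fin m) F} (hM : M ∈ GSp m F) {a : F}
    (hA : A.valᵀ * Matrix.J (Fin m) F * A.val = a • Matrix.J (Fin m) F) :
    (M * A * M⁻¹).valᵀ * Matrix.J (Fin m) F * (M * A * M⁻¹).val = a • Matrix.J (Fin m) F := by
  obtain ⟨c, hc⟩ := hM
  have h1 : M.val * M⁻¹.val = 1 := M.mul_inv
  calc (M * A * M⁻¹).valᵀ * Matrix.J (Fin m) F * (M * A * M⁻¹).val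
      = (M⁻¹).valᵀ * (A.valᵀ * (M.valᵀ * Matrix.J (Fin m) F * M.val) * A.val) * M⁻¹.val := by
        simp only [Units.val_mul, Matrix.transpose_mul, Matrix.mul_assoc]
    _ = a • ((M⁻¹).valᵀ * ((c : F) • Matrix.J (Fin m) F) * M⁻¹.val) := by
        rw [hc]
        simp only [Matrix.mul_smul, Matrix.smul_mul, hA]
        rw [smul_comm]
    _ = a • ((M.val * M⁻¹.val)ᵀ * Matrix.J (Fin m) F * (M.val * M⁻¹.val)) := by
        rw [← hc]
        simp only [Matrix.transpose_mul, Matrix.mul_assoc]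
    _ = _ := by rw [h1]; simp

theorem transpose_map_mul_J_mul_map (γ : F →+* F) {A : Matrix (Fin m ⊕ Fin m) (Fin m ⊕ Fin m) F}
    {c : F} (h : Aᵀ * Matrix.J (Fin m) F * A = c • Matrix.J (Fin m) F) :
    (A.map γ)ᵀ * Matrix.J (Fin m) F * A.map γ = γ c • Matrix.J (Fin m) F := by
  have h1 := congrArg (fun B => B.map γ) h
  simpa [Matrix.map_mul, Matrix.transpose_map, Matrix.map_smul'] using h1

/-- A matrix over a subfield is a symplectic similitude if it is one over the large field: its
multiplier is an entry of `AᵀJA`. -/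
theorem mem_GSp_of_map_mem {E : Type*} [Field E] [Algebra E F] (hm : 0 < m)
    {A : GL (Fin m ⊕ Fin m) E} (hA : GeneralLinearGroup.map (algebraMap E F) A ∈ GSp m F) :
    A ∈ GSp m E := by
  obtain ⟨c, hc⟩ := hA
  set X := A.valᵀ * Matrix.J (Fin m) E * A.val
  have hX : X.map (algebraMap E F) = (c : F) • Matrix.J (Fin m) F := by
    rw [← hc, ← map_J (algebraMap E F), Matrix.map_mul, Matrix.map_mul, Matrix.transpose_map]
    rfl
  have hentry := congrFun (congrFun hX (Sum.inr ⟨0, hm⟩)) (Sum.inl ⟨0, hm⟩)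
  have hc' : algebraMap E F (X (Sum.inr ⟨0, hm⟩) (Sum.inl ⟨0, hm⟩)) = c := by
    simpa [Matrix.J] using hentry
  refine mem_GSp_of_eq_smul hm (c := X (Sum.inr ⟨0, hm⟩) (Sum.inl ⟨0, hm⟩))
    (Matrix.map_injective (algebraMap E F).injective ?_)
  change X.map (algebraMap E F) = (_ • Matrix.J (Fin m) E).map (algebraMap E F)
  rw [hX, Matrix.map_smul' _ _ _ (map_mul _), map_J, hc']

end Similitudes

section Symplectic

variable {K L G : Type*} [Field K] [Field L] [Algebra K L]
  [TopologicalSpace L] [Group G] [TopologicalSpace G] {m : ℕ}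

theorem Rep.mult_spec {ρ : Rep G (GSp m L)} (g : G) :
    (ρ.hom g).valᵀ * Matrix.J (Fin m) L * (ρ.hom g).val =
      (ρ.mult g : L) • Matrix.J (Fin m) L :=
  multiplier_spec ⟨ρ.hom g, ρ.mem g⟩

/-- The pairing transported by `Q` to a representation over `E` is, up to a scalar, defined
over `E`: normalised to have an entry equal to `1`, it is fixed by the Galois group of `L/E` by
Schur's lemma. -/
theorem exists_form_of_conj_eq_map [IsGalois K L] {ρ : Rep G (GSp m L)}
    (hρ : TraceSeparating ρ.hom) {E : IntermediateField K L} (hE : ∀ g, (ρ.mult g : L) ∈ E)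
    {Q : GL (Fin m ⊕ Fin m) L} {σ : G →* GL (Fin m ⊕ Fin m) E}
    (hσ : ∀ g, Q⁻¹ * ρ.hom g * Q = GeneralLinearGroup.map (algebraMap E L) (σ g)) (hm : 0 < m) :
    ∃ (B : Matrix (Fin m ⊕ Fin m) (Fin m ⊕ Fin m) E) (b : L), b ≠ 0 ∧
      Q.valᵀ * Matrix.J (Fin m) L * Q.val = b • B.map (algebraMap E L) := by
  set B := Q.valᵀ * Matrix.J (Fin m) L * Q.val with hBdef
  have hBunit : IsUnit B :=
    (((Matrix.isUnit_transpose (A := Q.val)).2 Q.isUnit).mul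
      ((Matrix.isUnit_iff_isUnit_det _).2 (Matrix.isUnit_det_J (Fin m) L))).mul Q.isUnit
  obtain ⟨i, j, hij⟩ : ∃ i j, B i j ≠ 0 := by
    by_contra! h
    have : Nonempty (Fin m ⊕ Fin m) := ⟨Sum.inl ⟨0, hm⟩⟩
    exact hBunit.ne_zero (Matrix.ext h)
  set B₁ := (B i j)⁻¹ • B with hB₁
  have hB₁unit : IsUnit B₁ := by
    rw [hB₁, Matrix.isUnit_iff_isUnit_det, det_smul]
    exact ((isUnit_iff_ne_zero.2 (inv_ne_zero hij)).pow _).mul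
      ((Matrix.isUnit_iff_isUnit_det _).1 hBunit)
  have hsep : TraceSeparating ((GeneralLinearGroup.map (algebraMap E L)).comp σ) := by
    refine hρ.of_conj Q⁻¹ fun g => ?_
    rw [MonoidHom.comp_apply, ← hσ]
    group
  have hinv : ∀ g, (GeneralLinearGroup.map (algebraMap E L) (σ g)).valᵀ * B₁ *
      (GeneralLinearGroup.map (algebraMap E L) (σ g)).val = (ρ.mult g : L) • B₁ := by
    intro g
    have h1 : Q.val * (GeneralLinearGroup.map (algebraMap E L) (σ g)).val =
        (ρ.hom g).val * Q.val := by
      rw [← hσ, ← Units.val_mul, ← Units.val_mul]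
      group
    rw [hB₁, Matrix.mul_smul, Matrix.smul_mul, smul_comm (ρ.mult g : L)]
    congr 1
    calc _ = (Q.val * (GeneralLinearGroup.map (algebraMap E L) (σ g)).val)ᵀ *
          Matrix.J (Fin m) L * (Q.val * (GeneralLinearGroup.map (algebraMap E L) (σ g)).val) := by
          simp only [hBdef, Matrix.transpose_mul, Matrix.mul_assoc]
      _ = Q.valᵀ * ((ρ.hom g).valᵀ * Matrix.J (Fin m) L * (ρ.hom g).val) * Q.val := by
          rw [h1]
          simp only [Matrix.transpose_mul, Matrix.mul_assoc]
      _ = _ := by rw [Rep.mult_spec, Matrix.mul_smul, Matrix.smul_mul]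
  have hfixed : ∀ δ ∈ E.fixingSubgroup, B₁.map δ = B₁ := by
    intro δ hδ
    obtain ⟨c, hc⟩ := hsep.exists_eq_smul_form hB₁unit hinv (C := B₁.map δ) fun g => by
      have h1 := congrArg (fun X => X.map (δ : L →+* L)) (hinv g)
      have h2 : ((GeneralLinearGroup.map (algebraMap E L) (σ g)).val).map (δ : L →+* L) =
          (GeneralLinearGroup.map (algebraMap E L) (σ g)).val := by
        ext k l
        exact hδ ((σ g).val k l)
      have h3 : (δ : L →+* L) (ρ.mult g : L) = ρ.mult g := hδ ⟨_, hE g⟩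
      simp only [Matrix.map_mul, Matrix.transpose_map, h2] at h1
      rw [Matrix.map_smul' (δ : L →+* L) (ρ.mult g : L) B₁ (map_mul _), h3] at h1
      exact h1
    have h1 : B₁ i j = 1 := by simp [hB₁, hij]
    have h2 := congrFun (congrFun hc i) j
    rw [Matrix.map_apply, Matrix.smul_apply, h1, map_one, smul_eq_mul, mul_one] at h2
    rw [hc, ← h2, one_smul]
  have hmem : ∀ k l, B₁ k l ∈ E := by
    intro k l
    rw [← InfiniteGalois.fixedField_fixingSubgroup E]
    rintro ⟨δ, hδ⟩
    exact congrFun (congrFun (hfixed δ hδ) k) l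
  refine ⟨Matrix.of fun k l => ⟨B₁ k l, hmem k l⟩, B i j, hij, ?_⟩
  have h1 : (Matrix.of fun k l => (⟨B₁ k l, hmem k l⟩ : E)).map (algebraMap E L) = B₁ := rfl
  rw [h1, hB₁, smul_smul, mul_inv_cancel₀ hij, one_smul]

/-- A descent of `ρ` as a linear representation can be corrected by a symplectic basis of the
descended form to a descent by a symplectic similitude. -/
theorem exists_GSp_conj_eq_map [IsGalois K L] (hm : 0 < m) {ρ : Rep G (GSp m L)}
    (hρ : TraceSeparating ρ.hom) {E : IntermediateField K L} (hE : ∀ g, (ρ.mult g : L) ∈ E)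
    {Q : GL (Fin m ⊕ Fin m) L} {σ : G →* GL (Fin m ⊕ Fin m) E}
    (hσ : ∀ g, Q⁻¹ * ρ.hom g * Q = GeneralLinearGroup.map (algebraMap E L) (σ g)) :
    ∃ M ∈ GSp m L, ∃ τ : G →* GL (Fin m ⊕ Fin m) E,
      ∀ g, M⁻¹ * ρ.hom g * M = GeneralLinearGroup.map (algebraMap E L) (τ g) := by
  obtain ⟨B, b, hb, hB⟩ := exists_form_of_conj_eq_map hρ hE hσ hm
  have hBunit : IsUnit B := by
    have h1 : IsUnit (b • B.map (algebraMap E L)) := hB ▸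
      (((Matrix.isUnit_transpose (A := Q.val)).2 Q.isUnit).mul
        ((Matrix.isUnit_iff_isUnit_det _).2 (Matrix.isUnit_det_J (Fin m) L))).mul Q.isUnit
    rw [Matrix.isUnit_iff_isUnit_det, det_smul, ← RingHom.mapMatrix_apply, ← RingHom.map_det,
      isUnit_iff_ne_zero] at h1
    rw [Matrix.isUnit_iff_isUnit_det, isUnit_iff_ne_zero]
    rintro h0
    simp [h0] at h1
  have halt : ∀ x, x ⬝ᵥ B *ᵥ x = 0 := by
    intro x
    refine (algebraMap E L).injective ?_
    set y : Fin m ⊕ Fin m → L := algebraMap E L ∘ x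
    have h1 : algebraMap E L (x ⬝ᵥ B *ᵥ x) = y ⬝ᵥ B.map (algebraMap E L) *ᵥ y := by
      rw [RingHom.map_dotProduct]
      congr 1
      exact funext fun i => RingHom.map_mulVec _ B x i
    have h2 : b * (y ⬝ᵥ B.map (algebraMap E L) *ᵥ y) = 0 := by
      rw [← smul_eq_mul, ← dotProduct_smul, ← smul_mulVec, ← hB, ← mulVec_mulVec, ← mulVec_mulVec,
        dotProduct_mulVec, vecMul_transpose, dotProduct_J_mulVec_self]
    rw [h1, map_zero]
    exact (mul_eq_zero.1 h2).resolve_left hb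
  obtain ⟨P, hP⟩ := exists_transpose_mul_mul_eq_J halt hBunit
  set P' := GeneralLinearGroup.map (algebraMap E L) P
  refine ⟨Q * P', mem_GSp_of_eq_smul hm (c := b) ?_, (MulAut.conj P⁻¹).toMonoidHom.comp σ,
    fun g => ?_⟩
  · have h1 := congrArg (fun X => X.map (algebraMap E L)) hP
    simp only [Matrix.map_mul, Matrix.transpose_map] at h1
    have h2 : P.val.map (algebraMap E L) = P'.val := rfl
    rw [map_J, h2] at h1
    calc (Q * P').valᵀ * Matrix.J (Fin m) L * (Q * P').val
        = P'.valᵀ * (Q.valᵀ * Matrix.J (Fin m) L * Q.val) * P'.val := by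
          simp only [Units.val_mul, Matrix.transpose_mul, Matrix.mul_assoc]
      _ = _ := by rw [hB, Matrix.mul_smul, Matrix.smul_mul, h1]
  · have h1 : (MulAut.conj P⁻¹).toMonoidHom.comp σ g = P⁻¹ * σ g * P := by simp
    rw [h1, map_mul, map_mul, map_inv, ← hσ]
    change _ = P'⁻¹ * _ * P'
    group

variable [TopologicalSpace K] [CoefficientExtension K L]

theorem map_mult_of_mem_innerTwists (hm : 0 < m) {ρ : Rep G (GSp m L)} {x : TwistGroup K L G}
    (hx : x ∈ innerTwists K ρ.toClass) (g : G) :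
    x.right (ρ.mult g : L) = (x.left.1 g : L) ^ 2 * ρ.mult g := by
  obtain ⟨M, hM, h⟩ := exists_conj_of_mem_innerTwists hx
  have h1 := transpose_map_mul_J_mul_map (x.right : L →+* L) (Rep.mult_spec (ρ := ρ) g)
  have h2 := transpose_conj_mul_J_mul_conj hM (Rep.mult_spec (ρ := ρ) g)
  change ((ρ.hom g).val.map x.right)ᵀ * _ * ((ρ.hom g).val.map x.right) = _ at h1
  rw [h g, Matrix.transpose_smul, Matrix.smul_mul, Matrix.smul_mul, Matrix.mul_smul, h2, smul_smul,
    smul_smul] at h1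
  rw [sq]
  exact (smul_left_injective L (J_ne_zero hm) h1).symm

/-- `Δ` is the Galois group of `L` over the field generated by the traces and the multipliers. -/
theorem groupΔ_eq_fixingSubgroup_of_GSp (hm : 0 < m) {ρ : Rep G (GSp m L)}
    (hρ : TraceSeparating ρ.hom) :
    groupΔ K ρ.toClass = (IntermediateField.adjoin K
      ((Set.range fun g => trace (ρ.hom g).val) ∪
        Set.range fun g => (ρ.mult g : L))).fixingSubgroup := by
  ext γ
  rw [mem_fixingSubgroup_adjoin]
  constructor
  · rintro h x (⟨g, rfl⟩ | ⟨g, rfl⟩)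
    · obtain ⟨M, -, hM⟩ := mem_groupΔ_toClass.1 h
      exact map_trace_eq_of_conj hM g
    · simpa using map_mult_of_mem_innerTwists hm (mem_groupΔ.1 h) g
  · intro h
    obtain ⟨M, hM⟩ := hρ.exists_conj_map (γ := γ) fun g => h _ (Or.inl ⟨g, rfl⟩)
    -- The form `MᵀJM` is `ρ`-invariant up to the multiplier of `ρ`, hence proportional to `J`.
    obtain ⟨c, hc⟩ := hρ.exists_eq_smul_form (m := fun g => (ρ.mult g : L))
      (B := Matrix.J (Fin m) L) (C := M.valᵀ * Matrix.J (Fin m) L * M.val)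
      ((Matrix.isUnit_iff_isUnit_det _).2 (Matrix.isUnit_det_J (Fin m) L))
      (fun g => Rep.mult_spec g) fun g => by
        have h1 := transpose_map_mul_J_mul_map (γ : L →+* L) (Rep.mult_spec (ρ := ρ) g)
        have h2 : (ρ.hom g).val.map (γ : L →+* L) = (M * ρ.hom g * M⁻¹).val :=
          congrArg Units.val (hM g)
        have h3 : (γ : L →+* L) (ρ.mult g : L) = ρ.mult g := h _ (Or.inr ⟨g, rfl⟩)
        have h4 : (M * ρ.hom g * M⁻¹).val * M.val = M.val * (ρ.hom g).val := by
          rw [← Units.val_mul, inv_mul_cancel_right, Units.val_mul]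
        rw [h2, h3] at h1
        calc (ρ.hom g).valᵀ * (M.valᵀ * Matrix.J (Fin m) L * M.val) * (ρ.hom g).val
            = (M.val * (ρ.hom g).val)ᵀ * Matrix.J (Fin m) L * (M.val * (ρ.hom g).val) := by
              simp only [Matrix.transpose_mul, Matrix.mul_assoc]
          _ = M.valᵀ * ((M * ρ.hom g * M⁻¹).valᵀ * Matrix.J (Fin m) L *
                (M * ρ.hom g * M⁻¹).val) * M.val := by
              rw [← h4]
              simp only [Matrix.transpose_mul, Matrix.mul_assoc]
          _ = _ := by rw [h1, Matrix.mul_smul, Matrix.smul_mul]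
    exact mem_groupΔ_toClass.2 ⟨M, mem_GSp_of_eq_smul hm hc, hM⟩

/-- The field generated by the traces and the multipliers is the smallest field of definition. -/
theorem isLeast_adjoin_of_GSp [IsGalois K L] [IsTopologicalGroup G] [CompactSpace G] (hm : 0 < m)
    {ρ : Rep G (GSp m L)} (hρ : IsResAbsIrreducible K ρ.hom) :
    IsLeast {F : IntermediateField K L | ∃ ρ' : Rep G (GSp m L),
        ρ'.toClass = ρ.toClass ∧ ρ'.DefinedOver F (GSp m F)}
      (IntermediateField.adjoin K ((Set.range fun g => trace (ρ.hom g).val) ∪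
        Set.range fun g => (ρ.mult g : L))) := by
  have := CoefficientExtension.isTopologicalRing K L
  set A := (Set.range fun g => trace (ρ.hom g).val) ∪ Set.range fun g => (ρ.mult g : L)
  constructor
  · obtain ⟨Q, σ, hσ⟩ := hρ.exists_conj_eq_map fun g =>
      IntermediateField.subset_adjoin K A (Or.inl ⟨g, rfl⟩)
    obtain ⟨M, hM, τ, hτ⟩ := exists_GSp_conj_eq_map hm hρ.traceSeparating
      (fun g => IntermediateField.subset_adjoin K A (Or.inr ⟨g, rfl⟩)) hσ
    have hmem : ∀ g, M⁻¹ * ρ.hom g * M ∈ GSp m L := fun g =>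
      mul_mem (mul_mem (inv_mem hM) (ρ.mem g)) hM
    refine ⟨⟨(MulAut.conj M⁻¹).toMonoidHom.comp ρ.hom, ?_, fun g => ?_⟩,
      Rep.toClass_eq_iff.2 ⟨M⁻¹, inv_mem hM, fun g => rfl⟩,
      ⟨τ, continuous_of_continuous_map ?_, fun g => mem_GSp_of_map_mem (F := L) hm ?_⟩,
      fun g => ?_⟩
    · exact (continuous_conj_hom ρ M).congr fun g => by simp
    · simpa using hmem g
    · simp only [← hτ]
      exact continuous_conj_hom ρ M
    · rw [← hτ]
      exact hmem g
    · rw [← hτ]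
      simp
  · rintro F ⟨ρ', h, hF⟩
    refine IntermediateField.adjoin_le_iff.2 (Set.union_subset
      (Set.range_subset_iff.2 (trace_mem_of_definedOver h hF)) (Set.range_subset_iff.2 fun g => ?_))
    obtain ⟨M, hM, hconj⟩ := Rep.toClass_eq_iff.1 h
    obtain ⟨σ, hσ⟩ := hF
    have h1 := transpose_conj_mul_J_mul_conj hM (Rep.mult_spec (ρ := ρ) g)
    obtain ⟨c, hc⟩ := σ.mem g
    have h2 := congrArg (fun X => X.map (algebraMap F L)) hc
    have h3 : (σ.hom g).val.map (algebraMap F L) = (M * ρ.hom g * M⁻¹).val := by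
      rw [← hconj, hσ]
      rfl
    simp only [Matrix.map_mul, Matrix.transpose_map] at h2
    rw [Matrix.map_smul' _ _ _ (map_mul _), map_J, h3, h1] at h2
    rw [smul_left_injective L (J_ne_zero hm) h2]
    exact (c : F).2

end Symplectic

end InnerTwist

open InnerTwist in
theorem mainTheorem6 {K : Type*} {L : Type*} [Field K] [Field L] [Algebra K L]
    [TopologicalSpace K] [TopologicalSpace L] [CoefficientExtension K L] [IsGalois K L]
    {G : Type*} [Group G] [TopologicalSpace G] [IsTopologicalGroup G] [CompactSpace G]
    (χ : G →* Kˣ) (hχ : Continuous χ)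
    (ψ : characters K L G) (hψ : IsOfFinOrder ψ) :
    -- general linear representations
    (∀ (n : ℕ) (ρ : Rep G (⊤ : Subgroup (GL (Fin n) L))),
      IsResAbsIrreducible K ρ.hom →
      (∀ g, Matrix.GeneralLinearGroup.det (ρ.hom g) =
        ψ.1 g * Units.map (algebraMap K L : K →* L) (χ g)) →
      (∀ (g : G) (x : L), x ^ n = (ψ.1 g : L) → x ∈ fieldE K ρ.toClass) →
      -- (a)
      (groupΔ K ρ.toClass ≤ groupΓ K ρ.toClass ∧
        IsOpen (((groupΔ K ρ.toClass).subgroupOf (groupΓ K ρ.toClass) :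
          Subgroup (groupΓ K ρ.toClass)) : Set (groupΓ K ρ.toClass)) ∧
        (∃ (_ : ((groupΔ K ρ.toClass).subgroupOf (groupΓ K ρ.toClass)).Normal)
          (h : fieldK K ρ.toClass ≤ fieldE K ρ.toClass),
          FiniteDimensional (fieldK K ρ.toClass) (IntermediateField.extendScalars h) ∧
          IsGalois (fieldK K ρ.toClass) (IntermediateField.extendScalars h) ∧
          ∃ e : (groupΓ K ρ.toClass ⧸ (groupΔ K ρ.toClass).subgroupOf (groupΓ K ρ.toClass)) ≃*
              Gal((IntermediateField.extendScalars h)/(fieldK K ρ.toClass)),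
            ∀ (γ : groupΓ K ρ.toClass) (x : IntermediateField.extendScalars h),
              ((e γ x : IntermediateField.extendScalars h) : L) = γ.1 (x : L)) ∧
        ∀ γ ∈ groupΓ K ρ.toClass,
          (fieldE K ρ.toClass).map (γ : L →ₐ[K] L) = fieldE K ρ.toClass) ∧
      -- (b)
      (IsLeast {F : IntermediateField K L | ∃ ρ' : Rep G (⊤ : Subgroup (GL (Fin n) L)),
          ρ'.toClass = ρ.toClass ∧ ρ'.DefinedOver F ⊤} (fieldE K ρ.toClass) ∧
        fieldE K ρ.toClass = IntermediateField.adjoin K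
          (Set.range fun g => Matrix.trace (ρ.hom g).val))) ∧
    -- symplectic representations
    (∀ (m : ℕ) (ρ : Rep G (GSp m L)),
      IsResAbsIrreducible K ρ.hom →
      (∀ g, ρ.mult g = ψ.1 g * Units.map (algebraMap K L : K →* L) (χ g)) →
      -- (a)
      (groupΔ K ρ.toClass ≤ groupΓ K ρ.toClass ∧
        IsOpen (((groupΔ K ρ.toClass).subgroupOf (groupΓ K ρ.toClass) :
          Subgroup (groupΓ K ρ.toClass)) : Set (groupΓ K ρ.toClass)) ∧
        (∃ (_ : ((groupΔ K ρ.toClass).subgroupOf (groupΓ K ρ.toClass)).Normal)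
          (h : fieldK K ρ.toClass ≤ fieldE K ρ.toClass),
          FiniteDimensional (fieldK K ρ.toClass) (IntermediateField.extendScalars h) ∧
          IsGalois (fieldK K ρ.toClass) (IntermediateField.extendScalars h) ∧
          ∃ e : (groupΓ K ρ.toClass ⧸ (groupΔ K ρ.toClass).subgroupOf (groupΓ K ρ.toClass)) ≃*
              Gal((IntermediateField.extendScalars h)/(fieldK K ρ.toClass)),
            ∀ (γ : groupΓ K ρ.toClass) (x : IntermediateField.extendScalars h),
              ((e γ x : IntermediateField.extendScalars h) : L) = γ.1 (x : L)) ∧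
        ∀ γ ∈ groupΓ K ρ.toClass,
          (fieldE K ρ.toClass).map (γ : L →ₐ[K] L) = fieldE K ρ.toClass) ∧
      -- (b)
      (NoCM K ρ.toClass →
        IsLeast {F : IntermediateField K L | ∃ ρ' : Rep G (GSp m L),
          ρ'.toClass = ρ.toClass ∧ ρ'.DefinedOver F (GSp m F)} (fieldE K ρ.toClass) ∧
        fieldE K ρ.toClass = IntermediateField.adjoin K
          ((Set.range fun g => Matrix.trace (ρ.hom g).val) ∪
            Set.range fun g => (ρ.mult g : L)))) := by
  have hψN := hψ.orderOf_pos
  refine ⟨fun n ρ hρ hdet hroot => ?_, fun m ρ hρ hmult => ?_⟩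
  · have hsep := hρ.traceSeparating
    have hne := hρ.nonempty
    have hn : 0 < n := Fin.pos_iff_nonempty.2 hne
    have hΔ := groupΔ_eq_fixingSubgroup_of_top (K := K) hsep
    have hE := fieldE_eq_of_groupΔ_eq hΔ
    -- The `n`-th powers of the values of an inner twist are values of `ψ`.
    have hpow : ∀ x ∈ innerTwists K ρ.toClass, ∀ g, ∃ g' : G,
        x.left.1 g ^ n = ψ.1 g' := by
      intro x hx g
      have h1 := map_det_of_mem_innerTwists hx g
      rw [Fintype.card_fin] at h1
      obtain ⟨a, -, ha⟩ := exists_mul_eq_pow hψ (congrArg Units.val (hdet g)) h1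
      exact ⟨g ^ a * g⁻¹, Units.ext (eq_of_mul_eq_pow ha)⟩
    refine ⟨galois_structure _ _ hΔ (fun x hx δ hδ g => ?_)
      (finite_left_innerTwists_toClass hρ (N := n * orderOf ψ) (by positivity)
        fun x hx g => ?_), ?_, hE⟩
    · obtain ⟨g', hg'⟩ := hpow x hx g
      exact hroot g' _ (by rw [← hg', Units.val_pow_eq_pow_val]) ⟨δ, hδ⟩
    · obtain ⟨g', hg'⟩ := hpow x hx g
      rw [pow_mul, hg', character_pow_orderOf]
    · rw [hE]
      exact isLeast_adjoin_of_top hρ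
  · have hsep := hρ.traceSeparating
    have hne := hρ.nonempty
    have hm : 0 < m := by
      obtain ⟨i | i⟩ := hne
      · exact i.pos
      · exact i.pos
    have hΔ := groupΔ_eq_fixingSubgroup_of_GSp (K := K) hm hsep
    have hE := fieldE_eq_of_groupΔ_eq hΔ
    have hpow : ∀ x ∈ innerTwists K ρ.toClass, ∀ g, ∃ a : ℕ,
        x.right (ψ.1 g : L) = (ψ.1 g : L) ^ a ∧
          (x.left.1 g : L) ^ 2 * ψ.1 g = (ψ.1 g : L) ^ a := fun x hx g =>
      exists_mul_eq_pow hψ (congrArg Units.val (hmult g)) (map_mult_of_mem_innerTwists hm hx g)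
    refine ⟨galois_structure _ _ hΔ (fun x hx δ hδ g => ?_)
      (finite_left_innerTwists_toClass hρ (N := 2 * orderOf ψ) (by positivity)
        fun x hx g => ?_), fun _ => ⟨?_, hE⟩⟩
    · obtain ⟨a, ha, he⟩ := hpow x hx g
      -- An inner twist with trivial character fixes the multiplier and hence the values of `ψ`.
      have h1 := map_mult_of_mem_innerTwists hm (mem_groupΔ.1 hδ) g
      obtain ⟨b, hb, hb'⟩ := exists_mul_eq_pow hψ (congrArg Units.val (hmult g)) h1
      refine map_eq_self_of_sq_mul_eq_pow hψN ?_ ha he ?_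
      · exact congrArg Units.val (character_pow_orderOf ψ g)
      · exact hb.trans (hb'.symm.trans (by simp))
    · obtain ⟨a, -, he⟩ := hpow x hx g
      have h1 : x.left.1 g ^ 2 = ψ.1 (g ^ a * g⁻¹) := Units.ext (by
        rw [Units.val_pow_eq_pow_val]
        exact eq_of_mul_eq_pow he)
      rw [pow_mul, h1, character_pow_orderOf]
    · rw [hE]
      exact isLeast_adjoin_of_GSp hm hρ
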